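/- Throughout, $A^k$ is the set of products $a_1\cdots a_k$ with all $a_i\in A$; a finite set $A$ in a group is symmetric if $A^{-1}=A$ and $K$-tripling if $|A^3|\le K|A|$; $|A\Gamma/\Gamma|$ is the number of left cosets of $\Gamma$ that meet $A$; $O_p(\Sigma)$ is the largest normal $p$-subgroup of a finite group $\Sigma$; and $\gamma_1(\Delta)=\Delta$, $\gamma_{k+1}(\Delta)=[\gamma_k(\Delta),\Delta]$. A subgroup of $\mathrm{GL}_n(\mathbf F)$ is trigonalizable if over some extension field $\mathbf E$ of $\mathbf F$ it is conjugate to a group of invertible upper-triangular matrices over $\mathbf E$. **Proposition.** For every integer $n\ge 2$ and every integer $c\ge 0$ there are integers $C,m\ge 0$, depending only on $n$ and $c$, such that the following holds. Let $\mathbf F$ be a finite field of characteristic $p$, let $K$ be a real number, let $A\subset\mathrm{GL}_n(\mathbf F)$ be a finite, nonempty, symmetric, $K$-tripling set, and let $G=\langle A\rangle$. Assume there are subgroups $P\le\Gamma\trianglelefteq G$, with $P$ characteristic in $\Gamma$, such that, with $\Sigma=\Gamma/P$, (i) $|A\Gamma/\Gamma|\le K^{c}$; (ii) $\Sigma$ is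 soluble; (iii) $P\subseteq A^6$; (iv) there is a trigonalizable subgroup $B\le\Gamma$ whose image in $\Sigma$ is all of $\Sigma$; (v) $G$, acting by conjugation, acts trivially on $\Sigma/O_p(\Sigma)$. Then there is a normal subgroup $\Delta\trianglelefteq G$ with $P\le\Delta\le\Gamma$ such that (1) $|A\Delta/\Delta|\le K^{C}$, and (2) $\gamma_n(\Delta)\subseteq A^{m}$. -/

import Mathlib

open scoped Pointwise

universe u

/-- The group `B_n(E)` of invertible upper-triangular `n × n` matrices. -/
def borelSubgroup (n : ℕ) (E : Type u) [Field E] : Subgroup (GL (Fin n) E) where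
  carrier := {g | (g : Matrix (Fin n) (Fin n) E).IsUpperTriangular}
  one_mem' := Matrix.blockTriangular_one
  mul_mem' {a b} ha hb := by
    have h := Matrix.BlockTriangular.mul (show Matrix.BlockTriangular _ id from ha)
      (show Matrix.BlockTriangular _ id from hb)
    simpa using h
  inv_mem' {a} ha := by
    have h := Matrix.blockTriangular_inv_of_blockTriangular
      (M := (a : Matrix (Fin n) (Fin n) E)) (show Matrix.BlockTriangular _ id from ha)
    simpa using h

/-- A subgroup `B ≤ GL_n(F)` is trigonalizable if, over some extension field `E` of `F`, it is
conjugate to a subgroup of `B_n(E)`. -/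
def IsTrigonalizable {n : ℕ} {F : Type u} [Field F] (B : Subgroup (GL (Fin n) F)) : Prop :=
  ∃ (E : Type u) (_ : Field E) (_ : Algebra F E) (g : GL (Fin n) E),
    (B.map (Matrix.GeneralLinearGroup.map (algebraMap F E))).map (MulAut.conj g).toMonoidHom
      ≤ borelSubgroup n E

/-- The `p`-core `O_p(S)` of a group `S`: the join of all normal `p`-subgroups of `S`. -/
def pCore (p : ℕ) (S : Type u) [Group S] : Subgroup S :=
  sSup {N | N.Normal ∧ IsPGroup p N}

instance pCore_normal (p : ℕ) (S : Type u) [Group S] : (pCore p S).Normal :=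
  Subgroup.sSup_normal _ fun _ h => h.1

/-- The `p`-core is the largest normal `p`-subgroup. -/
theorem pCore_isGreatest (p : ℕ) (S : Type u) [Group S] :
    IsGreatest {N : Subgroup S | N.Normal ∧ IsPGroup p N} (pCore p S) :=
  ⟨⟨pCore_normal p S, Sylow.sSup_of_normal _ (fun _ h => h.2) fun _ h => h.1⟩,
    fun _ h => le_sSup h⟩

/-- The section `Γ / P` of a group `L`, for subgroups `P ≤ Γ` of `L` (with `P` normal in `Γ` when
it is used as a group). -/
abbrev SectionOf {L : Type u} [Group L] (Γ P : Subgroup L) : Type u :=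
  Γ ⧸ P.subgroupOf Γ

/-- The trace `tr(A, Γ / P)`: the projection of `A ∩ Γ` to `Γ / P`. -/
def sectionTrace {L : Type u} [Group L] (A : Set L) (Γ P : Subgroup L) : Set (SectionOf Γ P) :=
  (fun x : Γ => (QuotientGroup.mk x : SectionOf Γ P)) '' {x : Γ | (x : L) ∈ A}

/-- For `G` normalizing `Γ` and `P`, and `M` a normal subgroup of `Γ / P` invariant under `G`:
the conjugation action of `G` on the quotient `(Γ / P) / M` is trivial. -/
def ActsTriviallyMod {L : Type u} [Group L] (G Γ P : Subgroup L) [(P.subgroupOf Γ).Normal]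
    (M : Subgroup (SectionOf Γ P)) : Prop :=
  ∀ g ∈ G, ∀ x y : Γ, (y : L) = g * x * g⁻¹ →
    (QuotientGroup.mk (QuotientGroup.mk y : SectionOf Γ P) : SectionOf Γ P ⧸ M) =
      QuotientGroup.mk (QuotientGroup.mk x : SectionOf Γ P)

/-- The number `|AΓ / Γ|` of left cosets of `Γ` that meet `A`. -/
noncomputable def cosetCount {L : Type u} [Group L] (A : Set L) (Γ : Subgroup L) : ℕ :=
  ((fun a : L => (QuotientGroup.mk a : L ⧸ Γ)) '' A).ncard

/-- `γ_k(D)` for `k ≥ 1`, with the indexing `γ_1(D) = D`, `γ_{k+1}(D) = [γ_k(D), D]`. -/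
def lowerCentralTerm {L : Type u} [Group L] (k : ℕ) (D : Subgroup L) : Subgroup L :=
  D.lowerCentralSeries (k - 1)

/-!
Work in the quotient of `G = ⟨A⟩` by `P`; since `P ⊆ A ^ 6`, containments in powers of `A` lift
back. Trigonalizing `B` and taking the unipotent part gives a nilpotent normal subgroup `U` of the
quotient, and reading off the matrix entries one diagonal after the other filters `U` by subgroups
`W k` such that an element of `Γ` acts on each `W k / W (k + 1)` as multiplication by a ratio of
two diagonal entries, hence either trivially or without fixed points.

Let `Δ ≤ Γ` be the centralizer of a maximal set of steps which is met by `A` up to boundedly many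
powers of `K` in index. On every other step `A ^ 4 ∩ Δ` meets many cosets of the centralizer, so a
greedy choice gives a set `T ⊆ A ^ 4 ∩ Δ` larger than a prescribed power of `K` such that the
quotient of any two elements of `T` acts without fixed points on all these steps. Let `e` be a
power of `p` annihilating `U`, let `D` be the subgroup generated by the `e`-th powers of `Δ`, and
let `S = D ∩ U`. Then `γ_n(Δ) ≤ S` and `S = [S, D]`, and `S` has to be covered by a bounded power
of `A`.

Sections `H / H'` of `S`, written additively, on which the action of `T` is free in this sense and
commutes with that of `A` are covered by pivoting inside balls `X` of vectors of bounded length.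
Take `T' ⊆ T` just larger than the growth constant of the balls. If no two of the sums `x + t y`
with `x ∈ X` and `t ∈ T'` coincided, a ball would grow by the factor `|T'|`, which is impossible
for `y` short. As `T'` commutes with the action of `A`, and applying `t - t'` to a coincidence
brings long vectors back into a ball, the set of `y` with a coincidence is stable under the
operations generating `H / H'`, so it is everything. Each `y` with a coincidence satisfies
`(t - t') y ∈ X - X` with `t - t'` injective, whence `|H / H'| ≤ |T'| ^ 2 |X - X|`. So the ball
`X - X` is dense, and as the map `(t, w) ↦ t w` from `T × (X - X)` is nearly equidistributed, a
bounded sum reaches every element.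

For the step from `γ_i(S)` to `γ_{i+1}(S)`, the commutator pairing of `S` with `γ_i(S)` is
equidistributed: as the translates of a proper subgroup by `T` are transverse, no nontrivial
character of the target has a large radical. Fourier analysis then covers the section by a bounded
number of sums of commutators.
-/

open scoped commutatorElement IsMulCommutative

section CharacterSums

open Finset

variable {Z I J : Type*} [AddCommGroup Z] [Fintype I] [Fintype J]

/-- The exponential sum `∑ⱼ ξ (f j)` of a family `f` of elements of `Z`: the Fourier coefficient
at `ξ` of the measure counting the members of `f` with multiplicity. -/
noncomputable def charSum (f : J → Z) (ξ : AddChar Z ℂ) : ℂ := ∑ j, ξ (f j)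

/-- A family is Fourier uniform with parameter `ε` if its nontrivial exponential sums are at most
`ε` times the trivial one. -/
def IsFourierUniform (f : I → Z) (ε : ℝ) : Prop :=
  ∀ ξ : AddChar Z ℂ, ξ ≠ 0 → ‖charSum f ξ‖ ≤ ε * Fintype.card I

theorem charSum_zero (f : J → Z) : charSum f 0 = Fintype.card J := by simp [charSum]

theorem charSum_add (f : I → Z) (g : J → Z) (ξ : AddChar Z ℂ) :
    charSum (fun q : I × J => f q.1 + g q.2) ξ = charSum f ξ * charSum g ξ := by
  simp only [charSum, AddChar.map_add_eq_mul, Fintype.sum_prod_type, sum_mul_sum]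

theorem charSum_sub_const (f : J → Z) (z : Z) (ξ : AddChar Z ℂ) :
    charSum (fun j => f j - z) ξ = charSum f ξ * ξ (-z) := by
  simp only [charSum, sub_eq_add_neg, AddChar.map_add_eq_mul, sum_mul]

theorem charSum_neg [Finite Z] (f : J → Z) (ξ : AddChar Z ℂ) :
    charSum (fun j => -f j) ξ = (starRingEnd ℂ) (charSum f ξ) := by
  simp only [charSum, map_sum, AddChar.map_neg_eq_conj]

theorem charSum_sub_self [Finite Z] (f : J → Z) (ξ : AddChar Z ℂ) :
    charSum (fun q : J × J => f q.1 - f q.2) ξ = ((‖charSum f ξ‖ ^ 2 : ℝ) : ℂ) := by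
  simp only [sub_eq_add_neg]
  rw [charSum_add f (fun j => -f j), charSum_neg, Complex.mul_conj, Complex.normSq_eq_norm_sq]

theorem sq_card_le_card_mul_card_collisions {Y : Type*} [DecidableEq Y]
    {W : Finset Y} {f : J → Y} (hf : ∀ j, f j ∈ W) :
    Fintype.card J ^ 2 ≤ #W * #{q : J × J | f q.1 = f q.2} := by
  have hfibers : Fintype.card J = ∑ w ∈ W, #{j | f j = w} :=
    card_eq_sum_card_fiberwise fun j _ => hf j
  have hpairs : #{q : J × J | f q.1 = f q.2} = ∑ w ∈ W, #{j | f j = w} ^ 2 := by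
    rw [card_eq_sum_card_fiberwise (f := fun q => f q.1) (t := W) fun q _ => hf q.1]
    refine sum_congr rfl fun w _ => ?_
    rw [sq, ← card_product]
    congr 1
    ext ⟨a, b⟩
    simp only [mem_filter, mem_univ, true_and, mem_product]
    exact ⟨fun ⟨hab, ha⟩ => ⟨ha, hab ▸ ha⟩, fun ⟨ha, hb⟩ => ⟨ha.trans hb.symm, ha⟩⟩
  rw [hfibers, hpairs]
  exact sq_sum_le_card_mul_sum_sq

section Parseval

variable [Fintype Z]

theorem sum_charSum [DecidableEq Z] (f : J → Z) :
    ∑ ξ : AddChar Z ℂ, charSum f ξ = Fintype.card Z * #{j | f j = 0} := by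
  simp only [charSum]
  rw [sum_comm]
  simp only [AddChar.sum_apply_eq_ite, ← sum_filter, sum_const, nsmul_eq_mul, mul_comm]

theorem sum_norm_charSum_sq [DecidableEq Z] (f : J → Z) :
    ∑ ξ : AddChar Z ℂ, ‖charSum f ξ‖ ^ 2 = Fintype.card Z * #{q : J × J | f q.1 = f q.2} := by
  have parseval := sum_charSum fun q : J × J => f q.1 - f q.2
  simp only [charSum_sub_self, sub_eq_zero] at parseval
  exact_mod_cast parseval

theorem sum_norm_charSum_sq_of_injective {f : J → Z} (hf : Function.Injective f) :
    ∑ ξ : AddChar Z ℂ, ‖charSum f ξ‖ ^ 2 = Fintype.card Z * Fintype.card J := by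
  classical
  have hdiag : ({q : J × J | f q.1 = f q.2} : Finset (J × J)) = univ.diag := by
    ext q
    simp [hf.eq_iff]
  rw [sum_norm_charSum_sq, hdiag, diag_card, card_univ]

theorem sum_norm_charSum_coe_sq (X : Finset Z) :
    ∑ ξ : AddChar Z ℂ, ‖charSum (fun x : X => (x : Z)) ξ‖ ^ 2 = Fintype.card Z * #X := by
  rw [sum_norm_charSum_sq_of_injective Subtype.val_injective, Fintype.card_coe]

end Parseval

theorem card_le_sum_norm_charSum [Finite Z] {f : J → Z} (hf : ∀ j, f j ≠ 0) :
    (Fintype.card J : ℝ) ≤ ∑ ξ ∈ univ.erase (0 : AddChar Z ℂ), ‖charSum f ξ‖ := by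
  classical
  have := Fintype.ofFinite Z
  have hsum : ∑ ξ : AddChar Z ℂ, charSum f ξ = 0 := by simp [sum_charSum, hf]
  rw [← add_sum_erase _ _ (mem_univ (0 : AddChar Z ℂ)), charSum_zero] at hsum
  calc (Fintype.card J : ℝ) = ‖(Fintype.card J : ℂ)‖ := by simp
    _ = ‖∑ ξ ∈ univ.erase (0 : AddChar Z ℂ), charSum f ξ‖ := by
      rw [eq_neg_of_add_eq_zero_left hsum, norm_neg]
    _ ≤ _ := norm_sum_le _ _

namespace IsFourierUniform

variable [Fintype Z] {Φ : I → Z} {ε : ℝ} {X : Finset Z}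

theorem exists_sub_add_eq [Nonempty I] (hΦ : IsFourierUniform Φ ε) (hε₀ : 0 ≤ ε)
    (hε : ε * Fintype.card Z < #X) (z : Z) :
    ∃ x ∈ X, ∃ x' ∈ X, ∃ i, x - x' + Φ i = z := by
  classical
  by_contra! hz
  have hX : (0 : ℝ) < #X := lt_of_le_of_lt (by positivity) hε
  have : (0 : ℝ) < Fintype.card I := by exact_mod_cast Fintype.card_pos
  set ι : X → Z := fun x => x
  have hcard : (#X : ℝ) ^ 2 * Fintype.card I ≤
      ∑ ξ ∈ univ.erase (0 : AddChar Z ℂ), ‖charSum ι ξ‖ ^ 2 * ‖charSum Φ ξ‖ := by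
    convert card_le_sum_norm_charSum
      (f := fun q : (X × X) × I => (ι q.1.1 - ι q.1.2 + Φ q.2) - z)
      fun q => sub_ne_zero.2 (hz _ q.1.1.2 _ q.1.2.2 q.2) using 2 with ξ
    · simp [sq]
    · rw [charSum_sub_const, charSum_add (fun q : X × X => ι q.1 - ι q.2) Φ, charSum_sub_self,
        norm_mul, norm_mul, AddChar.norm_apply, Complex.norm_real, mul_one,
        Real.norm_of_nonneg (by positivity)]
  have hbound : ∑ ξ ∈ univ.erase (0 : AddChar Z ℂ), ‖charSum ι ξ‖ ^ 2 * ‖charSum Φ ξ‖ ≤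
      (Fintype.card Z * #X) * (ε * Fintype.card I) := by
    rw [← sum_norm_charSum_coe_sq, sum_mul]
    refine (sum_le_sum fun ξ hξ => ?_).trans
      (sum_le_sum_of_subset_of_nonneg (erase_subset _ _) fun _ _ _ => by positivity)
    exact mul_le_mul_of_nonneg_left (hΦ ξ (ne_of_mem_erase hξ)) (by positivity)
  have hlt : (ε * Fintype.card Z) * (#X * Fintype.card I) < #X * (#X * Fintype.card I) :=
    mul_lt_mul_of_pos_right hε (by positivity)
  linarith

theorem sum_norm_charSum_add_sq_le (hΦ : IsFourierUniform Φ ε) (X : Finset Z) :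
    ∑ ξ : AddChar Z ℂ, ‖charSum (fun q : X × I => (q.1 : Z) + Φ q.2) ξ‖ ^ 2 ≤
      (#X * Fintype.card I) ^ 2 + Fintype.card Z * #X * (ε * Fintype.card I) ^ 2 := by
  rw [← add_sum_erase _ _ (mem_univ (0 : AddChar Z ℂ)), ← sum_norm_charSum_coe_sq, sum_mul]
  refine add_le_add (by simp [charSum_zero]) ?_
  refine (sum_le_sum fun ξ hξ => ?_).trans
    (sum_le_sum_of_subset_of_nonneg (erase_subset _ _) fun _ _ _ => by positivity)
  rw [charSum_add (fun x : X => (x : Z)) Φ, norm_mul, mul_pow]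
  gcongr
  exact hΦ ξ (ne_of_mem_erase hξ)

theorem card_le [Nonempty I] (hΦ : IsFourierUniform Φ ε) (hX : X.Nonempty) {W : Finset Z}
    (hW : ∀ x ∈ X, ∀ i, x + Φ i ∈ W) {L : ℝ} (hL : #W ≤ L * #X) :
    (Fintype.card Z : ℝ) ≤ L * (#X + ε ^ 2 * Fintype.card Z) := by
  classical
  have hX₀ : (0 : ℝ) < #X := by exact_mod_cast hX.card_pos
  have : (0 : ℝ) < Fintype.card I := by exact_mod_cast Fintype.card_pos
  have hL₀ : 0 ≤ L := nonneg_of_mul_nonneg_left ((Nat.cast_nonneg _).trans hL) hX₀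
  have henergy := hΦ.sum_norm_charSum_add_sq_le X
  rw [sum_norm_charSum_sq] at henergy
  set E : ℕ := #{q : (X × I) × (X × I) | (q.1.1 : Z) + Φ q.1.2 = q.2.1 + Φ q.2.2}
  have hcollisions : ((#X : ℝ) * Fintype.card I) ^ 2 ≤ #W * E := by
    have := sq_card_le_card_mul_card_collisions (f := fun q : X × I => (q.1 : Z) + Φ q.2)
      fun q => hW q.1 q.1.2 q.2
    rw [Fintype.card_prod, Fintype.card_coe] at this
    exact_mod_cast this
  refine le_of_mul_le_mul_right (a := (#X : ℝ) ^ 2 * Fintype.card I ^ 2) ?_ (by positivity)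
  calc (Fintype.card Z : ℝ) * (#X ^ 2 * Fintype.card I ^ 2)
      = Fintype.card Z * (#X * Fintype.card I) ^ 2 := by ring
    _ ≤ (Fintype.card Z : ℝ) * (#W * E) := by gcongr
    _ = #W * (Fintype.card Z * E) := by ring
    _ ≤ L * #X * ((#X * Fintype.card I) ^ 2 +
        Fintype.card Z * #X * (ε * Fintype.card I) ^ 2) := by gcongr
    _ = _ := by ring

end IsFourierUniform

end CharacterSums

section Pivot

open Finset

variable {V : Type*} [AddCommGroup V]

theorem injOn_compAddMonoidHom [Finite V] {T : Set (AddMonoid.End V)}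
    (hT : T.Pairwise fun t t' => Function.Injective (t - t')) {ξ : AddChar V ℂ} (hξ : ξ ≠ 0) :
    Set.InjOn (fun t : AddMonoid.End V => ξ.compAddMonoidHom t) T := by
  intro t ht t' ht' heq
  by_contra hne
  refine hξ (DFunLike.ext _ _ fun v => ?_)
  obtain ⟨w, rfl⟩ := Finite.surjective_of_injective (hT ht ht' hne) v
  have hw : ξ (t w) = ξ (t' w) := DFunLike.congr_fun heq w
  change ξ (t w - t' w) = 1
  rw [sub_eq_add_neg, AddChar.map_add_eq_mul, hw, ← AddChar.map_add_eq_mul, add_neg_cancel,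
    AddChar.map_zero_eq_one]

theorem isFourierUniform_apply [Fintype V] {T : Finset (AddMonoid.End V)} {X : Finset V}
    (hT : (T : Set (AddMonoid.End V)).Pairwise fun t t' => Function.Injective (t - t'))
    (hT₀ : T.Nonempty) (hX₀ : X.Nonempty) :
    IsFourierUniform (fun q : T × X => (q.1 : AddMonoid.End V) q.2)
      √(Fintype.card V / (#T * #X)) := by
  classical
  intro ξ hξ
  have : (0 : ℝ) < #T := by exact_mod_cast hT₀.card_pos
  have : (0 : ℝ) < #X := by exact_mod_cast hX₀.card_pos
  let pullback (t : AddMonoid.End V) : AddChar V ℂ := ξ.compAddMonoidHom t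
  have hinj : Set.InjOn pullback T := injOn_compAddMonoidHom hT hξ
  let S (η : AddChar V ℂ) : ℂ := charSum (fun x : X => (x : V)) η
  have hsplit : charSum (fun q : T × X => (q.1 : AddMonoid.End V) q.2) ξ =
      ∑ t ∈ T, S (pullback t) := by
    rw [charSum, Fintype.sum_prod_type, sum_coe_sort T fun t => ∑ x : X, ξ (t x)]
    rfl
  refine le_of_sq_le_sq ?_ (by positivity)
  rw [mul_pow, Real.sq_sqrt (by positivity), hsplit]
  calc ‖∑ t ∈ T, S (pullback t)‖ ^ 2 ≤ (∑ t ∈ T, ‖S (pullback t)‖) ^ 2 := by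
        gcongr; exact norm_sum_le _ _
    _ ≤ #T * ∑ t ∈ T, ‖S (pullback t)‖ ^ 2 := sq_sum_le_card_mul_sum_sq
    _ = #T * ∑ η ∈ T.image pullback, ‖S η‖ ^ 2 := by rw [sum_image hinj]
    _ ≤ #T * ∑ η, ‖S η‖ ^ 2 := by
        gcongr
        exact subset_univ _
    _ = Fintype.card V / (#T * #X) * Fintype.card (T × X) ^ 2 := by
        rw [sum_norm_charSum_coe_sq, Fintype.card_prod, Fintype.card_coe, Fintype.card_coe]
        push_cast
        field_simp

theorem eq_univ_of_add_mem {Ψ : Set (AddMonoid.End V)} {X N : Set V}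
    (hΨ : ∀ ψ ∈ Ψ, ∃ ψ' ∈ Ψ, ψ * ψ' = 1) (hne : Ψ.Nonempty) (hX₀ : 0 ∈ X)
    (hXneg : ∀ x ∈ X, -x ∈ X)
    (hgen : ∀ M : AddSubgroup V, (∀ ψ ∈ Ψ, ∀ v ∈ M, ψ v ∈ M) → X ⊆ M → M = ⊤)
    (h₀ : 0 ∈ N) (h : ∀ ψ ∈ Ψ, ∀ y ∈ N, ∀ x ∈ X, ψ y + x ∈ N) : N = Set.univ := by
  have hψN : ∀ ψ ∈ Ψ, ∀ y ∈ N, ψ y ∈ N := fun ψ hψ y hy => by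
    simpa using h ψ hψ y hy 0 hX₀
  have hpreimage : ∀ ψ ∈ Ψ, ∀ y ∈ N, ∃ w ∈ N, ψ w = y := fun ψ hψ y hy =>
    have ⟨ψ', hψ', hinv⟩ := hΨ ψ hψ
    ⟨ψ' y, hψN ψ' hψ' y hy, DFunLike.congr_fun hinv y⟩
  have hXN : ∀ y ∈ N, ∀ x ∈ X, y + x ∈ N := fun y hy x hx => by
    obtain ⟨ψ, hψ⟩ := hne
    obtain ⟨w, hw, rfl⟩ := hpreimage ψ hψ y hy
    exact h ψ hψ w hw x hx
  let stabilizer : AddSubgroup V :=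
    { carrier := {v | ∀ y, y ∈ N ↔ y + v ∈ N}
      zero_mem' := by simp
      add_mem' := fun {a b} ha hb y => by rw [ha y, hb (y + a), add_assoc]
      neg_mem' := fun {a} ha y => by rw [ha (y + -a), neg_add_cancel_right] }
  have hstep : ∀ ψ ∈ Ψ, ∀ v ∈ stabilizer, ∀ y ∈ N, y + ψ v ∈ N := fun ψ hψ v hv y hy => by
    obtain ⟨w, hw, rfl⟩ := hpreimage ψ hψ y hy
    rw [← map_add]
    exact hψN ψ hψ _ ((hv w).1 hw)
  have htop : stabilizer = ⊤ := by
    refine hgen stabilizer (fun ψ hψ v hv y => ⟨hstep ψ hψ v hv y, fun hy => ?_⟩)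
      (fun x hx y => ⟨fun hy => hXN y hy x hx, fun hy => ?_⟩)
    · simpa using hstep ψ hψ (-v) (neg_mem hv) _ hy
    · simpa using hXN _ hy _ (hXneg x hx)
  refine Set.eq_univ_of_forall fun v => ?_
  have hv : v ∈ stabilizer := htop ▸ AddSubgroup.mem_top v
  simpa using (hv 0).1 h₀

/-- A family `X 0 ⊆ X 1 ⊆ …` of finite sets which behaves like the balls about `0` of a length
function on `V`. -/
structure IsBallFamily (X : ℕ → Finset V) : Prop where
  mono : Monotone X
  zero_mem : ∀ j, 0 ∈ X j
  neg_mem : ∀ j, ∀ x ∈ X j, -x ∈ X j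
  add_mem : ∀ i j, ∀ x ∈ X i, ∀ y ∈ X j, x + y ∈ X (i + j)

theorem IsBallFamily.sub_mem {X : ℕ → Finset V} (hX : IsBallFamily X) {i j : ℕ} {x y : V}
    (hx : x ∈ X i) (hy : y ∈ X j) : x - y ∈ X (i + j) := by
  rw [sub_eq_add_neg]
  exact hX.add_mem i j x hx _ (hX.neg_mem j y hy)

/-- The set of `y` for which two distinct members `t, t'` of `T` satisfy `t y - t' y ∈ X`. A vector
outside this set is a pivot: for `X ⊇ Y - Y` the sums `x + t y` with `x ∈ Y` and `t ∈ T` are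
pairwise distinct. -/
def coincidenceSet (T : Finset (AddMonoid.End V)) (X : Finset V) : Set V :=
  {y | ∃ t ∈ T, ∃ t' ∈ T, t ≠ t' ∧ (t - t') y ∈ X}

variable {T : Finset (AddMonoid.End V)}

theorem injOn_of_notMem_coincidenceSet {X Y : Finset V} (hXY : ∀ x ∈ Y, ∀ x' ∈ Y, x - x' ∈ X)
    {y : V} (hy : y ∉ coincidenceSet T X) :
    Set.InjOn (fun q : AddMonoid.End V × V => q.2 + q.1 y) (T ×ˢ Y : Finset _) := by
  rintro ⟨t, x⟩ hq ⟨t', x'⟩ hq' (heq : x + t y = x' + t' y)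
  rw [mem_coe, mem_product] at hq hq'
  have hdiff : (t - t') y = x' - x := by
    change t y - t' y = x' - x
    rw [sub_eq_sub_iff_add_eq_add, add_comm, heq, add_comm]
  obtain rfl : t = t' := by
    by_contra hne
    exact hy ⟨t, hq.1, t', hq'.1, hne, hdiff ▸ hXY _ hq'.2 _ hq.2⟩
  rw [add_left_inj] at heq
  rw [heq]

theorem card_le_of_coincidenceSet_eq_univ [Fintype V]
    (hT : (T : Set (AddMonoid.End V)).Pairwise fun t t' => Function.Injective (t - t'))
    {X : Finset V} (h : coincidenceSet T X = Set.univ) : Fintype.card V ≤ #T ^ 2 * #X := by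
  classical
  have hcover : (univ : Finset V) ⊆
      T.offDiag.biUnion fun q => univ.filter fun y => (q.1 - q.2 : AddMonoid.End V) y ∈ X := by
    intro y _
    obtain ⟨t, ht, t', ht', hne, hy⟩ : y ∈ coincidenceSet T X := h ▸ Set.mem_univ y
    exact mem_biUnion.2 ⟨(t, t'), mem_offDiag.2 ⟨ht, ht', hne⟩, by simpa using hy⟩
  calc Fintype.card V ≤ #T.offDiag * #X := by
        refine (card_le_card hcover).trans (card_biUnion_le_card_mul _ _ _ ?_)
        rintro ⟨t, t'⟩ hq
        obtain ⟨ht, ht', hne⟩ := mem_offDiag.1 hq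
        exact card_le_card_of_injOn (t - t' : AddMonoid.End V) (fun y hy => by simpa using hy)
          (hT ht ht' hne).injOn
    _ ≤ #T ^ 2 * #X := by
        gcongr
        rw [offDiag_card, sq]
        exact Nat.sub_le _ _

theorem map_add_mem_coincidenceSet {X : ℕ → Finset V} (hX : IsBallFamily X)
    (hT : (T : Set (AddMonoid.End V)).Pairwise fun t t' => Function.Injective (t - t'))
    (hTT : ∀ t ∈ T, ∀ t' ∈ T, Commute t t') {a m : ℕ}
    (hTX : ∀ t ∈ T, ∀ j, ∀ x ∈ X j, t x ∈ X (j + a)) {ψ : AddMonoid.End V}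
    (hψT : ∀ t ∈ T, Commute t ψ) (hψX : ∀ j, ∀ x ∈ X j, ψ x ∈ X (j + 1))
    (hcard : #(X (20 * (m + a + 1))) < #T * #(X m)) {x y : V} (hx : x ∈ X m)
    (hy : y ∈ coincidenceSet T (X (2 * m))) :
    ψ y + x ∈ coincidenceSet T (X (2 * m)) := by
  obtain ⟨t, ht, t', ht', hne, hy⟩ := hy
  by_contra hcon
  set s : AddMonoid.End V := t - t'
  have hsT : ∀ τ ∈ T, ∀ w, s (τ w) = τ (s w) := fun τ hτ =>
    DFunLike.congr_fun ((hTT t ht τ hτ).sub_left (hTT t' ht' τ hτ)).eq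
  have hsψ : s (ψ y) = ψ (s y) :=
    DFunLike.congr_fun ((hψT t ht).sub_left (hψT t' ht')).eq y
  have hsX : ∀ j, ∀ w ∈ X j, s w ∈ X ((j + a) + (j + a)) := fun j w hw =>
    hX.sub_mem (hTX t ht j w hw) (hTX t' ht' j w hw)
  -- Applying `s` brings the possibly long vectors `w + τ (ψ y + x)` back into a ball.
  have hmaps : Set.MapsTo (fun q : AddMonoid.End V × V => s (q.2 + q.1 (ψ y + x)))
      (T ×ˢ X m : Finset _) (X (20 * (m + a + 1))) := by
    rintro ⟨τ, w⟩ hq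
    obtain ⟨hτ, hw⟩ := mem_product.1 hq
    change s (w + τ (ψ y + x)) ∈ X _
    have hshort : s (ψ y + x) ∈ X ((2 * m + 1) + ((m + a) + (m + a))) := by
      rw [map_add, hsψ]
      exact hX.add_mem _ _ _ (hψX _ _ hy) _ (hsX m x hx)
    rw [map_add, hsT τ hτ]
    exact hX.mono (by lia) (hX.add_mem _ _ _ (hsX m w hw) _ (hTX τ hτ _ _ hshort))
  have hinj := (hT ht ht' hne).comp_injOn (injOn_of_notMem_coincidenceSet
    (Y := X m) (fun x hx x' hx' => two_mul m ▸ hX.sub_mem hx hx') hcon)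
  have := card_le_card_of_injOn _ hmaps hinj
  rw [card_product] at this
  exact this.not_gt hcard

theorem mem_of_card_le_card_mul [Fintype V] {X : ℕ → Finset V} (hX : IsBallFamily X)
    (hT : (T : Set (AddMonoid.End V)).Pairwise fun t t' => Function.Injective (t - t'))
    {a j : ℕ} (hTX : ∀ t ∈ T, ∀ x ∈ X j, t x ∈ X (j + a)) {κ : ℝ}
    (hκ : Fintype.card V ≤ κ * #(X j)) (hTκ : κ ^ 3 < #T) (v : V) : v ∈ X (3 * j + a) := by
  have : (0 : ℝ) < #(X j) := by exact_mod_cast Finset.card_pos.2 ⟨0, hX.zero_mem j⟩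
  have : (0 : ℝ) < Fintype.card V := by exact_mod_cast Fintype.card_pos
  have hκ₀ : 0 < κ := by by_contra! h; nlinarith
  have hT₀ : (0 : ℝ) < #T := lt_of_le_of_lt (by positivity) hTκ
  have hTne : T.Nonempty := card_pos.1 (by exact_mod_cast hT₀)
  have hXne : (X j).Nonempty := ⟨0, hX.zero_mem j⟩
  have := hTne.coe_sort
  have := hXne.coe_sort
  have hdense : √(Fintype.card V / (#T * #(X j))) * Fintype.card V < #(X j) := by
    refine lt_of_pow_lt_pow_left₀ 2 (by positivity) ?_
    rw [mul_pow, Real.sq_sqrt (by positivity), div_mul_eq_mul_div, div_lt_iff₀ (by positivity)]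
    calc (Fintype.card V : ℝ) * Fintype.card V ^ 2 = (Fintype.card V : ℝ) ^ 3 := by ring
      _ ≤ (κ * #(X j)) ^ 3 := by gcongr
      _ = κ ^ 3 * #(X j) ^ 3 := by ring
      _ < #T * #(X j) ^ 3 := by gcongr
      _ = _ := by ring
  obtain ⟨x, hx, x', hx', ⟨t, w⟩, rfl⟩ :=
    (isFourierUniform_apply hT hTne hXne).exists_sub_add_eq (Real.sqrt_nonneg _) hdense v
  exact hX.mono (by lia) (hX.add_mem _ _ _ (hX.sub_mem hx hx') _ (hTX t t.2 w w.2))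

theorem mem_of_commuting_of_injective_sub [Finite V] {Ψ : Set (AddMonoid.End V)}
    (hT : (T : Set (AddMonoid.End V)).Pairwise fun t t' => Function.Injective (t - t'))
    (hTT : ∀ t ∈ T, ∀ t' ∈ T, Commute t t') (hTΨ : ∀ t ∈ T, ∀ ψ ∈ Ψ, Commute t ψ)
    {X : ℕ → Finset V} (hX : IsBallFamily X) {a m : ℕ}
    (hTX : ∀ t ∈ T, ∀ j, ∀ x ∈ X j, t x ∈ X (j + a))
    (hΨX : ∀ ψ ∈ Ψ, ∀ j, ∀ x ∈ X j, ψ x ∈ X (j + 1))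
    (hgen : ∀ N : Set V, 0 ∈ N → (∀ ψ ∈ Ψ, ∀ y ∈ N, ∀ x ∈ X m, ψ y + x ∈ N) → N = Set.univ)
    {L : ℝ} (hL₁ : 1 ≤ L) (hL : #(X (20 * (m + a + 1))) ≤ L * #(X m))
    (hTL : 64 * L ^ 6 < #T) (v : V) : v ∈ X (6 * m + a) := by
  have := Fintype.ofFinite V
  have hfloor : (⌊L⌋₊ : ℝ) ≤ L := Nat.floor_le (by linarith)
  obtain ⟨T', hT'T, hT'card⟩ : ∃ T' ⊆ T, #T' = ⌊L⌋₊ + 1 := by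
    apply exists_subset_card_eq
    have : L ≤ L ^ 6 := le_self_pow₀ hL₁ (by norm_num)
    have : ((⌊L⌋₊ + 1 : ℕ) : ℝ) ≤ #T := by push_cast; nlinarith
    exact_mod_cast this
  have hT'L : L < #T' := by rw [hT'card]; push_cast; exact Nat.lt_floor_add_one L
  have hT'le : (#T' : ℝ) ≤ 2 * L := by rw [hT'card]; push_cast; linarith
  have hX₀ : (0 : ℝ) < #(X m) := by exact_mod_cast Finset.card_pos.2 ⟨0, hX.zero_mem m⟩
  have hT' := hT.mono (coe_subset.2 hT'T)
  have huniv : coincidenceSet T' (X (2 * m)) = Set.univ := by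
    refine hgen _ ?_ fun ψ hψ y hy x hx =>
      map_add_mem_coincidenceSet hX hT' (fun t ht t' ht' => hTT t (hT'T ht) t' (hT'T ht'))
        (fun t ht => hTX t (hT'T ht)) (fun t ht => hTΨ t (hT'T ht) ψ hψ) (hΨX ψ hψ) ?_ hx hy
    · obtain ⟨t, ht, t', ht', hne⟩ := one_lt_card.1
        (show 1 < #T' by exact_mod_cast hL₁.trans_lt hT'L)
      exact ⟨t, ht, t', ht', hne, by rw [map_zero]; exact hX.zero_mem _⟩
    · exact_mod_cast hL.trans_lt (mul_lt_mul_of_pos_right hT'L hX₀)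
  have hcard : (Fintype.card V : ℝ) ≤ 4 * L ^ 2 * #(X (2 * m)) := by
    calc (Fintype.card V : ℝ) ≤ #T' ^ 2 * #(X (2 * m)) := by
          exact_mod_cast card_le_of_coincidenceSet_eq_univ hT' huniv
      _ ≤ (2 * L) ^ 2 * #(X (2 * m)) := by gcongr
      _ = 4 * L ^ 2 * #(X (2 * m)) := by ring
  have hmem := mem_of_card_le_card_mul hX hT (fun t ht => hTX t ht (2 * m)) hcard
    (by linarith only [hTL, show (4 * L ^ 2) ^ 3 = 64 * L ^ 6 by ring]) v
  rwa [show 3 * (2 * m) + a = 6 * m + a by ring] at hmem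

end Pivot

section Counting

variable {G : Type*} [Group G]

theorem exists_coset_representatives (Y : Set G) (H : Subgroup G) :
    ∃ r : G ⧸ H → G, ∀ y ∈ Y, r y ∈ Y ∧ (r y)⁻¹ * y ∈ H := by
  have h (q : G ⧸ H) : ∃ y', ∀ y ∈ Y, (y : G ⧸ H) = q → y' ∈ Y ∧ (y' : G ⧸ H) = q := by
    by_cases hq : ∃ y ∈ Y, (y : G ⧸ H) = q
    · exact hq.imp fun y hy _ _ _ => hy
    · exact ⟨1, fun y hy hyq => (hq ⟨y, hy, hyq⟩).elim⟩
  choose r hr using h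
  exact ⟨r, fun y hy => (hr y y hy rfl).imp_right QuotientGroup.eq.1⟩

theorem cosetCount_le_one {Y : Set G} {H : Subgroup G} (h : Y ⊆ H) : cosetCount Y H ≤ 1 := by
  rw [← Set.ncard_singleton ((1 : G) : G ⧸ H)]
  refine Set.ncard_le_ncard ?_ (Set.finite_singleton _)
  rintro _ ⟨y, hy, rfl⟩
  exact QuotientGroup.eq.2 (by simpa using h hy)

theorem cosetCount_ker {Q : Type*} [Group Q] (π : G →* Q) (Y : Set G) :
    cosetCount Y π.ker = (π '' Y).ncard := by
  rw [cosetCount, ← Set.ncard_image_of_injective _ (QuotientGroup.kerLift_injective π),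
    Set.image_image]
  rfl

variable [Finite G]

theorem cosetCount_mul_ncard_le {H : Subgroup G} {X : Set G} (hX : X ⊆ H) (Y : Set G) :
    cosetCount Y H * X.ncard ≤ (Y * X).ncard := by
  obtain ⟨r, hr⟩ := exists_coset_representatives Y H
  rw [cosetCount, ← Set.ncard_prod]
  refine Set.ncard_le_ncard_of_injOn (fun q => r q.1 * q.2) ?_ ?_
  · rintro ⟨_, x⟩ ⟨⟨y, hy, rfl⟩, hx⟩
    exact Set.mul_mem_mul (hr y hy).1 hx
  · rintro ⟨_, x⟩ ⟨⟨y, hy, rfl⟩, hx⟩ ⟨_, x'⟩ ⟨⟨y', hy', rfl⟩, hx'⟩ (heq : r y * x = r y' * x')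
    have hyr : (r y : G ⧸ H) = y := QuotientGroup.eq.2 (hr y hy).2
    have hyr' : (r y' : G ⧸ H) = y' := QuotientGroup.eq.2 (hr y' hy').2
    have hyy' : (y : G ⧸ H) = y' := by
      rw [← hyr, ← hyr', QuotientGroup.eq, show (r y)⁻¹ * r y' = x * x'⁻¹ by
        rw [eq_mul_inv_iff_mul_eq, mul_assoc, ← heq, inv_mul_cancel_left]]
      exact H.mul_mem (hX hx) (H.inv_mem (hX hx'))
    rw [hyy', mul_right_inj] at heq
    exact Prod.ext hyy' heq

theorem ncard_le_cosetCount_mul_ncard (Y : Set G) (H : Subgroup G) :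
    Y.ncard ≤ cosetCount Y H * (Y⁻¹ * Y ∩ H : Set G).ncard := by
  obtain ⟨r, hr⟩ := exists_coset_representatives Y H
  rw [cosetCount, ← Set.ncard_prod]
  refine Set.ncard_le_ncard_of_injOn (fun y => ((y : G ⧸ H), (r y)⁻¹ * y)) (fun y hy => ?_) ?_
  · exact ⟨Set.mem_image_of_mem _ hy,
      Set.mul_mem_mul (Set.inv_mem_inv.2 (hr y hy).1) hy, (hr y hy).2⟩
  · rintro y - y' - heq
    obtain ⟨h₁, h₂⟩ := Prod.ext_iff.1 heq
    dsimp only at h₁ h₂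
    rwa [h₁, mul_right_inj] at h₂

theorem cosetCount_mono {Y Y' : Set G} (h : Y ⊆ Y') (H : Subgroup G) :
    cosetCount Y H ≤ cosetCount Y' H :=
  Set.ncard_le_ncard (Set.image_mono h)

theorem cosetCount_pos {Y : Set G} (hY : Y.Nonempty) (H : Subgroup G) : 0 < cosetCount Y H :=
  (Set.ncard_pos).2 (hY.image _)

theorem cosetCount_inf_le (Y : Set G) (H C : Subgroup G) :
    cosetCount Y (H ⊓ C) ≤ cosetCount Y H * cosetCount (Y⁻¹ * Y ∩ H) C := by
  obtain ⟨r, hr⟩ := exists_coset_representatives Y H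
  obtain ⟨s, hs⟩ := exists_coset_representatives Y (H ⊓ C)
  rw [cosetCount, cosetCount, cosetCount, ← Set.ncard_prod]
  refine Set.ncard_le_ncard_of_injOn
    (fun q => ((s q : G ⧸ H), (((r (s q))⁻¹ * s q : G) : G ⧸ C))) ?_ ?_
  · rintro _ ⟨y, hy, rfl⟩
    have hsy := (hs y hy).1
    exact ⟨Set.mem_image_of_mem _ hsy, Set.mem_image_of_mem _
      ⟨Set.mul_mem_mul (Set.inv_mem_inv.2 (hr _ hsy).1) hsy, (hr _ hsy).2⟩⟩
  · rintro _ ⟨y, hy, rfl⟩ _ ⟨y', hy', rfl⟩ heq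
    obtain ⟨h₁, h₂⟩ := Prod.ext_iff.1 heq
    dsimp only at h₁ h₂
    rw [h₁, QuotientGroup.eq] at h₂
    change (y : G ⧸ H ⊓ C) = y'
    rw [← QuotientGroup.eq.2 (hs y hy).2, ← QuotientGroup.eq.2 (hs y' hy').2, QuotientGroup.eq]
    refine ⟨QuotientGroup.eq.1 h₁, ?_⟩
    simpa [mul_assoc] using h₂

end Counting

/-- A symmetric set containing `1`, all of whose powers grow slowly: the form in which small
tripling is used. -/
structure SmallGrowth {G : Type*} [Group G] (B : Set G) (K : ℝ) : Prop where
  one_mem : 1 ∈ B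
  inv_eq : B⁻¹ = B
  one_le : 1 ≤ K
  card_pow : ∀ j, ((B ^ j).ncard : ℝ) ≤ K ^ j * B.ncard

namespace SmallGrowth

variable {G : Type*} [Group G] {B : Set G} {K : ℝ}

theorem pow_mono (hB : SmallGrowth B K) : Monotone (fun j : ℕ => B ^ j) :=
  fun _ _ h => Set.pow_subset_pow_right hB.one_mem h

theorem mul_mem {i j : ℕ} {x y : G} (hx : x ∈ B ^ i) (hy : y ∈ B ^ j) : x * y ∈ B ^ (i + j) := by
  rw [pow_add]; exact Set.mul_mem_mul hx hy

theorem inv_mem (hB : SmallGrowth B K) {j : ℕ} {x : G} (hx : x ∈ B ^ j) : x⁻¹ ∈ B ^ j := by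
  rw [← hB.inv_eq, inv_pow]; exact Set.inv_mem_inv.2 hx

theorem one_mem_pow (hB : SmallGrowth B K) (j : ℕ) : (1 : G) ∈ B ^ j :=
  Set.one_mem_pow hB.one_mem

theorem commutator_mem (hB : SmallGrowth B K) {i j : ℕ} {x y : G} (hx : x ∈ B ^ i)
    (hy : y ∈ B ^ j) : ⁅x, y⁆ ∈ B ^ (i + j + i + j) :=
  mul_mem (mul_mem (mul_mem hx hy) (hB.inv_mem hx)) (hB.inv_mem hy)

variable [Finite G]

theorem ncard_pow_inter_le (hB : SmallGrowth B K) (H : Subgroup G) (j : ℕ) :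
    ((B ^ j ∩ H : Set G).ncard : ℝ) ≤ K ^ (j + 1) * (B ^ 2 ∩ H : Set G).ncard := by
  have hK : 0 ≤ K := zero_le_one.trans hB.one_le
  have hpos : (0 : ℝ) < cosetCount B H := by exact_mod_cast cosetCount_pos ⟨1, hB.one_mem⟩ H
  have hupper : B.ncard ≤ cosetCount B H * (B ^ 2 ∩ H : Set G).ncard := by
    simpa only [hB.inv_eq, ← sq] using ncard_le_cosetCount_mul_ncard B H
  have hlower : cosetCount B H * (B ^ j ∩ H : Set G).ncard ≤ (B ^ (j + 1)).ncard := by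
    refine (cosetCount_mul_ncard_le Set.inter_subset_right B).trans (Set.ncard_le_ncard ?_)
    rw [pow_succ']
    exact Set.mul_subset_mul_left Set.inter_subset_left
  refine le_of_mul_le_mul_left (a := (cosetCount B H : ℝ)) ?_ hpos
  calc (cosetCount B H : ℝ) * (B ^ j ∩ H : Set G).ncard ≤ (B ^ (j + 1)).ncard := by
        exact_mod_cast hlower
    _ ≤ K ^ (j + 1) * B.ncard := hB.card_pow _
    _ ≤ K ^ (j + 1) * (cosetCount B H * (B ^ 2 ∩ H : Set G).ncard) := by
        gcongr; exact_mod_cast hupper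
    _ = _ := by ring

theorem image {Q : Type*} [Group Q] (hB : SmallGrowth B K) (π : G →* Q) :
    SmallGrowth (π '' B) (K ^ 3) where
  one_mem := ⟨1, hB.one_mem, map_one π⟩
  inv_eq := by rw [← Set.image_inv, hB.inv_eq]
  one_le := one_le_pow₀ hB.one_le
  card_pow j := by
    have hK : 0 ≤ K := zero_le_one.trans hB.one_le
    rcases Nat.eq_zero_or_pos j with rfl | hj
    · have : 0 < (π '' B).ncard := (Set.ncard_pos).2 ⟨1, 1, hB.one_mem, map_one π⟩
      rw [pow_zero, pow_zero, one_mul, ← Set.singleton_one, Set.ncard_singleton]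
      exact_mod_cast this
    set k := (B ^ 2 ∩ π.ker : Set G).ncard
    have hk : (0 : ℝ) < k := by
      have hne : (B ^ 2 ∩ π.ker : Set G).Nonempty := ⟨1, hB.one_mem_pow 2, π.ker.one_mem⟩
      exact_mod_cast hne.ncard_pos
    have hupper : B.ncard ≤ (π '' B).ncard * k := by
      simpa only [hB.inv_eq, ← sq, cosetCount_ker] using ncard_le_cosetCount_mul_ncard B π.ker
    have hlower : ((π '' B) ^ j).ncard * k ≤ (B ^ (j + 2)).ncard := by
      rw [← Set.image_pow, ← cosetCount_ker]
      refine (cosetCount_mul_ncard_le Set.inter_subset_right _).trans (Set.ncard_le_ncard ?_)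
      rw [pow_add]
      exact Set.mul_subset_mul_left Set.inter_subset_left
    refine le_of_mul_le_mul_right (a := (k : ℝ)) ?_ hk
    calc (((π '' B) ^ j).ncard : ℝ) * k ≤ (B ^ (j + 2)).ncard := by exact_mod_cast hlower
      _ ≤ K ^ (j + 2) * B.ncard := hB.card_pow _
      _ ≤ K ^ (3 * j) * ((π '' B).ncard * k) := by
          gcongr ?_ * ?_
          · exact pow_le_pow_right₀ hB.one_le (by lia)
          · exact_mod_cast hupper
      _ = _ := by ring

end SmallGrowth

section Tripling

variable {G : Type*} [Group G] [Finite G] {A : Set G}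

theorem ncard_pow_le_ncard_pow (hA : A.Nonempty) {i j : ℕ} (hij : i ≤ j) :
    (A ^ i).ncard ≤ (A ^ j).ncard := by
  obtain ⟨a, ha⟩ := hA.pow (n := j - i)
  refine Set.ncard_le_ncard_of_injOn (· * a) (fun x hx => ?_) (mul_left_injective a).injOn
  rw [← Nat.add_sub_cancel' hij, pow_add]
  exact Set.mul_mem_mul hx ha

theorem one_le_of_tripling {K : ℝ} (hA : A.Nonempty)
    (h : ((A ^ 3).ncard : ℝ) ≤ K * A.ncard) : 1 ≤ K := by
  have hpos : (0 : ℝ) < A.ncard := by exact_mod_cast (Set.ncard_pos).2 hA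
  have hmono : (A.ncard : ℝ) ≤ (A ^ 3).ncard := by
    have := ncard_pow_le_ncard_pow hA (show 1 ≤ 3 by norm_num)
    rw [pow_one] at this
    exact_mod_cast this
  refine le_of_mul_le_mul_right ?_ hpos
  rw [one_mul]
  exact hmono.trans h

theorem ncard_pow_le_of_tripling {K : ℝ} (hinv : A⁻¹ = A)
    (h : ((A ^ 3).ncard : ℝ) ≤ K * A.ncard) {m : ℕ} (hm : 3 ≤ m) :
    ((A ^ m).ncard : ℝ) ≤ K ^ (m - 2) * A.ncard := by
  classical
  obtain ⟨F, rfl⟩ := A.toFinite.exists_finset_coe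
  rw [← Finset.coe_pow, Set.ncard_coe_finset, Set.ncard_coe_finset] at h ⊢
  exact Finset.small_pow_of_small_tripling hm h (by exact_mod_cast hinv)

theorem SmallGrowth.of_tripling {K : ℝ} (hA : A.Nonempty) (hinv : A⁻¹ = A)
    (h : ((A ^ 3).ncard : ℝ) ≤ K * A.ncard) : SmallGrowth (A ^ 2) (K ^ 2) := by
  have hK := one_le_of_tripling hA h
  obtain ⟨a, ha⟩ := hA
  have hone : (1 : G) ∈ A ^ 2 := by
    rw [sq, ← mul_inv_cancel a]
    exact Set.mul_mem_mul ha (hinv ▸ Set.inv_mem_inv.2 ha)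
  refine ⟨hone, by rw [← inv_pow, hinv], one_le_pow₀ hK, fun j => ?_⟩
  rw [← pow_mul, ← pow_mul]
  rcases lt_or_ge j 2 with hj | hj
  · calc ((A ^ (2 * j)).ncard : ℝ) ≤ (A ^ 2).ncard := by
          exact_mod_cast ncard_pow_le_ncard_pow ⟨a, ha⟩ (by lia)
      _ ≤ K ^ (2 * j) * (A ^ 2).ncard :=
          le_mul_of_one_le_left (Nat.cast_nonneg _) (one_le_pow₀ hK)
  · calc ((A ^ (2 * j)).ncard : ℝ) ≤ K ^ (2 * j - 2) * (A ^ 1).ncard := by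
          rw [pow_one]
          exact ncard_pow_le_of_tripling hinv h (by lia)
      _ ≤ K ^ (2 * j) * (A ^ 2).ncard := by
          gcongr ?_ * ?_
          · exact pow_le_pow_right₀ hK (by lia)
          · exact_mod_cast ncard_pow_le_ncard_pow ⟨a, ha⟩ (by norm_num)

end Tripling

section CoprimePowers

variable {G : Type*} [Group G]

theorem mem_of_pow_mem_of_coprime (H : Subgroup G) {x : G} {e q : ℕ} (h : e.Coprime q)
    (he : x ^ e ∈ H) (hq : x ^ q ∈ H) : x ∈ H := by
  have hx : x = (x ^ e) ^ e.gcdA q * (x ^ q) ^ e.gcdB q := by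
    rw [← zpow_natCast, ← zpow_natCast, ← zpow_mul, ← zpow_mul, ← zpow_add, ← Nat.gcd_eq_gcd_ab,
      h.gcd_eq_one, Nat.cast_one, zpow_one]
  rw [hx]
  exact H.mul_mem (H.zpow_mem he _) (H.zpow_mem hq _)

theorem eq_one_of_pow_eq_one_of_coprime {x : G} {e q : ℕ} (h : e.Coprime q)
    (he : x ^ e = 1) (hq : x ^ q = 1) : x = 1 := by
  rw [← Subgroup.mem_bot] at *
  exact mem_of_pow_mem_of_coprime ⊥ h he hq

theorem mul_pow_mul_inv_pow_mem {U : Subgroup G} [U.Normal] {u : G} (hu : u ∈ U) (d : G)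
    (e : ℕ) : (u * d) ^ e * (d ^ e)⁻¹ ∈ U := by
  rw [← QuotientGroup.eq_one_iff]
  simp [(QuotientGroup.eq_one_iff u).2 hu]

theorem commute_pow_of_commute_commutator {U : Subgroup G} [U.Normal] {e q : ℕ}
    (hU : ∀ u ∈ U, u ^ e = 1) (heq : e.Coprime q) {τ h : G} (hτ : τ ^ q ∈ U)
    (hw : ⁅τ, h⁆ ∈ U) (hc : Commute (τ ^ e) ⁅τ, h⁆) : Commute (τ ^ e) h := by
  set w := ⁅τ, h⁆ with hwdef
  have hconj : h * τ * h⁻¹ = w⁻¹ * τ := by rw [hwdef, commutatorElement_def]; group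
  have hcomm : Commute (τ ^ e) ((w⁻¹ * τ) ^ e) :=
    ((hc.inv_right).mul_right (Commute.pow_self τ e)).pow_right e
  have hz : ((w⁻¹ * τ) ^ e * (τ ^ e)⁻¹) ^ e = 1 :=
    hU _ (mul_pow_mul_inv_pow_mem (U.inv_mem hw) τ e)
  have hz' : ((w⁻¹ * τ) ^ e * (τ ^ e)⁻¹) ^ q = 1 := by
    rw [(hcomm.symm.inv_right).mul_pow, inv_pow, ← pow_mul, ← pow_mul, mul_comm e q, pow_mul,
      pow_mul, hU _ hτ, inv_one, mul_one, ← hconj, conj_pow]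
    exact hU _ (Subgroup.Normal.conj_mem inferInstance _ hτ _)
  have hfix := mul_inv_eq_one.1 (eq_one_of_pow_eq_one_of_coprime heq hz hz')
  rw [← hconj, conj_pow, mul_inv_eq_iff_eq_mul] at hfix
  exact hfix.symm

end CoprimePowers

section FixedPointFree

variable {G : Type*} [Group G]

/-- Conjugation by `d` has no nontrivial fixed point on `H / H'`. Neither `H' ≤ H` nor invariance
under `d` is part of the definition. -/
def IsFixedPointFree (d : G) (H H' : Subgroup G) : Prop :=
  ∀ x ∈ H, ⁅d, x⁆ ∈ H' → x ∈ H'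

theorem commutator_inv_mul_mem_iff {H H' : Subgroup G} {d x y : G} (hHH : ⁅H, H⁆ ≤ H')
    (hy : y ∈ H) (hdx : ⁅d, x⁆ ∈ H) (hdy : ⁅d, y⁆ ∈ H) :
    ⁅d, y⁻¹ * x⁆ ∈ H' ↔ ⁅d, y⁆⁻¹ * ⁅d, x⁆ ∈ H' := by
  have heq : ⁅d, y⁻¹ * x⁆ = ⁅y⁻¹, ⁅d, y⁆⁻¹ * ⁅d, x⁆⁆ * (⁅d, y⁆⁻¹ * ⁅d, x⁆) := by
    simp only [commutatorElement_def]; group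
  rw [heq]
  exact H'.mul_mem_cancel_left (hHH (Subgroup.commutator_mem_commutator (H.inv_mem hy)
    (H.mul_mem (H.inv_mem hdy) hdx)))

theorem IsFixedPointFree.exists_commutator_inv_mul_mem {H H' : Subgroup G} [Finite H] {d : G}
    (hfpf : IsFixedPointFree d H H') (hHH : ⁅H, H⁆ ≤ H') (hdH : ∀ x ∈ H, ⁅d, x⁆ ∈ H)
    (hdH' : ∀ x ∈ H', ⁅d, x⁆ ∈ H') : ∀ x ∈ H, ∃ y ∈ H, ⁅d, y⁆⁻¹ * x ∈ H' := by
  have hiff (x y : H) := commutator_inv_mul_mem_iff hHH x.2 (hdH y y.2) (hdH x x.2)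
  let c (x : H) : H := ⟨⁅d, (x : G)⁆, hdH x x.2⟩
  let f : H ⧸ H'.subgroupOf H → H ⧸ H'.subgroupOf H :=
    Quotient.map' c fun x y hxy => by
      rw [QuotientGroup.leftRel_apply] at hxy ⊢
      exact (hiff x y).1 (hdH' _ hxy)
  have hinj : Function.Injective f := by
    rintro ⟨x⟩ ⟨y⟩ hxy
    exact QuotientGroup.eq.2 (hfpf _ (H.mul_mem (H.inv_mem x.2) y.2)
      ((hiff x y).2 ((QuotientGroup.eq (a := c x) (b := c y)).1 hxy)))
  intro x hx
  obtain ⟨⟨y⟩, hy⟩ := Finite.surjective_of_injective hinj (QuotientGroup.mk ⟨x, hx⟩)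
  exact ⟨y, y.2, (QuotientGroup.eq (a := c y)).1 hy⟩

theorem IsFixedPointFree.of_le {H H' V : Subgroup G} [Finite H] {d : G}
    (hfpf : IsFixedPointFree d H H') (hHH : ⁅H, H⁆ ≤ H') (hH'V : H' ≤ V) (hVH : V ≤ H)
    (hdH' : ∀ x ∈ H', ⁅d, x⁆ ∈ H') (hdV : ∀ x ∈ V, ⁅d, x⁆ ∈ V) : IsFixedPointFree d H V := by
  intro x hx hdx
  have : Finite V := Finite.of_injective _ (Subgroup.inclusion_injective hVH)
  have hfpfV : IsFixedPointFree d V H' := fun x hx => hfpf x (hVH hx)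
  obtain ⟨y, hy, hyx⟩ := hfpfV.exists_commutator_inv_mul_mem
    ((Subgroup.commutator_mono hVH hVH).trans hHH) hdV hdH' _ hdx
  have hyx' : y⁻¹ * x ∈ V := hH'V (hfpf _ (H.mul_mem (H.inv_mem (hVH hy)) hx)
    ((commutator_inv_mul_mem_iff hHH (hVH hy) (hVH hdx) (hVH (hdV y hy))).2 hyx))
  simpa only [mul_inv_cancel_left] using V.mul_mem hy hyx'

/-- Conjugation on an abelian normal subgroup, written additively so that operators can be
subtracted. -/
def conjEnd (M : Subgroup G) [M.Normal] [IsMulCommutative M] :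
    G →* AddMonoid.End (Additive M) where
  toFun g := MonoidHom.toAdditive (MulAut.conjNormal (H := M) g).toMonoidHom
  map_one' := by rw [map_one]; rfl
  map_mul' g h := by rw [map_mul]; rfl

theorem commute_conjEnd (M : Subgroup G) [M.Normal] [IsMulCommutative M] {g h : G}
    (hgh : ∀ x ∈ M, ⁅⁅g, h⁆, x⁆ = 1) : Commute (conjEnd M g) (conjEnd M h) := by
  have htriv : conjEnd M ⁅g, h⁆ = 1 := by
    refine AddMonoidHom.ext fun x => Additive.toMul.injective (Subtype.ext ?_)
    change ⁅g, h⁆ * (x.toMul : G) * ⁅g, h⁆⁻¹ = x.toMul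
    rw [commutatorElement_eq_one_iff_mul_comm.1 (hgh _ x.toMul.2), mul_inv_cancel_right]
  have hmul : g * h = ⁅g, h⁆ * (h * g) := by rw [commutatorElement_def]; group
  rw [commute_iff_eq, ← map_mul, hmul, map_mul, htriv, one_mul, map_mul]

/-- On an abelian normal subgroup, taking commutators with a fixed element is an endomorphism. -/
def commutatorHom (M : Subgroup G) [M.Normal] [IsMulCommutative M] (g : G) : M →* M :=
  (MulAut.conjNormal g).toMonoidHom / MonoidHom.id M

theorem coe_commutatorHom (M : Subgroup G) [M.Normal] [IsMulCommutative M] (g : G) (x : M) :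
    (commutatorHom M g x : G) = ⁅g, (x : G)⁆ := by
  rw [commutatorHom, MonoidHom.div_apply, Subgroup.coe_div, commutatorElement_def, div_eq_mul_inv]
  rfl

theorem commutatorHom_left_comm {M : Subgroup G} [M.Normal] [IsMulCommutative M] {g h : G}
    (hgh : ∀ x ∈ M, ⁅⁅g, h⁆, x⁆ = 1) (x : M) :
    commutatorHom M g (commutatorHom M h x) = commutatorHom M h (commutatorHom M g x) := by
  have hcomm : MulAut.conjNormal g (MulAut.conjNormal h x) =
      MulAut.conjNormal h (MulAut.conjNormal g x) :=
    DFunLike.congr_fun (commute_conjEnd M hgh).eq (Additive.ofMul x)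
  have happly (k : G) (y : M) : commutatorHom M k y = MulAut.conjNormal k y / y := rfl
  simp only [happly, map_div, hcomm]
  exact div_div_div_comm _ _ _ _

theorem range_commutatorHom_sup_eq_top {M D : Subgroup G} [M.Normal] [IsMulCommutative M] {d : G}
    (hd : ∀ d' ∈ D, ∀ x ∈ M, ⁅⁅d', d⁆, x⁆ = 1) (hMD : M ≤ ⁅D, M⁆) {V V' : Subgroup G}
    (hV : (commutatorHom M d).range ⊔ V.subgroupOf M = ⊤) (hDV : ⁅D, V⁆ ≤ V') :
    (commutatorHom M d).range ⊔ V'.subgroupOf M = ⊤ := by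
  set R := (commutatorHom M d).range
  have hle : ∀ d' ∈ D, R ⊔ V.subgroupOf M ≤
      (R ⊔ V'.subgroupOf M).comap (commutatorHom M d') := by
    refine fun d' hd' => sup_le ?_ fun x hx => ?_
    · rintro _ ⟨x, rfl⟩
      exact Subgroup.mem_sup_left ⟨_, (commutatorHom_left_comm (hd d' hd') x).symm⟩
    · refine Subgroup.mem_sup_right (Subgroup.mem_subgroupOf.2 ?_)
      rw [coe_commutatorHom]
      exact hDV (Subgroup.commutator_mem_commutator hd' hx)
  have hM : M ≤ (R ⊔ V'.subgroupOf M).map M.subtype := by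
    refine hMD.trans (Subgroup.commutator_le.2 fun d' hd' x hx => ?_)
    exact ⟨commutatorHom M d' ⟨x, hx⟩, hle d' hd' (hV ▸ Subgroup.mem_top _),
      coe_commutatorHom M d' _⟩
  rwa [← top_le_iff, ← Subgroup.map_subtype_le_map_subtype, ← MonoidHom.range_eq_map,
    Subgroup.range_subtype]

-- By induction on `k`, the image of `x ↦ ⁅d, x⁆` covers `M` modulo `V k`; at `k = r` it is onto.
theorem isFixedPointFree_bot_of_filtration {M D : Subgroup G} [M.Normal] [IsMulCommutative M]
    [Finite M] {d : G} (hd : ∀ d' ∈ D, ∀ x ∈ M, ⁅⁅d', d⁆, x⁆ = 1) (hMD : M ≤ ⁅D, M⁆)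
    {V : ℕ → Subgroup G} {r : ℕ} (hV₀ : V 0 = M) (hVr : V r = ⊥)
    (hstep : ∀ k < r, ⁅D, V k⁆ ≤ V (k + 1) ∨ ∀ x ∈ V k, ∃ y ∈ M, ⁅d, y⁆⁻¹ * x ∈ V (k + 1)) :
    IsFixedPointFree d M ⊥ := by
  have hcover : ∀ k ≤ r, (commutatorHom M d).range ⊔ (V k).subgroupOf M = ⊤ := by
    intro k
    induction k with
    | zero => intro _; rw [hV₀, Subgroup.subgroupOf_self, sup_top_eq]
    | succ k ih =>
      intro hk
      rcases hstep k hk with htriv | hfpf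
      · exact range_commutatorHom_sup_eq_top hd hMD (ih (by lia)) htriv
      · rw [eq_top_iff, ← ih (by lia)]
        refine sup_le le_sup_left fun x hx => ?_
        obtain ⟨y, hy, hyx⟩ := hfpf x hx
        rw [← mul_inv_cancel_left (commutatorHom M d ⟨y, hy⟩) x]
        refine Subgroup.mul_mem_sup ⟨_, rfl⟩ (Subgroup.mem_subgroupOf.2 ?_)
        rwa [Subgroup.coe_mul, Subgroup.coe_inv, coe_commutatorHom]
  have hsurj : Function.Surjective (commutatorHom M d) := by
    rw [← MonoidHom.range_eq_top, ← hcover r le_rfl, hVr, Subgroup.bot_subgroupOf, sup_bot_eq]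
  intro x hx hdx
  have hdx' : commutatorHom M d ⟨x, hx⟩ = commutatorHom M d 1 := by
    rw [map_one]
    exact Subtype.ext ((coe_commutatorHom M d _).trans hdx)
  exact congrArg Subtype.val (Finite.injective_iff_surjective.2 hsurj hdx')

end FixedPointFree

section Commutators

variable {G : Type*} [Group G]

theorem isMulCommutative_map_mk' {H H' : Subgroup G} [H'.Normal] (h : ⁅H, H⁆ ≤ H') :
    IsMulCommutative (H.map (QuotientGroup.mk' H')) := by
  rwa [← Subgroup.commutator_self_eq_bot_iff, ← Subgroup.map_commutator,
    Subgroup.map_eq_bot_iff, QuotientGroup.ker_mk']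

theorem mk'_apply_eq_one_iff {N : Subgroup G} [N.Normal] {x : G} :
    QuotientGroup.mk' N x = 1 ↔ x ∈ N :=
  QuotientGroup.eq_one_iff x

theorem commutator_le_iff_le_comap_centralizer {H K N : Subgroup G} [N.Normal] :
    ⁅H, K⁆ ≤ N ↔
      H ≤ (Subgroup.centralizer (K.map (QuotientGroup.mk' N) : Set (G ⧸ N))).comap
        (QuotientGroup.mk' N) := by
  rw [← Subgroup.map_le_iff_le_comap, ← Subgroup.commutator_eq_bot_iff_le_centralizer,
    ← Subgroup.map_commutator, Subgroup.map_eq_bot_iff, QuotientGroup.ker_mk']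

theorem sup_commutator_le {H₁ H₂ K N : Subgroup G} [N.Normal] (h₁ : ⁅H₁, K⁆ ≤ N)
    (h₂ : ⁅H₂, K⁆ ≤ N) : ⁅H₁ ⊔ H₂, K⁆ ≤ N := by
  rw [commutator_le_iff_le_comap_centralizer] at *
  exact sup_le h₁ h₂

theorem normal_of_forall_conj_mem {A : Set G} (hA : Subgroup.closure A = ⊤)
    (hinv : A⁻¹ = A) {C : Subgroup G} (h : ∀ a ∈ A, ∀ x ∈ C, a * x * a⁻¹ ∈ C) : C.Normal := by
  rw [← Subgroup.normalizer_eq_top_iff, eq_top_iff, ← hA, Subgroup.closure_le]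
  intro a ha
  rw [SetLike.mem_coe, Subgroup.mem_normalizer_iff]
  intro x
  refine ⟨h a ha x, fun hx => ?_⟩
  have hx' := h a⁻¹ (by rw [← hinv]; exact Set.inv_mem_inv.2 ha) _ hx
  simpa [mul_assoc] using hx'

theorem conj_mem_sq_pow {A : Set G} (hinv : A⁻¹ = A) {a x : G} {j : ℕ} (ha : a ∈ A)
    (hx : x ∈ (A ^ 2) ^ j) : a * x * a⁻¹ ∈ (A ^ 2) ^ (j + 1) := by
  have ha' : a⁻¹ ∈ A := by rw [← hinv]; exact Set.inv_mem_inv.2 ha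
  have hpow : (A ^ 2) ^ (j + 1) = A * (A ^ 2) ^ j * A := by
    rw [← pow_mul, ← pow_mul, ← pow_succ', ← pow_succ]
    congr 1
  rw [hpow]
  exact Set.mul_mem_mul (Set.mul_mem_mul ha hx) ha'

theorem IsFixedPointFree.of_map {G' : Type*} [Group G'] (π : G →* G') {d : G} {H : Subgroup G}
    (h : IsFixedPointFree (π d) (H.map π) ⊥) : IsFixedPointFree d H π.ker := by
  intro x hx hdx
  rw [MonoidHom.mem_ker, map_commutatorElement] at hdx
  exact h (π x) (Subgroup.mem_map_of_mem π hx) hdx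

theorem IsFixedPointFree.of_mul_left {H H' : Subgroup G} {v d : G}
    (h : IsFixedPointFree (v * d) H H') (hH : ∀ x ∈ H, ⁅v, x⁆ ∈ H')
    (hH' : ∀ x ∈ H', ⁅v, x⁆ ∈ H') : IsFixedPointFree d H H' := by
  intro x hx hdx
  have heq : ⁅v * d, x⁆ = ⁅v, ⁅d, x⁆⁆ * ⁅d, x⁆ * ⁅v, x⁆ := by
    simp only [commutatorElement_def]; group
  refine h x hx ?_
  rw [heq]
  exact H'.mul_mem (H'.mul_mem (hH' _ hdx) hdx) (hH x hx)

end Commutators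

section PivotData

variable {G : Type*} [Group G]

/-- Each step of the filtration `W 0 ≥ ⋯ ≥ W r` is either centralised by `D` or has no nontrivial
fixed point of conjugation by `g`. -/
def IsFixedPointFreeAlong (D : Subgroup G) (W : ℕ → Subgroup G) (r : ℕ) (g : G) : Prop :=
  ∀ k < r, ⁅D, W k⁆ ≤ W (k + 1) ∨ IsFixedPointFree g (W k) (W (k + 1))

/-- A normal subgroup `U`, nilpotent of class at most `n` and of exponent dividing `e`, filtered by
`U = W 0 ≥ ⋯ ≥ W r = 1` with steps centralised by `U` and invariant under a normal subgroup `D`.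
Modulo `S ≤ U ⊓ D` the group `D` is central and has exponent dividing `q`, which is prime to `e`,
and `D` acts on `S` without coinvariants. -/
structure CoprimeFiltration (n r e q : ℕ) (U D S : Subgroup G) (W : ℕ → Subgroup G) : Prop where
  normal_U : U.Normal
  normal_D : D.Normal
  normal_S : S.Normal
  S_le_U : S ≤ U
  S_le_D : S ≤ D
  D_central : ⁅D, (⊤ : Subgroup G)⁆ ≤ S
  S_le : S ≤ ⁅S, D⁆
  nilp : U.lowerCentralSeries n = ⊥
  W_zero : W 0 = U
  W_last : W r = ⊥
  commutator_D_W_le : ∀ k, ⁅D, W k⁆ ≤ W k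
  commutator_U_W_le : ∀ k, ⁅U, W k⁆ ≤ W (k + 1)
  W_anti : ∀ k, W (k + 1) ≤ W k
  pow_mem : ∀ d ∈ D, d ^ q ∈ S
  pow_eq : ∀ u ∈ U, u ^ e = 1
  coprime : e.Coprime q

/-- A set of `K`-small growth together with a set `T` of multipliers: elements of `A ^ 4 ∩ U D`
whose quotients act without fixed points on all steps of the filtration on which `D` acts
nontrivially. -/
structure PivotData (n r e q : ℕ) (A : Set G) (K : ℝ) (U D S : Subgroup G) (W : ℕ → Subgroup G)
    (T : Set G) : Prop extends CoprimeFiltration n r e q U D S W where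
  closure_eq : Subgroup.closure A = ⊤
  inv_eq : A⁻¹ = A
  growth : SmallGrowth (A ^ 2) K
  two_le : 2 ≤ K
  T_sub : T ⊆ (A ^ 2) ^ 2
  T_le : T ⊆ (U ⊔ D : Subgroup G)
  rich : ∀ t ∈ T, ∀ t' ∈ T, t ≠ t' → IsFixedPointFreeAlong D W r (t⁻¹ * t')

namespace CoprimeFiltration

variable {n r e q : ℕ} {U D S : Subgroup G} {W : ℕ → Subgroup G}

theorem W_le (F : CoprimeFiltration n r e q U D S W) (k : ℕ) : W k ≤ U := by
  induction k with
  | zero => exact F.W_zero.le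
  | succ k ih => exact (F.W_anti k).trans ih

theorem commutator_mem (F : CoprimeFiltration n r e q U D S W) {τ : G} (hτ : τ ∈ U ⊔ D)
    (g : G) : ⁅τ, g⁆ ∈ U := by
  have := F.normal_U
  exact sup_commutator_le (Subgroup.commutator_le_left U ⊤) (F.D_central.trans F.S_le_U)
    (Subgroup.commutator_mem_commutator hτ (Subgroup.mem_top g))

theorem commutator_mem_sup (F : CoprimeFiltration n r e q U D S W) {τ x : G} (hτ : τ ∈ U ⊔ D)
    {j : ℕ} (hx : x ∈ U.lowerCentralSeries j ⊔ S) :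
    ⁅τ, x⁆ ∈ U.lowerCentralSeries (j + 1) ⊔ S := by
  have := F.normal_U
  have := F.normal_S
  have hU : ⁅U, U.lowerCentralSeries j ⊔ S⁆ ≤ U.lowerCentralSeries (j + 1) ⊔ S := by
    rw [Subgroup.commutator_comm]
    exact sup_commutator_le le_sup_left ((Subgroup.commutator_le_left S U).trans le_sup_right)
  have hD : ⁅D, U.lowerCentralSeries j ⊔ S⁆ ≤ U.lowerCentralSeries (j + 1) ⊔ S :=
    ((Subgroup.commutator_mono le_rfl le_top).trans F.D_central).trans le_sup_right
  exact sup_commutator_le hU hD (Subgroup.commutator_mem_commutator hτ hx)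

theorem pow_mem_of_mem_sup (F : CoprimeFiltration n r e q U D S W) {τ : G} (hτ : τ ∈ U ⊔ D) :
    τ ^ q ∈ U := by
  have := F.normal_U
  obtain ⟨u, hu, d, hd, rfl⟩ := Subgroup.mem_sup_of_normal_left.1 hτ
  simpa only [inv_mul_cancel_right] using
    U.mul_mem (mul_pow_mul_inv_pow_mem hu d q) (F.S_le_U (F.pow_mem d hd))

theorem isFixedPointFreeAlong_of_mul_left (F : CoprimeFiltration n r e q U D S W) {v d : G}
    (hv : v ∈ U) (h : IsFixedPointFreeAlong D W r (v * d)) : IsFixedPointFreeAlong D W r d := by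
  have hW (k : ℕ) : ∀ x ∈ W k, ⁅v, x⁆ ∈ W (k + 1) := fun x hx =>
    F.commutator_U_W_le k (Subgroup.commutator_mem_commutator hv hx)
  exact fun k hk => (h k hk).imp_right fun hfpf =>
    hfpf.of_mul_left (hW k) fun x hx => F.W_anti _ (hW (k + 1) x hx)

theorem commutator_inf_W_le (F : CoprimeFiltration n r e q U D S W) (H : Subgroup G) [H.Normal]
    (k : ℕ) : ⁅D, H ⊓ W k⁆ ≤ H ⊓ W k :=
  le_inf ((Subgroup.commutator_mono le_rfl inf_le_left).trans (Subgroup.commutator_le_right D H))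
    ((Subgroup.commutator_mono le_rfl inf_le_right).trans (F.commutator_D_W_le k))

theorem commutator_inf_W_self_le (F : CoprimeFiltration n r e q U D S W) (H : Subgroup G)
    [H.Normal] (k : ℕ) : ⁅H ⊓ W k, H ⊓ W k⁆ ≤ H ⊓ W (k + 1) :=
  le_inf ((Subgroup.commutator_mono inf_le_left inf_le_left).trans
    (Subgroup.commutator_le_left H H))
    ((Subgroup.commutator_mono (inf_le_right.trans (F.W_le k)) inf_le_right).trans
      (F.commutator_U_W_le k))

theorem isFixedPointFree_of_mem [Finite G] (F : CoprimeFiltration n r e q U D S W)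
    {H H' : Subgroup G} [H.Normal] [H'.Normal] (hHS : H ≤ S) (hHS' : ⁅H, S⁆ ≤ H')
    (hHD : H ≤ ⁅H, D⁆ ⊔ H') {d : G} (hd : d ∈ D) (hfpf : IsFixedPointFreeAlong D W r d) :
    IsFixedPointFree d H H' := by
  have := F.normal_S
  set π := QuotientGroup.mk' H'
  have : IsMulCommutative (H.map π) :=
    isMulCommutative_map_mk' ((Subgroup.commutator_mono le_rfl hHS).trans hHS')
  have : (H.map π).Normal :=
    Subgroup.Normal.map inferInstance _ (QuotientGroup.mk'_surjective H')
  have hπ (x : G) (hx : x ∈ H') : π x = 1 := mk'_apply_eq_one_iff.2 hx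
  have hdmem (k : ℕ) : ∀ x ∈ H ⊓ W k, ⁅d, x⁆ ∈ H ⊓ W k := fun x hx =>
    F.commutator_inf_W_le H k (Subgroup.commutator_mem_commutator hd hx)
  rw [← QuotientGroup.ker_mk' H']
  refine IsFixedPointFree.of_map π (isFixedPointFree_bot_of_filtration (D := D.map π)
    (V := fun k => (H ⊓ W k).map π) (r := r) ?_ ?_ ?_ ?_ fun k hk => ?_)
  · rintro _ ⟨d', hd', rfl⟩ _ ⟨x, hx, rfl⟩
    rw [← map_commutatorElement, ← map_commutatorElement]
    refine hπ _ (hHS' (Subgroup.commutator_comm H S ▸ ?_))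
    exact Subgroup.commutator_mem_commutator
      (F.D_central (Subgroup.commutator_mem_commutator hd' (Subgroup.mem_top d))) hx
  · have hH' : H'.map π = ⊥ := (Subgroup.map_eq_bot_iff _).2 (QuotientGroup.ker_mk' H').ge
    rw [← Subgroup.map_commutator, Subgroup.commutator_comm, ← sup_bot_eq ((⁅H, D⁆).map π), ← hH',
      ← Subgroup.map_sup]
    exact Subgroup.map_mono hHD
  · rw [F.W_zero, inf_eq_left.2 (hHS.trans F.S_le_U)]
  · rw [F.W_last, inf_bot_eq, Subgroup.map_bot]
  · refine (hfpf k hk).imp (fun htriv => ?_) fun hk => ?_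
    · rw [← Subgroup.map_commutator]
      exact Subgroup.map_mono (le_inf ((F.commutator_inf_W_le H k).trans inf_le_left)
        ((Subgroup.commutator_mono le_rfl inf_le_right).trans htriv))
    · have hk' : IsFixedPointFree d (H ⊓ W k : Subgroup G) (H ⊓ W (k + 1)) :=
        fun x hx hdx => ⟨hx.1, hk x hx.2 hdx.2⟩
      rintro _ ⟨x, hx, rfl⟩
      obtain ⟨y, hy, hyx⟩ :=
        hk'.exists_commutator_inv_mul_mem (F.commutator_inf_W_self_le H k) (hdmem k)
          (hdmem (k + 1)) x hx
      refine ⟨π y, ⟨y, hy.1, rfl⟩, _, hyx, ?_⟩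
      rw [map_mul, map_inv, map_commutatorElement]

theorem isFixedPointFree [Finite G] (F : CoprimeFiltration n r e q U D S W)
    {H H' : Subgroup G} [H.Normal] [H'.Normal] (hHS : H ≤ S) (hHU : ⁅H, U⁆ ≤ H')
    (hHD : H ≤ ⁅H, D⁆ ⊔ H') {τ : G} (hτ : τ ∈ U ⊔ D) (hfpf : IsFixedPointFreeAlong D W r τ) :
    IsFixedPointFree τ H H' := by
  have := F.normal_U
  obtain ⟨v, hv, d, hd, rfl⟩ := Subgroup.mem_sup_of_normal_left.1 hτ
  have hfpfd := F.isFixedPointFree_of_mem hHS ((Subgroup.commutator_mono le_rfl F.S_le_U).trans hHU)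
    hHD hd (F.isFixedPointFreeAlong_of_mul_left hv hfpf)
  refine IsFixedPointFree.of_mul_left (v := v⁻¹) (by rwa [inv_mul_cancel_left]) (fun x hx => ?_)
    fun x hx => ?_
  · exact hHU (Subgroup.commutator_comm H U ▸
      Subgroup.commutator_mem_commutator (U.inv_mem hv) hx)
  · exact Subgroup.commutator_le_right ⊤ H'
      (Subgroup.commutator_mem_commutator (Subgroup.mem_top _) hx)

theorem commutator_le_commutator_commutator (F : CoprimeFiltration n r e q U D S W)
    {H H' : Subgroup G} [H.Normal] [H'.Normal] (hHS : H ≤ S) (hHS' : ⁅H, S⁆ ≤ H') :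
    ⁅H, D⁆ ≤ ⁅⁅H, D⁆, D⁆ ⊔ H' := by
  have := F.normal_D
  set N : Subgroup G := ⁅⁅H, D⁆, D⁆ ⊔ H'
  set π := QuotientGroup.mk' N
  rw [Subgroup.commutator_le]
  intro h hh d hd
  have hz : ⁅h, d⁆ ∈ ⁅H, D⁆ := Subgroup.commutator_mem_commutator hh hd
  have hzU : ⁅h, d⁆ ∈ U := F.S_le_U (hHS (Subgroup.commutator_le_left H D hz))
  have hzd : Commute (π ⁅h, d⁆) (π d) := by
    rw [← commutatorElement_eq_one_iff_commute, ← map_commutatorElement]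
    exact mk'_apply_eq_one_iff.2 (Subgroup.mem_sup_left (Subgroup.commutator_mem_commutator hz hd))
  have hhd : Commute (π h) (π d ^ q) := by
    rw [← map_pow, ← commutatorElement_eq_one_iff_commute, ← map_commutatorElement]
    exact mk'_apply_eq_one_iff.2 (Subgroup.mem_sup_right
      (hHS' (Subgroup.commutator_mem_commutator hh (F.pow_mem d hd))))
  have hconj : π h * π d * (π h)⁻¹ = π ⁅h, d⁆ * π d := by
    rw [map_commutatorElement, commutatorElement_def, inv_mul_cancel_right]
  have hpow : π d ^ q = π ⁅h, d⁆ ^ q * π d ^ q := by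
    rw [← hzd.mul_pow, ← hconj, conj_pow, hhd.eq, mul_inv_cancel_right]
  rw [← mk'_apply_eq_one_iff]
  exact eq_one_of_pow_eq_one_of_coprime F.coprime
    (by rw [← map_pow, F.pow_eq _ hzU, map_one]) (mul_eq_right.1 hpow.symm)

end CoprimeFiltration

end PivotData

section Covers

variable {G : Type*} [Group G] {A : Set G} {K : ℝ}

/-- Every element of `H` is congruent modulo `H'` to an element of `B`; that is, `H ⊆ B H'`. -/
def Covers (B : Set G) (H H' : Subgroup G) : Prop := ∀ x ∈ H, ∃ b ∈ B, b⁻¹ * x ∈ H'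

theorem Covers.of_le {B : Set G} (hB : 1 ∈ B) {H H' : Subgroup G} (h : H ≤ H') : Covers B H H' :=
  fun x hx => ⟨1, hB, by simpa using h hx⟩

theorem Covers.trans {B : Set G} {H₁ H₂ H₃ : Subgroup G} {i j : ℕ} (h₁₂ : Covers (B ^ i) H₁ H₂)
    (h₂₃ : Covers (B ^ j) H₂ H₃) : Covers (B ^ (i + j)) H₁ H₃ := fun x hx => by
  obtain ⟨b, hb, hbx⟩ := h₁₂ x hx
  obtain ⟨c, hc, hcx⟩ := h₂₃ _ hbx
  exact ⟨b * c, SmallGrowth.mul_mem hb hc, by rwa [mul_inv_rev, mul_assoc]⟩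

theorem SmallGrowth.exists_normal_mem_iff_of_reduction (hB : SmallGrowth (A ^ 2) K)
    (hA : Subgroup.closure A = ⊤) (hinv : A⁻¹ = A) {S L : Subgroup G} [S.Normal] [L.Normal]
    {m : ℕ} (hred : ∀ y ∈ S, ∀ b ∈ (A ^ 2) ^ (2 * m + 1), b⁻¹ * y ∈ L →
      ∃ c ∈ (A ^ 2) ^ m, c⁻¹ * y ∈ L) :
    ∃ C : Subgroup G, C.Normal ∧ ∀ x, x ∈ C ↔ x ∈ S ∧ ∃ b ∈ (A ^ 2) ^ m, b⁻¹ * x ∈ L := by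
  let C : Subgroup G :=
    { carrier := {x | x ∈ S ∧ ∃ b ∈ (A ^ 2) ^ m, b⁻¹ * x ∈ L}
      one_mem' := ⟨S.one_mem, 1, hB.one_mem_pow m, by simp⟩
      mul_mem' := by
        rintro x y ⟨hx, b, hb, hbx⟩ ⟨hy, c, hc, hcy⟩
        refine ⟨S.mul_mem hx hy, hred _ (S.mul_mem hx hy) (b * c)
          (hB.pow_mono (by lia) (SmallGrowth.mul_mem hb hc)) ?_⟩
        rw [← mk'_apply_eq_one_iff, map_mul, map_inv, inv_mul_eq_one] at *
        rw [map_mul, map_mul, hbx, hcy]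
      inv_mem' := by
        rintro x ⟨hx, b, hb, hbx⟩
        refine ⟨S.inv_mem hx, b⁻¹, hB.inv_mem hb, ?_⟩
        rw [← mk'_apply_eq_one_iff, map_mul, map_inv, inv_mul_eq_one] at *
        rw [map_inv, map_inv, hbx] }
  refine ⟨C, normal_of_forall_conj_mem hA hinv ?_, fun x => Iff.rfl⟩
  rintro a ha x ⟨hx, b, hb, hbx⟩
  have hax : a * x * a⁻¹ ∈ S := Subgroup.Normal.conj_mem inferInstance x hx a
  refine ⟨hax, hred _ hax (a * b * a⁻¹) (hB.pow_mono (by lia) (conj_mem_sq_pow hinv ha hb)) ?_⟩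
  simpa [mul_assoc] using Subgroup.Normal.conj_mem inferInstance _ hbx a

theorem SmallGrowth.le_of_covers (hB : SmallGrowth (A ^ 2) K)
    (hA : Subgroup.closure A = ⊤) (hinv : A⁻¹ = A) {S U H N : Subgroup G} [S.Normal] [H.Normal]
    [N.Normal] {m : ℕ} (hHSU : H ≤ ⁅S, U⁆) (hHU : ⁅H, U⁆ ≤ N)
    (hcov : Covers ((A ^ 2) ^ m) S H)
    (hN : ∀ x ∈ (A ^ 2) ^ (3 * m + 1), x ∈ H → x ∈ N) : H ≤ N := by
  obtain ⟨C, hC, hmemC⟩ : ∃ C : Subgroup G, C.Normal ∧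
      ∀ x, x ∈ C ↔ x ∈ S ∧ ∃ b ∈ (A ^ 2) ^ m, b⁻¹ * x ∈ N ⊓ H := by
    refine hB.exists_normal_mem_iff_of_reduction hA hinv fun y hy b hb hby => ?_
    obtain ⟨c, hc, hcy⟩ := hcov y hy
    have hcb : c⁻¹ * b ∈ H := by
      simpa [mul_assoc] using H.mul_mem hcy (H.inv_mem hby.2)
    have hcbN : c⁻¹ * b ∈ N :=
      hN _ (hB.pow_mono (by lia) (SmallGrowth.mul_mem (hB.inv_mem hc) hb)) hcb
    exact ⟨c, hc, by simpa [mul_assoc] using N.mul_mem hcbN hby.1, hcy⟩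
  have hHUN : ⁅H, U⁆ ≤ N ⊓ H := le_inf hHU (Subgroup.commutator_le_left H U)
  have hNC : N ⊓ H ≤ C := fun x hx => (hmemC x).2
    ⟨Subgroup.commutator_le_left S U (hHSU hx.2), 1, hB.one_mem_pow m, by simpa using hx⟩
  have hSCH : S ≤ C ⊔ H := fun x hx => by
    obtain ⟨b, hb, hbx⟩ := hcov x hx
    have hbS : b ∈ S := by
      simpa using S.mul_mem hx (S.inv_mem (Subgroup.commutator_le_left S U (hHSU hbx)))
    have hbC : b ∈ C := (hmemC b).2 ⟨hbS, b, hb, by simp [(N ⊓ H).one_mem]⟩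
    simpa using Subgroup.mul_mem_sup hbC hbx
  have hSU : ⁅S, U⁆ ≤ C := (Subgroup.commutator_mono hSCH le_rfl).trans
    (sup_commutator_le (Subgroup.commutator_le_left C U) (hHUN.trans hNC))
  intro x hx
  obtain ⟨-, b, hb, hbx⟩ := (hmemC x).1 (hSU (hHSU hx))
  have hbH : b ∈ H := by simpa using H.mul_mem hx (H.inv_mem hbx.2)
  simpa using N.mul_mem (hN b (hB.pow_mono (by lia) hb) hbH) hbx.1

theorem SmallGrowth.iterate_commutator_mem {B : Set G} (hB : SmallGrowth B K) {τ x : G} {a b : ℕ}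
    (hτ : τ ∈ B ^ a) (hx : x ∈ B ^ b) (j : ℕ) :
    (fun y => ⁅τ, y⁆)^[j] x ∈ B ^ ((2 * a + b) * 2 ^ j - 2 * a) := by
  induction j with
  | zero => simpa using hx
  | succ j ih =>
    rw [Function.iterate_succ_apply']
    have hpos := Nat.le_mul_of_pos_right (2 * a + b) (pow_pos (by norm_num : 0 < 2) j)
    refine hB.pow_mono ?_ (hB.commutator_mem hτ ih)
    rw [pow_succ]
    lia

theorem commute_pow_of_iterate_commutator_eq_one {U : Subgroup G} [U.Normal] {e q : ℕ}
    (hU : ∀ u ∈ U, u ^ e = 1) (heq : e.Coprime q) {τ : G} (hτ : τ ^ q ∈ U)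
    (hτU : ∀ x, ⁅τ, x⁆ ∈ U) (k : ℕ) {x : G} (hx : (fun y => ⁅τ, y⁆)^[k] x = 1) :
    Commute (τ ^ e) x := by
  induction k generalizing x with
  | zero => rw [show x = 1 from hx]; exact Commute.one_right _
  | succ k ih => exact commute_pow_of_commute_commutator hU heq hτ (hτU x) (ih hx)

end Covers

namespace CoprimeFiltration

variable {G : Type*} [Group G] {n r e q : ℕ} {U D S : Subgroup G} {W : ℕ → Subgroup G}

theorem commute_mk'_pow (F : CoprimeFiltration n r e q U D S W) {N : Subgroup G} [N.Normal]
    {τ : G} (hτ : τ ∈ U ⊔ D) {k : ℕ} {x : G} (hx : (fun y => ⁅τ, y⁆)^[k] x ∈ N) :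
    Commute (QuotientGroup.mk' N τ ^ e) (QuotientGroup.mk' N x) := by
  set π := QuotientGroup.mk' N
  have hU : (U.map π).Normal := F.normal_U.map _ (QuotientGroup.mk'_surjective N)
  refine commute_pow_of_iterate_commutator_eq_one (U := U.map π) ?_ F.coprime
    ⟨τ ^ q, F.pow_mem_of_mem_sup hτ, map_pow π τ q⟩ ?_ k ?_
  · rintro _ ⟨u, hu, rfl⟩
    rw [← map_pow, F.pow_eq u hu, map_one]
  · intro y
    obtain ⟨y, rfl⟩ := QuotientGroup.mk'_surjective N y
    exact ⟨⁅τ, y⁆, F.commutator_mem hτ y, map_commutatorElement π τ y⟩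
  · have hsemi : Function.Semiconj π (fun y => ⁅τ, y⁆) (fun y => ⁅π τ, y⁆) :=
      map_commutatorElement π τ
    rw [← (hsemi.iterate_right k).eq, mk'_apply_eq_one_iff.2 hx]

theorem iterate_commutator_mem_sup (F : CoprimeFiltration n r e q U D S W) {τ : G}
    (hτ : τ ∈ U ⊔ D) (j : ℕ) (x : G) :
    (fun y => ⁅τ, y⁆)^[j + 1] x ∈ U.lowerCentralSeries j ⊔ S := by
  induction j with
  | zero => exact Subgroup.mem_sup_left (F.commutator_mem hτ x)
  | succ j ih =>
    rw [Function.iterate_succ_apply']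
    exact F.commutator_mem_sup hτ ih

end CoprimeFiltration

namespace PivotData

variable {G : Type*} [Group G] {n r e q : ℕ} {A : Set G} {K : ℝ} {U D S : Subgroup G}
  {W : ℕ → Subgroup G} {T : Set G}

theorem inv_mul_mem_pow (P : PivotData n r e q A K U D S W T) {t t' : G} (ht : t ∈ T)
    (ht' : t' ∈ T) : t⁻¹ * t' ∈ (A ^ 2) ^ 4 :=
  SmallGrowth.mul_mem (P.growth.inv_mem (P.T_sub ht)) (P.T_sub ht')

theorem inv_mul_mem_sup (P : PivotData n r e q A K U D S W T) {t t' : G} (ht : t ∈ T)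
    (ht' : t' ∈ T) : t⁻¹ * t' ∈ U ⊔ D :=
  Subgroup.mul_mem _ (Subgroup.inv_mem _ (P.T_le ht)) (P.T_le ht')

theorem isFixedPointFree_inv_mul [Finite G] (P : PivotData n r e q A K U D S W T)
    {H H' : Subgroup G} [H.Normal] [H'.Normal] (hHS : H ≤ S) (hHU : ⁅H, U⁆ ≤ H')
    (hHD : H ≤ ⁅H, D⁆ ⊔ H') {t t' : G} (ht : t ∈ T) (ht' : t' ∈ T) (hne : t ≠ t') :
    IsFixedPointFree (t⁻¹ * t') H H' :=
  P.isFixedPointFree hHS hHU hHD (P.inv_mul_mem_sup ht ht') (P.rich t ht t' ht' hne)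

-- With `τ = t⁻¹ t'`, the iterated commutators of `τ` with a generator land in `S`, hence in `N`,
-- so `τ ^ e` is central modulo `N`; as `τ ^ q ∈ U`, the whole of `⁅τ, S⁆` lies in `N`.
theorem le_of_pow_inter_le [Finite G] (P : PivotData n r e q A K U D S W T) {N : Subgroup G}
    [N.Normal] (hSU : ⁅S, U⁆ ≤ N) {t t' : G} (ht : t ∈ T) (ht' : t' ∈ T) (hne : t ≠ t')
    (hN : ∀ x ∈ (A ^ 2) ^ (17 * 2 ^ n), x ∈ S → x ∈ N) : S ≤ N := by
  have := P.normal_S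
  set τ := t⁻¹ * t'
  set π := QuotientGroup.mk' N
  have hτ : τ ∈ U ⊔ D := P.inv_mul_mem_sup ht ht'
  have hτB : τ ∈ (A ^ 2) ^ 4 := P.inv_mul_mem_pow ht ht'
  have hcentral : ∀ g ∈ A, Commute (π τ ^ e) (π g) := by
    intro g hg
    refine P.commute_mk'_pow (k := n + 1) hτ (hN _ ?_ ?_)
    · have hτg : ⁅τ, g⁆ ∈ (A ^ 2) ^ 9 := by
        rw [commutatorElement_def, mul_assoc, mul_assoc, ← mul_assoc g]
        exact SmallGrowth.mul_mem hτB (conj_mem_sq_pow P.inv_eq hg (P.growth.inv_mem hτB))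
      exact P.growth.pow_mono (Nat.sub_le _ _) (P.growth.iterate_commutator_mem hτB hτg n)
    · simpa only [P.nilp, bot_sup_eq] using P.iterate_commutator_mem_sup hτ n g
  have hcentral' (x : G) : τ ^ e ∈ (Subgroup.centralizer {π x}).comap π := by
    have hle : Subgroup.closure A ≤ (Subgroup.centralizer {π τ ^ e}).comap π :=
      (Subgroup.closure_le _).2 fun g hg =>
        Subgroup.mem_centralizer_singleton_iff.2 (hcentral g hg).eq.symm
    have hx : π x ∈ Subgroup.centralizer {π τ ^ e} :=
      hle (P.closure_eq ▸ Subgroup.mem_top x)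
    rw [Subgroup.mem_centralizer_singleton_iff] at hx
    rw [Subgroup.mem_comap, Subgroup.mem_centralizer_singleton_iff, map_pow, hx]
  intro x hx
  have hq : τ ^ q ∈ (Subgroup.centralizer {π x}).comap π := by
    rw [Subgroup.mem_comap, Subgroup.mem_centralizer_singleton_iff,
      ← commutatorElement_eq_one_iff_mul_comm, ← map_commutatorElement, mk'_apply_eq_one_iff]
    rw [Subgroup.commutator_comm] at hSU
    exact hSU (Subgroup.commutator_mem_commutator (P.pow_mem_of_mem_sup hτ) hx)
  have hcomm : Commute (π τ) (π x) := Subgroup.mem_centralizer_singleton_iff.1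
    (mem_of_pow_mem_of_coprime _ P.coprime (hcentral' x) hq)
  refine P.isFixedPointFree_inv_mul le_rfl hSU (P.S_le.trans le_sup_left) ht ht' hne x hx ?_
  rwa [← mk'_apply_eq_one_iff, map_commutatorElement, commutatorElement_eq_one_iff_commute]

end PivotData

section Section

variable {G : Type*} [Group G] {A : Set G} {K : ℝ} {H H' : Subgroup G} [H'.Normal]

/-- The class of an element of `H` in the section `H / H'`, written additively. The section is
realised as the image of `H` in `G ⧸ H'`. -/
def sectionMk (H H' : Subgroup G) [H'.Normal] (h : H) :
    Additive (H.map (QuotientGroup.mk' H')) :=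
  Additive.ofMul ((QuotientGroup.mk' H').subgroupMap H h)

theorem sectionMk_surjective : Function.Surjective (sectionMk H H') :=
  (QuotientGroup.mk' H').subgroupMap_surjective H

theorem sectionMk_eq_iff {x y : H} :
    sectionMk H H' x = sectionMk H H' y ↔ (x : G)⁻¹ * y ∈ H' :=
  Subtype.ext_iff.trans QuotientGroup.eq

theorem sectionMk_one : sectionMk H H' 1 = 0 := congrArg Additive.ofMul (map_one _)

theorem sectionMk_eq_zero_iff {x : H} : sectionMk H H' x = 0 ↔ (x : G) ∈ H' := by
  rw [← sectionMk_one, eq_comm, sectionMk_eq_iff, Subgroup.coe_one, inv_one, one_mul]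

/-- The classes in `H / H'` of the elements of `H` lying in the `j`-th power of `A ^ 2`. -/
noncomputable def sectionPow [Finite G] (A : Set G) (H H' : Subgroup G) [H'.Normal] (j : ℕ) :
    Finset (Additive (H.map (QuotientGroup.mk' H'))) :=
  (Set.toFinite (sectionMk H H' '' {h | (h : G) ∈ (A ^ 2) ^ j})).toFinset

theorem mem_sectionPow [Finite G] {j : ℕ} {x : Additive (H.map (QuotientGroup.mk' H'))} :
    x ∈ sectionPow A H H' j ↔ ∃ b : H, (b : G) ∈ (A ^ 2) ^ j ∧ sectionMk H H' b = x := by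
  rw [sectionPow, Set.Finite.mem_toFinset]; rfl

theorem sectionMk_mem_sectionPow [Finite G] {j : ℕ} {b : H} (hb : (b : G) ∈ (A ^ 2) ^ j) :
    sectionMk H H' b ∈ sectionPow A H H' j :=
  mem_sectionPow.2 ⟨b, hb, rfl⟩

theorem sectionPow_mono [Finite G] (hB : SmallGrowth (A ^ 2) K) :
    Monotone (sectionPow A H H') := by
  intro i j hij x hx
  obtain ⟨b, hb, rfl⟩ := mem_sectionPow.1 hx
  exact sectionMk_mem_sectionPow (hB.pow_mono hij hb)

theorem card_sectionPow [Finite G] (hle : H' ≤ H) (j : ℕ) : (sectionPow A H H' j).card =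
    ((QuotientGroup.mk' H' '' (A ^ 2)) ^ j ∩ H.map (QuotientGroup.mk' H') : Set _).ncard := by
  have hinj : Function.Injective fun x : Additive (H.map (QuotientGroup.mk' H')) =>
      (x.toMul : G ⧸ H') := fun x y h => Additive.toMul.injective (Subtype.ext h)
  rw [← Set.ncard_coe_finset, ← Set.ncard_image_of_injective _ hinj, ← Set.image_pow]
  congr 1
  ext y
  constructor
  · rintro ⟨x, hx, rfl⟩
    obtain ⟨b, hb, rfl⟩ := mem_sectionPow.1 hx
    exact ⟨⟨b, hb, rfl⟩, b, b.2, rfl⟩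
  · rintro ⟨⟨b, hb, rfl⟩, h, hh, hhb⟩
    have hbH : b ∈ H := by simpa using H.mul_mem hh (hle (QuotientGroup.eq.1 hhb))
    exact ⟨sectionMk H H' ⟨b, hbH⟩, sectionMk_mem_sectionPow hb, rfl⟩

theorem SmallGrowth.card_sectionPow_le [Finite G] (hB : SmallGrowth (A ^ 2) K) (hle : H' ≤ H)
    (j : ℕ) : ((sectionPow A H H' j).card : ℝ) ≤
      (K ^ 3) ^ (j + 1) * (sectionPow A H H' 2).card := by
  rw [card_sectionPow hle, card_sectionPow hle]
  exact (hB.image _).ncard_pow_inter_le _ j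

variable [IsMulCommutative (H.map (QuotientGroup.mk' H'))]

theorem isBallFamily_sectionPow [Finite G] (hB : SmallGrowth (A ^ 2) K) :
    IsBallFamily (sectionPow A H H') where
  mono := sectionPow_mono hB
  zero_mem j := mem_sectionPow.2 ⟨1, hB.one_mem_pow j, sectionMk_one⟩
  neg_mem j x hx := by
    obtain ⟨b, hb, rfl⟩ := mem_sectionPow.1 hx
    exact mem_sectionPow.2 ⟨b⁻¹, hB.inv_mem hb, congrArg Additive.ofMul (map_inv _ b)⟩
  add_mem i j x hx y hy := by
    obtain ⟨b, hb, rfl⟩ := mem_sectionPow.1 hx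
    obtain ⟨c, hc, rfl⟩ := mem_sectionPow.1 hy
    exact mem_sectionPow.2
      ⟨b * c, SmallGrowth.mul_mem hb hc, congrArg Additive.ofMul (map_mul _ b c)⟩

variable [H.Normal]

instance normal_map_mk' : (H.map (QuotientGroup.mk' H')).Normal :=
  Subgroup.Normal.map inferInstance _ (QuotientGroup.mk'_surjective H')

/-- The action of `G` by conjugation on the abelian section `H / H'`. -/
def sectionConj (H H' : Subgroup G) [H'.Normal] [H.Normal]
    [IsMulCommutative (H.map (QuotientGroup.mk' H'))] :
    G →* AddMonoid.End (Additive (H.map (QuotientGroup.mk' H'))) :=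
  (conjEnd (H.map (QuotientGroup.mk' H'))).comp (QuotientGroup.mk' H')

theorem sectionConj_sectionMk (g : G) (h : H) : sectionConj H H' g (sectionMk H H' h) =
    sectionMk H H' ⟨g * h * g⁻¹, Subgroup.Normal.conj_mem inferInstance _ h.2 g⟩ := rfl

theorem commute_sectionConj {U : Subgroup G} (hHU : ⁅H, U⁆ ≤ H') {t g : G} (htg : ⁅t, g⁆ ∈ U) :
    Commute (sectionConj H H' t) (sectionConj H H' g) := by
  refine commute_conjEnd _ ?_
  rintro _ ⟨h, hh, rfl⟩
  rw [← map_commutatorElement, ← map_commutatorElement, mk'_apply_eq_one_iff]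
  rw [Subgroup.commutator_comm] at hHU
  exact hHU (Subgroup.commutator_mem_commutator htg hh)

theorem IsFixedPointFree.injective_sectionConj_sub {t t' : G}
    (h : IsFixedPointFree (t⁻¹ * t') H H') :
    Function.Injective (sectionConj H H' t - sectionConj H H' t' : AddMonoid.End _) := by
  rw [injective_iff_map_eq_zero]
  intro x hx
  obtain ⟨x, rfl⟩ := sectionMk_surjective x
  have heq : sectionConj H H' t (sectionMk H H' x) = sectionConj H H' t' (sectionMk H H' x) :=
    sub_eq_zero.1 hx
  rw [sectionConj_sectionMk, sectionConj_sectionMk] at heq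
  have hquot : (t * x * t⁻¹)⁻¹ * (t' * x * t'⁻¹) ∈ H' := sectionMk_eq_iff.1 heq
  have hconj : ⁅t⁻¹ * t', (x : G)⁆ =
      t⁻¹ * ((t * x * t⁻¹) * ((t * x * t⁻¹)⁻¹ * (t' * x * t'⁻¹)) * (t * x * t⁻¹)⁻¹) * t⁻¹⁻¹ := by
    simp only [commutatorElement_def]; group
  refine sectionMk_eq_zero_iff.2 (h x x.2 ?_)
  rw [hconj]
  have hH' : H'.Normal := inferInstance
  exact hH'.conj_mem _ (hH'.conj_mem _ hquot _) _

theorem IsFixedPointFree.sectionConj_ne {t t' : G} (h : IsFixedPointFree (t⁻¹ * t') H H')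
    (hHH' : ¬ H ≤ H') : sectionConj H H' t ≠ sectionConj H H' t' := by
  refine fun heq => hHH' fun x hx => sectionMk_eq_zero_iff.1 (h.injective_sectionConj_sub ?_ :
    sectionMk H H' ⟨x, hx⟩ = 0)
  rw [heq, sub_self]
  rfl

theorem sectionConj_mem_sectionPow_of_mem_pow [Finite G] (hB : SmallGrowth (A ^ 2) K) {g : G}
    (hg : g ∈ (A ^ 2) ^ 2) {j : ℕ} {x : Additive (H.map (QuotientGroup.mk' H'))}
    (hx : x ∈ sectionPow A H H' j) : sectionConj H H' g x ∈ sectionPow A H H' (j + 4) := by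
  obtain ⟨b, hb, rfl⟩ := mem_sectionPow.1 hx
  rw [sectionConj_sectionMk]
  refine sectionMk_mem_sectionPow (hB.pow_mono (by lia : 2 + j + 2 ≤ j + 4) ?_)
  exact SmallGrowth.mul_mem (SmallGrowth.mul_mem hg hb) (hB.inv_mem hg)

theorem sectionConj_mem_sectionPow_of_mem [Finite G] (hinv : A⁻¹ = A) {a : G} (ha : a ∈ A) {j : ℕ}
    {x : Additive (H.map (QuotientGroup.mk' H'))} (hx : x ∈ sectionPow A H H' j) :
    sectionConj H H' a x ∈ sectionPow A H H' (j + 1) := by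
  obtain ⟨b, hb, rfl⟩ := mem_sectionPow.1 hx
  rw [sectionConj_sectionMk]
  exact sectionMk_mem_sectionPow (conj_mem_sq_pow hinv ha hb)

theorem eq_top_of_sectionPow_subset [Finite G] (hA : Subgroup.closure A = ⊤) (hinv : A⁻¹ = A)
    {m : ℕ} (hgen : ∀ N : Subgroup G, N.Normal → H' ≤ N →
      (∀ x ∈ (A ^ 2) ^ m, x ∈ H → x ∈ N) → H ≤ N)
    {N : AddSubgroup (Additive (H.map (QuotientGroup.mk' H')))}
    (hN : ∀ a ∈ A, ∀ x ∈ N, sectionConj H H' a x ∈ N)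
    (hXN : ∀ x ∈ sectionPow A H H' m, x ∈ N) : N = ⊤ := by
  let N₀ : Subgroup G := ((AddSubgroup.toSubgroup' N).map
    (H.map (QuotientGroup.mk' H')).subtype).comap (QuotientGroup.mk' H')
  have hmemN₀ (g : G) : g ∈ N₀ ↔ ∃ x ∈ N, (x.toMul : G ⧸ H') = QuotientGroup.mk' H' g := Iff.rfl
  have hnormal : N₀.Normal := by
    refine normal_of_forall_conj_mem hA hinv fun a ha g hg => ?_
    obtain ⟨x, hx, hxg⟩ := (hmemN₀ g).1 hg
    refine (hmemN₀ _).2 ⟨_, hN a ha x hx, ?_⟩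
    rw [map_mul, map_mul, map_inv, ← hxg]
    rfl
  have hle : H ≤ N₀ := by
    refine hgen N₀ hnormal (fun g hg => (hmemN₀ g).2 ⟨0, N.zero_mem, ?_⟩) fun g hg hgH =>
      (hmemN₀ g).2 ⟨sectionMk H H' ⟨g, hgH⟩, hXN _ (sectionMk_mem_sectionPow hg), rfl⟩
    exact (mk'_apply_eq_one_iff.2 hg).symm
  refine eq_top_iff.2 fun x _ => ?_
  obtain ⟨h, rfl⟩ := sectionMk_surjective x
  obtain ⟨y, hy, hyh⟩ := (hmemN₀ h).1 (hle h.2)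
  have hyx : y = sectionMk H H' h := Additive.toMul.injective (Subtype.ext hyh)
  exact hyx ▸ hy

theorem eq_univ_of_sectionConj_add_mem [Finite G] (hB : SmallGrowth (A ^ 2) K)
    (hA : Subgroup.closure A = ⊤) (hinv : A⁻¹ = A) {m : ℕ}
    (hgen : ∀ N : Subgroup G, N.Normal → H' ≤ N → (∀ x ∈ (A ^ 2) ^ m, x ∈ H → x ∈ N) → H ≤ N)
    {N : Set (Additive (H.map (QuotientGroup.mk' H')))} (h₀ : 0 ∈ N)
    (h : ∀ a ∈ A, ∀ y ∈ N, ∀ x ∈ sectionPow A H H' m, sectionConj H H' a y + x ∈ N) :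
    N = Set.univ := by
  have hball : IsBallFamily (sectionPow A H H') := isBallFamily_sectionPow hB
  have hne : A.Nonempty := by
    obtain ⟨a, ha, -⟩ := Set.mem_mul.1 (sq A ▸ hB.one_mem)
    exact ⟨a, ha⟩
  refine eq_univ_of_add_mem (Ψ := sectionConj H H' '' A) ?_ (hne.image _) (hball.zero_mem m)
    (hball.neg_mem m) (fun M hM hXM => eq_top_of_sectionPow_subset hA hinv hgen
      (fun a ha => hM _ ⟨a, ha, rfl⟩) hXM) h₀ (Set.forall_mem_image.2 h)
  rintro _ ⟨a, ha, rfl⟩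
  refine ⟨_, ⟨a⁻¹, hinv ▸ Set.inv_mem_inv.2 ha, rfl⟩, ?_⟩
  rw [← map_mul, mul_inv_cancel, map_one]

theorem mem_sectionPow_of_pairwise_isFixedPointFree [Finite G] (hB : SmallGrowth (A ^ 2) K)
    (hA : Subgroup.closure A = ⊤) (hinv : A⁻¹ = A) {m : ℕ}
    (hgen : ∀ N : Subgroup G, N.Normal → H' ≤ N → (∀ x ∈ (A ^ 2) ^ m, x ∈ H → x ∈ N) → H ≤ N)
    {T : Set G} (hT : T ⊆ (A ^ 2) ^ 2)
    (hfpf : T.Pairwise fun t t' => IsFixedPointFree (t⁻¹ * t') H H') (hHH' : ¬ H ≤ H')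
    (hcommute : ∀ t ∈ T, ∀ g, Commute (sectionConj H H' t) (sectionConj H H' g)) {L : ℝ}
    (hL₁ : 1 ≤ L)
    (hL : (sectionPow A H H' (20 * (m + 4 + 1))).card ≤ L * (sectionPow A H H' m).card)
    (hTL : 64 * L ^ 6 < T.ncard) (x : Additive (H.map (QuotientGroup.mk' H'))) :
    x ∈ sectionPow A H H' (6 * m + 4) := by
  have hinj : Set.InjOn (sectionConj H H') T := fun t ht t' ht' heq => by
    by_contra hne
    exact (hfpf ht ht' hne).sectionConj_ne hHH' heq
  let T' : Finset (AddMonoid.End _) := (Set.toFinite (sectionConj H H' '' T)).toFinset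
  have hcoe : (T' : Set (AddMonoid.End _)) = sectionConj H H' '' T := Set.Finite.coe_toFinset _
  have hforall {p : AddMonoid.End _ → Prop} : (∀ τ ∈ T', p τ) ↔ ∀ t ∈ T, p (sectionConj H H' t) :=
    by simp only [T', Set.Finite.mem_toFinset, Set.forall_mem_image]
  have hcard : T'.card = T.ncard := by
    rw [← Set.ncard_coe_finset, hcoe, hinj.ncard_image]
  refine mem_of_commuting_of_injective_sub (T := T') (Ψ := sectionConj H H' '' A) ?_
    (hforall.2 fun t ht => hforall.2 fun t' _ => hcommute t ht t')
    (hforall.2 fun t ht => Set.forall_mem_image.2 fun a _ => hcommute t ht a)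
    (isBallFamily_sectionPow hB)
    (hforall.2 fun t ht _ _ => sectionConj_mem_sectionPow_of_mem_pow hB (hT ht))
    (Set.forall_mem_image.2 fun a ha _ _ => sectionConj_mem_sectionPow_of_mem hinv ha)
    (fun N h₀ h => eq_univ_of_sectionConj_add_mem hB hA hinv hgen h₀ (Set.forall_mem_image.1 h))
    hL₁ hL (hcard ▸ hTL) x
  rw [hcoe]
  rintro _ ⟨t, ht, rfl⟩ _ ⟨t', ht', rfl⟩ hne
  exact (hfpf ht ht' fun h => hne (congrArg _ h)).injective_sectionConj_sub

end Section

/-- Exponent of `K` in the lower bound on the size of `T` required by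
`PivotData.covers_of_fixedPointFree`. -/
def fpfExponent (m : ℕ) : ℕ := 6 + 18 * (20 * (m + 4 + 1) + 1)

theorem pow_le_pow_fpfExponent {K : ℝ} (hK : 2 ≤ K) (m : ℕ) :
    64 * ((K ^ 3) ^ (20 * (m + 4 + 1) + 1)) ^ 6 ≤ K ^ fpfExponent m := by
  calc 64 * ((K ^ 3) ^ (20 * (m + 4 + 1) + 1)) ^ 6
      ≤ K ^ 6 * ((K ^ 3) ^ (20 * (m + 4 + 1) + 1)) ^ 6 := by
        gcongr
        exact (by norm_num : (64 : ℝ) = 2 ^ 6).trans_le (by gcongr)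
    _ = K ^ fpfExponent m := by
        rw [← pow_mul, ← pow_mul, ← pow_add]
        exact congrArg (fun k : ℕ => K ^ k) (by rw [fpfExponent]; ring)

namespace PivotData

variable {G : Type*} [Group G] [Finite G] {n r e q : ℕ} {A : Set G} {K : ℝ} {U D S : Subgroup G}
  {W : ℕ → Subgroup G} {T : Set G}

theorem covers_of_fixedPointFree (P : PivotData n r e q A K U D S W T) {H H' : Subgroup G}
    [H.Normal] [H'.Normal] (hHS : H ≤ S) (hH' : H' ≤ H) (hHU : ⁅H, U⁆ ≤ H')
    (hHD : H ≤ ⁅H, D⁆ ⊔ H') {m : ℕ} (hm : 2 ≤ m)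
    (hgen : ∀ N : Subgroup G, N.Normal → H' ≤ N → (∀ x ∈ (A ^ 2) ^ m, x ∈ H → x ∈ N) → H ≤ N)
    (hT : K ^ fpfExponent m < T.ncard) : Covers ((A ^ 2) ^ (6 * m + 4)) H H' := by
  have hB := P.growth
  by_cases hHH' : H ≤ H'
  · exact Covers.of_le (hB.one_mem_pow _) hHH'
  have hcomm : IsMulCommutative (H.map (QuotientGroup.mk' H')) :=
    isMulCommutative_map_mk' ((Subgroup.commutator_mono le_rfl (hHS.trans P.S_le_U)).trans hHU)
  have hcard : (sectionPow A H H' (20 * (m + 4 + 1))).card ≤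
      (K ^ 3) ^ (20 * (m + 4 + 1) + 1) * (sectionPow A H H' m).card :=
    (hB.card_sectionPow_le hH' _).trans (by
      have := P.two_le
      gcongr
      exact sectionPow_mono hB hm)
  intro x hx
  obtain ⟨b, hb, hbx⟩ := mem_sectionPow.1 (mem_sectionPow_of_pairwise_isFixedPointFree hB
    P.closure_eq P.inv_eq hgen P.T_sub
    (fun t ht t' ht' => P.isFixedPointFree_inv_mul hHS hHU hHD ht ht') hHH'
    (fun t ht g => commute_sectionConj hHU (P.commutator_mem (P.T_le ht) g))
    (one_le_pow₀ (one_le_pow₀ (by linarith [P.two_le]))) hcard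
    ((pow_le_pow_fpfExponent P.two_le m).trans_lt hT) (sectionMk H H' ⟨x, hx⟩))
  exact ⟨b, hb, sectionMk_eq_iff.1 hbx⟩

end PivotData

section Pairing

variable {S H V : Type*} [Group S] [Group H] [AddCommGroup V]

/-- The left radical of the pairing obtained by composing a bimultiplicative map `β` with an
additive character `ξ`. -/
def pairingRadical (β : S →* H →* Multiplicative V) (ξ : AddChar V ℂ) : Subgroup S :=
  ((MonoidHom.compHom ξ.toMonoidHom).comp β).ker

theorem mem_pairingRadical {β : S →* H →* Multiplicative V} {ξ : AddChar V ℂ} {x : S} :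
    x ∈ pairingRadical β ξ ↔ ∀ y, ξ (β x y).toAdd = 1 :=
  DFunLike.ext_iff

theorem commutatorElement_mem_pairingRadical (β : S →* H →* Multiplicative V) (ξ : AddChar V ℂ)
    (x x' : S) : ⁅x, x'⁆ ∈ pairingRadical β ξ := by
  have hβ : β ⁅x, x'⁆ = 1 := by
    rw [map_commutatorElement, commutatorElement_eq_one_iff_commute]
    exact Commute.all _ _
  refine mem_pairingRadical.2 fun y => ?_
  rw [hβ]
  exact ξ.map_zero_eq_one

theorem charSum_pairing [Fintype S] [Fintype H] (β : S →* H →* Multiplicative V)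
    (ξ : AddChar V ℂ) : charSum (fun p : S × H => (β p.1 p.2).toAdd) ξ =
      Nat.card (pairingRadical β ξ) * Fintype.card H := by
  classical
  have horth (x : S) : ∑ y, ξ (β x y).toAdd =
      if x ∈ pairingRadical β ξ then (Fintype.card H : ℂ) else 0 :=
    (sum_hom_units ((ξ.toMonoidHom).comp (β x))).trans (by push_cast; congr)
  rw [charSum, Fintype.sum_prod_type, Finset.sum_congr rfl fun x _ => horth x,
    ← Finset.sum_filter, Finset.sum_const, nsmul_eq_mul, Nat.card_eq_fintype_card,
    Fintype.card_subtype]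

theorem isFourierUniform_pairing [Fintype S] [Fintype H] {β : S →* H →* Multiplicative V} {N : ℕ}
    (hN : 0 < N) (h : ∀ ξ : AddChar V ℂ, ξ ≠ 0 → Nat.card (pairingRadical β ξ) * N ≤ Nat.card S) :
    IsFourierUniform (fun p : S × H => (β p.1 p.2).toAdd) (1 / N) := by
  intro ξ hξ
  rw [charSum_pairing, norm_mul, Complex.norm_natCast, Complex.norm_natCast, Fintype.card_prod,
    Nat.cast_mul, ← mul_assoc, ← Nat.card_eq_fintype_card (α := S)]
  gcongr
  rw [one_div, ← div_eq_inv_mul, le_div_iff₀ (by exact_mod_cast hN)]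
  exact_mod_cast h ξ hξ

end Pairing

theorem IsBallFamily.mem_of_isFourierUniform {I V : Type*} [Fintype I] [Nonempty I]
    [AddCommGroup V] [Finite V] {X : ℕ → Finset V} (hX : IsBallFamily X) {Φ : I → V} {ε : ℝ}
    (hΦ : IsFourierUniform Φ ε) (hε : 0 ≤ ε) {k m : ℕ} (hΦX : ∀ i, Φ i ∈ X k) {L : ℝ}
    (hL₁ : 1 ≤ L) (hL : (X (k + m)).card ≤ L * (X m).card) (hLε : 2 * L * ε < 1) (v : V) :
    v ∈ X (k + 2 * m) := by
  have := Fintype.ofFinite V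
  have hcard : (Fintype.card V : ℝ) ≤ L * ((X m).card + ε ^ 2 * Fintype.card V) :=
    hΦ.card_le ⟨0, hX.zero_mem m⟩
      (fun x hx i => add_comm x (Φ i) ▸ hX.add_mem k m _ (hΦX i) _ hx) hL
  have hV : (0 : ℝ) < Fintype.card V := by exact_mod_cast Fintype.card_pos
  have hdense : ε * Fintype.card V < (X m).card := by
    by_contra! hle
    have : ε ^ 2 ≤ ε := by nlinarith
    have : L * ((X m).card + ε ^ 2 * Fintype.card V) ≤ (2 * L * ε) * Fintype.card V := by
      nlinarith
    nlinarith
  obtain ⟨x, hx, x', hx', i, rfl⟩ := hΦ.exists_sub_add_eq hε hdense v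
  exact hX.mono (by lia : m + m + k ≤ k + 2 * m)
    (hX.add_mem _ _ _ (hX.sub_mem hx hx') _ (hΦX i))

section CommutatorPairing

variable {G : Type*} [Group G]

theorem mk'_conj_of_commutator_mem {H' : Subgroup G} [H'.Normal] {x z : G} (h : ⁅z, x⁆ ∈ H') :
    QuotientGroup.mk' H' (x * z * x⁻¹) = QuotientGroup.mk' H' z := by
  rw [← mk'_apply_eq_one_iff, map_commutatorElement, commutatorElement_eq_one_iff_mul_comm] at h
  rw [map_mul, map_mul, map_inv, ← h, mul_inv_cancel_right]

theorem mk'_commutator_mul_right {H' : Subgroup G} [H'.Normal] {x x' y : G}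
    (h : ⁅⁅y, x'⁆, x⁆ ∈ H') : QuotientGroup.mk' H' ⁅y, x * x'⁆ =
      QuotientGroup.mk' H' ⁅y, x⁆ * QuotientGroup.mk' H' ⁅y, x'⁆ := by
  rw [commutatorElement_mul_right_eq_mul_conj, mul_assoc, mul_assoc, ← mul_assoc x, map_mul,
    mk'_conj_of_commutator_mem h]

theorem mk'_commutator_mul_left {H' : Subgroup G} [H'.Normal] {x y y' : G}
    (h : ⁅⁅y', x⁆, y⁆ ∈ H') : QuotientGroup.mk' H' ⁅y * y', x⁆ =
      QuotientGroup.mk' H' ⁅y', x⁆ * QuotientGroup.mk' H' ⁅y, x⁆ := by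
  rw [commutatorElement_mul_left_eq_conj_mul, map_mul, mk'_conj_of_commutator_mem h]

theorem mk'_commutator_conj_right {H' : Subgroup G} [H'.Normal] {d x y : G}
    (h : ⁅⁅d⁻¹ * y * d, x⁆, d⁆ ∈ H') : QuotientGroup.mk' H' ⁅y, d * x * d⁻¹⁆ =
      QuotientGroup.mk' H' ⁅d⁻¹ * y * d, x⁆ := by
  have hconj : ⁅y, d * x * d⁻¹⁆ = d * ⁅d⁻¹ * y * d, x⁆ * d⁻¹ := by
    simp only [commutatorElement_def]; group
  rw [hconj, mk'_conj_of_commutator_mem h]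

variable {H₀ S H' : Subgroup G} [H'.Normal] [IsMulCommutative (⁅H₀, S⁆.map (QuotientGroup.mk' H'))]

/-- The bimultiplicative map `S × H₀ → ⁅H₀, S⁆ / H'`, `(x, y) ↦ ⁅y, x⁆`, where `⁅H₀, S⁆ / H'` is
centralised by `H₀` and `S`. -/
def commutatorPairing (h₀ : ⁅⁅H₀, S⁆, H₀⁆ ≤ H') (h : ⁅⁅H₀, S⁆, S⁆ ≤ H') :
    S →* H₀ →* Multiplicative (Additive (⁅H₀, S⁆.map (QuotientGroup.mk' H'))) :=
  MonoidHom.mk' (fun x => MonoidHom.mk'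
    (fun y => .ofAdd (sectionMk ⁅H₀, S⁆ H'
      ⟨⁅(y : G), (x : G)⁆, Subgroup.commutator_mem_commutator y.2 x.2⟩))
    fun y y' => by
      rw [mul_comm]
      exact Subtype.ext (mk'_commutator_mul_left (h₀ (Subgroup.commutator_mem_commutator
        (Subgroup.commutator_mem_commutator y'.2 x.2) y.2))))
    fun x x' => MonoidHom.ext fun y => Subtype.ext <| mk'_commutator_mul_right
      (h (Subgroup.commutator_mem_commutator (Subgroup.commutator_mem_commutator y.2 x'.2) x.2))

theorem conj_mem_pairingRadical [H₀.Normal] {h₀ : ⁅⁅H₀, S⁆, H₀⁆ ≤ H'} {h : ⁅⁅H₀, S⁆, S⁆ ≤ H'}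
    {ξ : AddChar (Additive (⁅H₀, S⁆.map (QuotientGroup.mk' H'))) ℂ} {d : G}
    (hd : ∀ z ∈ ⁅H₀, S⁆, ⁅z, d⁆ ∈ H') {x x' : S} (hx' : (x' : G) = d * x * d⁻¹)
    (hx : x ∈ pairingRadical (commutatorPairing h₀ h) ξ) :
    x' ∈ pairingRadical (commutatorPairing h₀ h) ξ := by
  refine mem_pairingRadical.2 fun y => ?_
  have hy : d⁻¹ * y * d ∈ H₀ := by
    simpa only [inv_inv] using (inferInstance : H₀.Normal).conj_mem y y.2 d⁻¹
  have hconj : commutatorPairing h₀ h x' y = commutatorPairing h₀ h x ⟨_, hy⟩ := by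
    refine Subtype.ext ?_
    change QuotientGroup.mk' H' ⁅(y : G), (x' : G)⁆ = QuotientGroup.mk' H' ⁅d⁻¹ * y * d, (x : G)⁆
    rw [hx']
    exact mk'_commutator_conj_right (hd _ (Subgroup.commutator_mem_commutator hy x.2))
  rw [hconj]
  exact mem_pairingRadical.1 hx _

theorem pairingRadical_commutatorPairing_ne_top {h₀ : ⁅⁅H₀, S⁆, H₀⁆ ≤ H'}
    {h : ⁅⁅H₀, S⁆, S⁆ ≤ H'} {ξ : AddChar (Additive (⁅H₀, S⁆.map (QuotientGroup.mk' H'))) ℂ}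
    (hξ : ξ ≠ 0) : pairingRadical (commutatorPairing h₀ h) ξ ≠ ⊤ := by
  intro htop
  apply hξ
  have hle : ⁅H₀, S⁆ ≤ (ξ.toMonoidHom.ker.map
      (⁅H₀, S⁆.map (QuotientGroup.mk' H')).subtype).comap (QuotientGroup.mk' H') := by
    refine Subgroup.commutator_le.2 fun y hy x hx => ?_
    have hmem : (⟨x, hx⟩ : S) ∈ pairingRadical (commutatorPairing h₀ h) ξ :=
      htop ▸ Subgroup.mem_top _
    exact ⟨commutatorPairing h₀ h ⟨x, hx⟩ ⟨y, hy⟩, mem_pairingRadical.1 hmem ⟨y, hy⟩, rfl⟩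
  ext v
  obtain ⟨z, rfl⟩ := sectionMk_surjective v
  obtain ⟨w, hw, hwz⟩ := hle z.2
  have hwz' : w = sectionMk ⁅H₀, S⁆ H' z := Subtype.ext hwz
  exact hwz' ▸ hw

theorem commutatorPairing_eq_of_inv_mul_mem {h₀ : ⁅⁅H₀, S⁆, H₀⁆ ≤ H'} {h : ⁅⁅H₀, S⁆, S⁆ ≤ H'}
    {x x' : S} {y y' : H₀} (hx : (x : G)⁻¹ * x' ∈ ⁅H₀, S⁆) (hy : (y : G)⁻¹ * y' ∈ ⁅H₀, S⁆) :
    commutatorPairing h₀ h x y = commutatorPairing h₀ h x' y' := by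
  have hright : commutatorPairing h₀ h (x⁻¹ * x') y' = 1 := by
    refine sectionMk_eq_zero_iff.2 (?_ : ⁅(y' : G), (x : G)⁻¹ * x'⁆ ∈ H')
    rw [← inv_mem_iff, commutatorElement_inv]
    exact h₀ (Subgroup.commutator_mem_commutator hx y'.2)
  have hleft : commutatorPairing h₀ h x (y⁻¹ * y') = 1 :=
    sectionMk_eq_zero_iff.2 (h (Subgroup.commutator_mem_commutator hy x.2))
  calc commutatorPairing h₀ h x y = commutatorPairing h₀ h x y' := by
        rw [← mul_inv_cancel_left y y', map_mul, hleft, mul_one]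
    _ = commutatorPairing h₀ h x' y' := by
        rw [← mul_inv_cancel_left x x', map_mul, MonoidHom.mul_apply, hright, mul_one]

theorem commutatorPairing_mem_sectionPow [Finite G] [H₀.Normal] [S.Normal] {A : Set G} {K : ℝ}
    (hB : SmallGrowth (A ^ 2) K) (hH₀S : H₀ ≤ S) {h₀ : ⁅⁅H₀, S⁆, H₀⁆ ≤ H'} {h : ⁅⁅H₀, S⁆, S⁆ ≤ H'}
    {m : ℕ} (hcov : Covers ((A ^ 2) ^ m) S ⁅H₀, S⁆) (x : S) (y : H₀) :
    (commutatorPairing h₀ h x y).toAdd ∈ sectionPow A ⁅H₀, S⁆ H' (4 * m) := by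
  obtain ⟨b, hb, hbx⟩ := hcov x x.2
  obtain ⟨c, hc, hcy⟩ := hcov y (hH₀S y.2)
  have hbS : b ∈ S := by
    simpa using S.mul_mem x.2 (S.inv_mem (Subgroup.commutator_le_right H₀ S hbx))
  have hcH₀ : c ∈ H₀ := by
    simpa using H₀.mul_mem y.2 (H₀.inv_mem (Subgroup.commutator_le_left H₀ S hcy))
  rw [← commutatorPairing_eq_of_inv_mul_mem (x := ⟨b, hbS⟩) (y := ⟨c, hcH₀⟩) hbx hcy]
  exact sectionMk_mem_sectionPow (hB.pow_mono (by lia) (hB.commutator_mem hc hb))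

end CommutatorPairing

theorem card_mul_card_le_of_isFixedPointFree {G ι : Type*} [Group G] {H V : Subgroup G} [Finite H]
    (hVH : V ≤ H) (hne : ¬ H ≤ V) (hHV : ∀ h ∈ H, ∀ v ∈ V, h * v * h⁻¹ ∈ V) {d : ι → G}
    (hdH : ∀ i, ∀ h ∈ H, d i * h * (d i)⁻¹ ∈ H) (hdV : ∀ i, ∀ v ∈ V, (d i)⁻¹ * v * d i ∈ V)
    (hfpf : Pairwise fun i j => IsFixedPointFree ((d i)⁻¹ * d j) H V) :
    Nat.card V * Nat.card ι ≤ Nat.card H := by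
  obtain ⟨x, hxH, hxV⟩ := Set.not_subset.1 hne
  rw [← Nat.card_prod]
  refine Nat.card_le_card_of_injective (fun p : V × ι =>
    (⟨d p.2 * x * (d p.2)⁻¹ * p.1, H.mul_mem (hdH _ _ hxH) (hVH p.1.2)⟩ : H)) ?_
  rintro ⟨v, i⟩ ⟨w, j⟩ heq
  have hvw : d i * x * (d i)⁻¹ * v = d j * x * (d j)⁻¹ * w := congrArg Subtype.val heq
  by_cases hij : i = j
  · subst hij
    rw [Subtype.ext (mul_left_cancel hvw)]
  · refine absurd (hfpf hij x hxH ?_) hxV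
    have hcomm : ⁅(d i)⁻¹ * d j, x⁆ = x * ((d i)⁻¹ * (v * (w : G)⁻¹) * d i) * x⁻¹ := by
      rw [eq_inv_mul_of_mul_eq hvw, commutatorElement_def]; group
    rw [hcomm]
    exact hHV x hxH _ (hdV i _ (V.mul_mem v.2 (V.inv_mem w.2)))

/-- Exponent of `K` in the lower bound on the size of `T` required by
`PivotData.covers_of_bilinear`. -/
def bilinExponent (m : ℕ) : ℕ := 3 * (4 * m + 3) + 1

theorem mul_pow_le_pow_bilinExponent {K : ℝ} (hK : 2 ≤ K) (m : ℕ) :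
    2 * (K ^ 3) ^ (4 * m + 3) ≤ K ^ bilinExponent m := by
  rw [bilinExponent, pow_succ K (3 * (4 * m + 3)), pow_mul, mul_comm]
  gcongr

namespace PivotData

variable {G : Type*} [Group G] [Finite G] {n r e q : ℕ} {A : Set G} {K : ℝ} {U D S : Subgroup G}
  {W : ℕ → Subgroup G} {T : Set G}

theorem exists_isFixedPointFree (P : PivotData n r e q A K U D S W T) :
    ∃ d : T → G, (∀ t, d t ∈ D) ∧
      Pairwise fun t t' => IsFixedPointFree ((d t)⁻¹ * d t') S ⁅S, S⁆ := by
  have := P.normal_U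
  have := P.normal_S
  have hfac (t : T) : ∃ d ∈ D, ∃ u ∈ U, u * d = (t : G) :=
    have ⟨u, hu, d, hd, h⟩ := Set.mem_mul.1 (Subgroup.normal_mul U D ▸ P.T_le t.2)
    ⟨d, hd, u, hu, h⟩
  choose d hd u hu hud using hfac
  refine ⟨d, hd, fun t t' hne => P.isFixedPointFree_of_mem le_rfl le_rfl
    (P.S_le.trans le_sup_left) (D.mul_mem (D.inv_mem (hd t)) (hd t'))
    (P.isFixedPointFreeAlong_of_mul_left (v := (d t)⁻¹ * ((u t)⁻¹ * u t') * d t) ?_ ?_)⟩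
  · simpa only [inv_inv] using
      P.normal_U.conj_mem _ (U.mul_mem (U.inv_mem (hu t)) (hu t')) (d t)⁻¹
  · have htt' : (d t)⁻¹ * ((u t)⁻¹ * u t') * d t * ((d t)⁻¹ * d t') = (t : G)⁻¹ * t' := by
      rw [← hud, ← hud]; group
    rw [htt']
    exact P.rich t t.2 t' t'.2 fun h => hne (Subtype.ext h)

theorem card_mul_ncard_le (P : PivotData n r e q A K U D S W T) {V : Subgroup G} (hVS : V ≤ S)
    (hSV : ⁅S, S⁆ ≤ V) (hVD : ∀ d ∈ D, ∀ x ∈ V, d * x * d⁻¹ ∈ V) (hne : ¬ S ≤ V) :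
    Nat.card V * T.ncard ≤ Nat.card S := by
  have hS := P.normal_S
  obtain ⟨d, hd, hfpf⟩ := P.exists_isFixedPointFree
  have hdV (t : T) : ∀ x ∈ V, (d t)⁻¹ * x * d t ∈ V := fun x hx => by
    simpa only [inv_inv] using hVD _ (D.inv_mem (hd t)) x hx
  rw [← Nat.card_coe_set_eq T]
  refine card_mul_card_le_of_isFixedPointFree hVS hne (fun h hh => hVD h (P.S_le_D hh))
    (fun t x hx => hS.conj_mem x hx _) hdV fun t t' hne' =>
      (hfpf hne').of_le le_rfl hSV hVS (fun x hx => ?_) fun x hx => ?_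
  · exact Subgroup.commutator_le_right ⊤ ⁅S, S⁆
      (Subgroup.commutator_mem_commutator (Subgroup.mem_top _) hx)
  · exact V.mul_mem (hVD _ (D.mul_mem (D.inv_mem (hd t)) (hd t')) x hx) (V.inv_mem hx)

theorem card_pairingRadical_mul_le (P : PivotData n r e q A K U D S W T) {H₀ H' : Subgroup G}
    [H₀.Normal] [H'.Normal] [IsMulCommutative (⁅H₀, S⁆.map (QuotientGroup.mk' H'))]
    {h₀ : ⁅⁅H₀, S⁆, H₀⁆ ≤ H'} {h : ⁅⁅H₀, S⁆, S⁆ ≤ H'} (hD : ⁅⁅H₀, S⁆, D⁆ ≤ H')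
    {ξ : AddChar (Additive (⁅H₀, S⁆.map (QuotientGroup.mk' H'))) ℂ} (hξ : ξ ≠ 0) :
    Nat.card (pairingRadical (commutatorPairing h₀ h) ξ) * T.ncard ≤ Nat.card S := by
  have hS := P.normal_S
  set R := pairingRadical (commutatorPairing h₀ h) ξ
  have hR : R ≠ ⊤ := pairingRadical_commutatorPairing_ne_top hξ
  rw [← Nat.card_congr (R.equivMapOfInjective _ S.subtype_injective).symm.toEquiv]
  refine P.card_mul_ncard_le (Subgroup.map_subtype_le R) (Subgroup.commutator_le.2 ?_) ?_ ?_
  · exact fun x hx x' hx' =>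
      ⟨_, commutatorElement_mem_pairingRadical _ ξ (⟨x, hx⟩ : S) ⟨x', hx'⟩, rfl⟩
  · rintro d hd _ ⟨x, hx, rfl⟩
    exact ⟨⟨d * x * d⁻¹, hS.conj_mem x x.2 d⟩, conj_mem_pairingRadical
      (fun z hz => hD (Subgroup.commutator_mem_commutator hz hd)) rfl hx, rfl⟩
  · refine fun hle => hR (eq_top_iff.2 fun x _ => ?_)
    obtain ⟨x', hx', heq⟩ := hle x.2
    rwa [← Subtype.ext heq]

theorem covers_of_bilinear (P : PivotData n r e q A K U D S W T) {H₀ H' : Subgroup G} [H₀.Normal]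
    [H'.Normal] (hH₀ : H₀ ≤ S) (hH' : H' ≤ ⁅H₀, S⁆) (hD : ⁅⁅H₀, S⁆, D⁆ ≤ H') {m : ℕ}
    (hcov : Covers ((A ^ 2) ^ m) S ⁅H₀, S⁆)
    (hT : K ^ bilinExponent m < T.ncard) :
    Covers ((A ^ 2) ^ (4 * m + 4)) ⁅H₀, S⁆ H' := by
  have hS := P.normal_S
  have h : ⁅⁅H₀, S⁆, S⁆ ≤ H' := (Subgroup.commutator_mono le_rfl P.S_le_D).trans hD
  have h₀ : ⁅⁅H₀, S⁆, H₀⁆ ≤ H' := (Subgroup.commutator_mono le_rfl hH₀).trans h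
  have : IsMulCommutative (⁅H₀, S⁆.map (QuotientGroup.mk' H')) := isMulCommutative_map_mk'
    ((Subgroup.commutator_mono le_rfl (Subgroup.commutator_le_right H₀ S)).trans h)
  have := Fintype.ofFinite S
  have := Fintype.ofFinite H₀
  have hTL : 2 * (K ^ 3) ^ (4 * m + 3) < T.ncard :=
    (mul_pow_le_pow_bilinExponent P.two_le m).trans_lt hT
  have hL₁ : 1 ≤ (K ^ 3) ^ (4 * m + 3) := one_le_pow₀ (one_le_pow₀ (by linarith [P.two_le]))
  have hTpos : (0 : ℝ) < T.ncard := by linarith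
  have huniform := isFourierUniform_pairing (by exact_mod_cast hTpos)
    fun ξ hξ => P.card_pairingRadical_mul_le (h₀ := h₀) (h := h) hD hξ
  have hball : IsBallFamily (sectionPow A ⁅H₀, S⁆ H') := isBallFamily_sectionPow P.growth
  intro x hx
  obtain ⟨b, hb, hbx⟩ := mem_sectionPow.1 (hball.mem_of_isFourierUniform huniform (by positivity)
    (fun p => commutatorPairing_mem_sectionPow P.growth hH₀ hcov p.1 p.2) hL₁
    (P.growth.card_sectionPow_le hH' _) (by rwa [mul_one_div, div_lt_one hTpos])
    (sectionMk ⁅H₀, S⁆ H' ⟨x, hx⟩))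
  exact ⟨b, hb, sectionMk_eq_iff.1 hbx⟩

end PivotData

section RelativeSeries

variable {G : Type*} [Group G]

theorem commutator_commutator_le_of_rotate {H₁ H₂ H₃ : Subgroup G} (N : Subgroup G) [N.Normal]
    (h₁ : ⁅⁅H₂, H₃⁆, H₁⁆ ≤ N) (h₂ : ⁅⁅H₃, H₁⁆, H₂⁆ ≤ N) : ⁅⁅H₁, H₂⁆, H₃⁆ ≤ N := by
  have hbot (X Y Z : Subgroup G) : ⁅⁅X, Y⁆, Z⁆ ≤ N ↔
      ⁅⁅X.map (QuotientGroup.mk' N), Y.map (QuotientGroup.mk' N)⁆,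
        Z.map (QuotientGroup.mk' N)⁆ = ⊥ := by
    rw [← Subgroup.map_commutator, ← Subgroup.map_commutator, Subgroup.map_eq_bot_iff,
      QuotientGroup.ker_mk']
  rw [hbot] at h₁ h₂ ⊢
  exact Subgroup.commutator_commutator_eq_bot_of_rotate h₁ h₂

/-- The descending chain obtained from `H` by iterating `X ↦ ⁅X, U⁆ ⊔ Z`: the lower central series
of `H` relative to `U`, computed modulo `Z`. -/
def relativeSeries (H U Z : Subgroup G) : ℕ → Subgroup G
  | 0 => H
  | j + 1 => ⁅relativeSeries H U Z j, U⁆ ⊔ Z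

variable {H U Z : Subgroup G}

theorem le_relativeSeries (h : Z ≤ H) (j : ℕ) : Z ≤ relativeSeries H U Z j := by
  cases j with
  | zero => exact h
  | succ j => exact le_sup_right

variable [U.Normal] [Z.Normal]

theorem relativeSeries_le_lowerCentralSeries (h : H ≤ U) (j : ℕ) :
    relativeSeries H U Z j ≤ U.lowerCentralSeries j ⊔ Z := by
  induction j with
  | zero => exact h.trans le_sup_left
  | succ j ih =>
    exact sup_le ((Subgroup.commutator_mono ih le_rfl).trans (sup_commutator_le le_sup_left
      ((Subgroup.commutator_le_left Z U).trans le_sup_right))) le_sup_right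

variable [H.Normal]

instance relativeSeries_normal (j : ℕ) : (relativeSeries H U Z j).Normal := by
  induction j with
  | zero => assumption
  | succ j ih => exact Subgroup.sup_normal _ _

theorem relativeSeries_succ_le (h : Z ≤ H) (j : ℕ) :
    relativeSeries H U Z (j + 1) ≤ relativeSeries H U Z j :=
  sup_le (Subgroup.commutator_le_left _ _) (le_relativeSeries h j)

theorem relativeSeries_le (h : Z ≤ H) (j : ℕ) : relativeSeries H U Z j ≤ H :=
  antitone_nat_of_succ_le (relativeSeries_succ_le h) (Nat.zero_le j)

end RelativeSeries

theorem CoprimeFiltration.relativeSeries_le_commutator_sup {G : Type*} [Group G] {n r e q : ℕ}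
    {U D S : Subgroup G} {W : ℕ → Subgroup G} (F : CoprimeFiltration n r e q U D S W)
    {H Z : Subgroup G} [H.Normal] [Z.Normal] (hZ : Z ≤ H) (hHS : ⁅H, S⁆ ≤ Z)
    (hHD : H ≤ ⁅H, D⁆ ⊔ Z) (j : ℕ) :
    relativeSeries H U Z j ≤ ⁅relativeSeries H U Z j, D⁆ ⊔ Z := by
  have hU := F.normal_U
  have hD := F.normal_D
  induction j with
  | zero => exact hHD
  | succ j ih =>
    set R := relativeSeries H U Z j
    have hDUR : ⁅⁅D, U⁆, R⁆ ≤ Z := calc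
      ⁅⁅D, U⁆, R⁆ ≤ ⁅S, H⁆ := Subgroup.commutator_mono
        ((Subgroup.commutator_mono le_rfl le_top).trans F.D_central) (relativeSeries_le hZ j)
      _ ≤ Z := Subgroup.commutator_comm S H ▸ hHS
    have hRDU : ⁅⁅R, D⁆, U⁆ ≤ ⁅⁅R, U⁆ ⊔ Z, D⁆ ⊔ Z := by
      refine commutator_commutator_le_of_rotate _ (hDUR.trans le_sup_right) ?_
      rw [Subgroup.commutator_comm U R]
      exact (Subgroup.commutator_mono le_sup_left le_rfl).trans le_sup_left
    refine sup_le ?_ le_sup_right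
    exact (Subgroup.commutator_mono ih le_rfl).trans (sup_commutator_le hRDU
      ((Subgroup.commutator_le_left Z U).trans le_sup_right))

namespace PivotData

section

variable {G : Type*} [Group G] [Finite G] {n r e q : ℕ} {A : Set G} {K : ℝ} {U D S : Subgroup G}
  {W : ℕ → Subgroup G} {T : Set G}

theorem covers_commutator_sup (P : PivotData n r e q A K U D S W T) {H Z : Subgroup G} [H.Normal]
    [Z.Normal] (hZH : Z ≤ H) (hHS : H ≤ S) (hHD : H ≤ ⁅H, D⁆ ⊔ Z) (hor : H = S ∨ H ≤ ⁅S, U⁆)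
    {m : ℕ} (hcov : Covers ((A ^ 2) ^ m) S H)
    (hT : K ^ fpfExponent (17 * 2 ^ n + (3 * m + 1)) < T.ncard) :
    Covers ((A ^ 2) ^ (6 * (17 * 2 ^ n + (3 * m + 1)) + 4)) H (⁅H, U⁆ ⊔ Z) := by
  have hU := P.normal_U
  have hS := P.normal_S
  have hB := P.growth
  obtain ⟨t, ht, t', ht', hne⟩ : ∃ t ∈ T, ∃ t' ∈ T, t ≠ t' := by
    rw [← Set.one_lt_ncard (Set.toFinite T)]
    exact_mod_cast (one_le_pow₀ (by linarith [P.two_le])).trans_lt hT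
  refine P.covers_of_fixedPointFree hHS (sup_le (Subgroup.commutator_le_left H U) hZH) le_sup_left
    (hHD.trans (sup_le_sup_left le_sup_right _)) (by have := Nat.one_le_two_pow (n := n); lia)
    (fun N _ hN hgen => ?_) hT
  have hHU : ⁅H, U⁆ ≤ N := le_sup_left.trans hN
  rcases hor with rfl | hHSU
  · exact P.le_of_pow_inter_le hHU ht ht' hne fun x hx =>
      hgen x (hB.pow_mono (Nat.le_add_right _ _) hx)
  · exact hB.le_of_covers P.closure_eq P.inv_eq hHSU hHU hcov fun x hx =>
      hgen x (hB.pow_mono (Nat.le_add_left _ _) hx)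

end

theorem exists_covers_relativeSeries (n m₀ j : ℕ) : ∃ m M : ℕ,
    ∀ {G : Type u} [Group G] [Finite G] {r e q : ℕ} {A : Set G} {K : ℝ} {U D S : Subgroup G}
      {W : ℕ → Subgroup G} {T : Set G}, PivotData n r e q A K U D S W T → K ^ M < T.ncard →
      ∀ {H Z : Subgroup G} [H.Normal] [Z.Normal], Z ≤ H → H ≤ S → Z ≤ ⁅S, U⁆ → ⁅H, S⁆ ≤ Z →
      H ≤ ⁅H, D⁆ ⊔ Z → (H = S ∨ H ≤ ⁅S, U⁆) → Covers ((A ^ 2) ^ m₀) S H →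
      Covers ((A ^ 2) ^ m) S (relativeSeries H U Z j) := by
  induction j with
  | zero => exact ⟨m₀, 0, fun _ _ _ _ _ _ _ _ _ _ _ _ h => h⟩
  | succ j ih =>
    obtain ⟨m, M, h⟩ := ih
    refine ⟨m + (6 * (17 * 2 ^ n + (3 * m + 1)) + 4),
      max M (fpfExponent (17 * 2 ^ n + (3 * m + 1))), ?_⟩
    intro G _ _ r e q A K U D S W T P hT H Z _ _ hZH hHS hZ hHSZ hHD hor hcov
    have hU := P.normal_U
    have hpow {a : ℕ} (ha : a ≤ max M (fpfExponent (17 * 2 ^ n + (3 * m + 1)))) :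
        K ^ a < T.ncard :=
      (pow_le_pow_right₀ (by linarith [P.two_le]) ha).trans_lt hT
    have hcovj := h P (hpow (le_max_left _ _)) hZH hHS hZ hHSZ hHD hor hcov
    refine hcovj.trans (P.covers_commutator_sup (le_relativeSeries hZH j)
      ((relativeSeries_le hZH j).trans hHS) (P.relativeSeries_le_commutator_sup hZH hHSZ hHD j) ?_
      hcovj (hpow (le_max_right _ _)))
    cases j with
    | zero => exact hor
    | succ j =>
      exact .inr (sup_le (Subgroup.commutator_mono ((relativeSeries_le hZH j).trans hHS) le_rfl) hZ)

section

variable {G : Type*} [Group G] [Finite G] {n r e q : ℕ} {A : Set G} {K : ℝ} {U D S : Subgroup G}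
  {W : ℕ → Subgroup G} {T : Set G}

theorem exists_normal_covers_of_covers_lowerCentralSeries (P : PivotData n r e q A K U D S W T)
    {i m : ℕ} (hcov : Covers ((A ^ 2) ^ m) S (S.lowerCentralSeries i))
    (hT : K ^ bilinExponent m < T.ncard) :
    ∃ H : Subgroup G, H.Normal ∧ S.lowerCentralSeries (i + 1) ≤ H ∧ H ≤ S ∧
      ⁅H, S⁆ ≤ S.lowerCentralSeries (i + 1) ∧ H ≤ ⁅H, D⁆ ⊔ S.lowerCentralSeries (i + 1) ∧
      (H = S ∨ H ≤ ⁅S, U⁆) ∧ Covers ((A ^ 2) ^ (m + (4 * m + 4))) S H := by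
  have hS := P.normal_S
  have hD := P.normal_D
  have hle := S.lowerCentralSeries_le_self
  rcases i with _ | k
  · exact ⟨S, hS, hle _, le_rfl, le_rfl, P.S_le.trans le_sup_left, .inl rfl,
      Covers.of_le (P.growth.one_mem_pow _) le_rfl⟩
  · set L := S.lowerCentralSeries (k + 1)
    have hLD : ⁅L, D⁆ ≤ L := Subgroup.commutator_le_left L D
    exact ⟨⁅L, D⁆, inferInstance, Subgroup.commutator_mono le_rfl P.S_le_D, hLD.trans (hle _),
      Subgroup.commutator_mono hLD le_rfl, P.commutator_le_commutator_commutator (hle _) le_rfl,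
      .inr (hLD.trans (Subgroup.commutator_mono (hle k) P.S_le_U)),
      hcov.trans (P.covers_of_bilinear (hle k) hLD le_rfl hcov hT)⟩

end

theorem exists_covers_lowerCentralSeries (n i : ℕ) : ∃ m M : ℕ,
    ∀ {G : Type u} [Group G] [Finite G] {r e q : ℕ} {A : Set G} {K : ℝ} {U D S : Subgroup G}
      {W : ℕ → Subgroup G} {T : Set G}, PivotData n r e q A K U D S W T → K ^ M < T.ncard →
      Covers ((A ^ 2) ^ m) S (S.lowerCentralSeries i) := by
  induction i with
  | zero => exact ⟨0, 0, fun P _ => Covers.of_le (P.growth.one_mem_pow 0) le_rfl⟩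
  | succ i ih =>
    obtain ⟨m, M, h⟩ := ih
    obtain ⟨m', M', h'⟩ := exists_covers_relativeSeries.{u} n (m + (4 * m + 4)) n
    refine ⟨m', max (max M (bilinExponent m)) M', ?_⟩
    intro G _ _ r e q A K U D S W T P hT
    have hU := P.normal_U
    have hS := P.normal_S
    have hpow {a : ℕ} (ha : a ≤ max (max M (bilinExponent m)) M') : K ^ a < T.ncard :=
      (pow_le_pow_right₀ (by linarith [P.two_le]) ha).trans_lt hT
    obtain ⟨H, hH, hZH, hHS, hHSZ, hHD, hor, hcov⟩ :=
      P.exists_normal_covers_of_covers_lowerCentralSeries (h P (hpow (by simp)))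
        (hpow (by simp))
    have hZ : S.lowerCentralSeries (i + 1) ≤ ⁅S, U⁆ :=
      Subgroup.commutator_mono (S.lowerCentralSeries_le_self i) P.S_le_U
    have hlast : relativeSeries H U (S.lowerCentralSeries (i + 1)) n ≤
        S.lowerCentralSeries (i + 1) := by
      simpa only [P.nilp, bot_sup_eq] using
        relativeSeries_le_lowerCentralSeries (Z := S.lowerCentralSeries (i + 1))
          (hHS.trans P.S_le_U) n
    intro x hx
    obtain ⟨b, hb, hbx⟩ := h' P (hpow (le_max_right _ _)) hZH hHS hZ hHSZ hHD hor hcov x hx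
    exact ⟨b, hb, hlast hbx⟩

theorem exists_subset_pow (n : ℕ) : ∃ m M : ℕ,
    ∀ {G : Type u} [Group G] [Finite G] {r e q : ℕ} {A : Set G} {K : ℝ} {U D S : Subgroup G}
      {W : ℕ → Subgroup G} {T : Set G}, PivotData n r e q A K U D S W T → K ^ M < T.ncard →
      (S : Set G) ⊆ (A ^ 2) ^ m := by
  obtain ⟨m, M, h⟩ := exists_covers_lowerCentralSeries.{u} n n
  refine ⟨m, M, fun P hT x hx => ?_⟩
  obtain ⟨b, hb, hbx⟩ := h P hT x hx
  have hbot : b⁻¹ * x ∈ (⊥ : Subgroup _) :=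
    P.nilp ▸ Subgroup.lowerCentralSeries_mono n P.S_le_U hbx
  rwa [← inv_mul_eq_one.1 (Subgroup.mem_bot.1 hbot)]

end PivotData

section Separation

variable {G : Type*} [Group G]

theorem exists_separated_subset [Finite G] {F : Set G} (C : ℕ → Subgroup G) {I : Finset ℕ}
    (hI : I.Nonempty) :
    ∃ T ⊆ F, (∀ t ∈ T, ∀ t' ∈ T, t ≠ t' → ∀ k ∈ I, t⁻¹ * t' ∉ C k) ∧
      ∀ x ∈ F, ∃ k ∈ I, ∃ t ∈ T, t⁻¹ * x ∈ C k := by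
  let R : SetRel G G := {p | ∃ k ∈ I, p.1⁻¹ * p.2 ∈ C k}
  have hrefl : R.IsRefl := ⟨fun x => by
    obtain ⟨k, hk⟩ := hI
    exact ⟨k, hk, by rw [inv_mul_cancel]; exact (C k).one_mem⟩⟩
  have hsymm : R.IsSymm := ⟨fun x y ⟨k, hk, hxy⟩ => ⟨k, hk, by simpa using (C k).inv_mem hxy⟩⟩
  obtain ⟨T, hT⟩ := (Set.toFinite {T | T ⊆ F ∧ R.IsSeparated T}).exists_maximal
    ⟨∅, Set.empty_subset F, .empty⟩
  refine ⟨T, hT.prop.1, fun t ht t' ht' hne k hk h => hT.prop.2 ht ht' hne ⟨k, hk, h⟩,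
    fun x hx => ?_⟩
  obtain ⟨t, ht, hxt⟩ := SetRel.IsCover.of_maximal_isSeparated hT hx
  obtain ⟨k, hk, hmem⟩ := R.symm hxt
  exact ⟨k, hk, t, ht, hmem⟩

namespace SmallGrowth

variable [Finite G] {B : Set G} {K : ℝ}

theorem ncard_mul_cosetCount_le (hB : SmallGrowth B K) (Δ C : Subgroup G) :
    ((B ^ 4 ∩ Δ ∩ C : Set G).ncard : ℝ) * cosetCount (B ^ 2 ∩ Δ) C ≤
      K ^ 7 * (B ^ 2 ∩ Δ : Set G).ncard := by
  have hsub : (B ^ 2 ∩ Δ) * (B ^ 4 ∩ Δ ∩ C) ⊆ B ^ 6 ∩ (Δ : Set G) := by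
    rintro _ ⟨x, hx, y, hy, rfl⟩
    exact ⟨mul_mem hx.1 hy.1.1, Δ.mul_mem hx.2 hy.1.2⟩
  rw [mul_comm]
  calc (cosetCount (B ^ 2 ∩ Δ) C * (B ^ 4 ∩ Δ ∩ C : Set G).ncard : ℝ)
      ≤ (B ^ 6 ∩ Δ : Set G).ncard := by
        exact_mod_cast (cosetCount_mul_ncard_le Set.inter_subset_right _).trans
          (Set.ncard_le_ncard hsub)
    _ ≤ K ^ 7 * (B ^ 2 ∩ Δ : Set G).ncard := hB.ncard_pow_inter_le Δ 6

theorem exists_pairwise_separated (hB : SmallGrowth B K) (Δ : Subgroup G) (C : ℕ → Subgroup G)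
    {I : Finset ℕ} (hI : I.Nonempty) {L : ℝ} (hL : ∀ k ∈ I, L ≤ cosetCount (B ^ 2 ∩ Δ) (C k)) :
    ∃ T ⊆ B ^ 2 ∩ (Δ : Set G), (∀ t ∈ T, ∀ t' ∈ T, t ≠ t' → ∀ k ∈ I, t⁻¹ * t' ∉ C k) ∧
      L ≤ K ^ 7 * I.card * T.ncard := by
  set F : Set G := B ^ 2 ∩ Δ
  obtain ⟨T, hTF, hsep, hcover⟩ := exists_separated_subset (F := F) C hI
  have hF : F ⊆ ⋃ k ∈ I, T * (B ^ 4 ∩ Δ ∩ C k) := by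
    intro x hx
    obtain ⟨k, hk, t, ht, htx⟩ := hcover x hx
    have hdiff : t⁻¹ * x ∈ B ^ 4 ∩ (Δ : Set G) := ⟨mul_mem (hB.inv_mem (hTF ht).1) hx.1,
      Δ.mul_mem (Δ.inv_mem (hTF ht).2) hx.2⟩
    exact Set.mem_biUnion hk ⟨t, ht, t⁻¹ * x, ⟨hdiff, htx⟩, mul_inv_cancel_left t x⟩
  have hcard : (F.ncard : ℝ) ≤ ∑ k ∈ I, (T.ncard * (B ^ 4 ∩ Δ ∩ C k : Set G).ncard : ℝ) := by
    exact_mod_cast (Set.ncard_le_ncard hF).trans <| (I.set_ncard_biUnion_le _).trans <|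
      Finset.sum_le_sum fun k _ => Set.natCard_mul_le
  have hpos : (0 : ℝ) < F.ncard := by
    have hone : (1 : G) ∈ F := ⟨hB.one_mem_pow 2, Δ.one_mem⟩
    exact_mod_cast (Set.ncard_pos).2 ⟨1, hone⟩
  refine ⟨T, hTF, hsep, ?_⟩
  rcases le_total L 0 with hneg | hnonneg
  · have := hB.one_le
    exact hneg.trans (by positivity)
  refine le_of_mul_le_mul_right ?_ hpos
  calc L * F.ncard
      ≤ L * ∑ k ∈ I, (T.ncard * (B ^ 4 ∩ Δ ∩ C k : Set G).ncard : ℝ) := by gcongr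
    _ = ∑ k ∈ I, (T.ncard : ℝ) * ((B ^ 4 ∩ Δ ∩ C k : Set G).ncard * L) := by
        rw [Finset.mul_sum]; exact Finset.sum_congr rfl fun k _ => by ring
    _ ≤ ∑ k ∈ I, (T.ncard : ℝ) * (K ^ 7 * F.ncard) := by
        refine Finset.sum_le_sum fun k hk => ?_
        refine mul_le_mul_of_nonneg_left ?_ (Nat.cast_nonneg _)
        exact (mul_le_mul_of_nonneg_left (hL k hk) (Nat.cast_nonneg _)).trans
          (hB.ncard_mul_cosetCount_le Δ (C k))
    _ = K ^ 7 * I.card * T.ncard * F.ncard := by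
        rw [Finset.sum_const, nsmul_eq_mul]; ring

end SmallGrowth

end Separation

section PowClosure

variable {G : Type*} [Group G]

/-- The subgroup generated by the `e`-th powers of the elements of `Δ`. -/
def powClosure (Δ : Subgroup G) (e : ℕ) : Subgroup G :=
  Subgroup.closure ((· ^ e) '' (Δ : Set G))

theorem pow_mem_powClosure {Δ : Subgroup G} {t : G} (ht : t ∈ Δ) (e : ℕ) : t ^ e ∈ powClosure Δ e :=
  Subgroup.subset_closure ⟨t, ht, rfl⟩

theorem powClosure_le (Δ : Subgroup G) (e : ℕ) : powClosure Δ e ≤ Δ := by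
  rw [powClosure, Subgroup.closure_le]
  rintro _ ⟨t, ht, rfl⟩
  exact Δ.pow_mem ht e

instance powClosure_normal (Δ : Subgroup G) [Δ.Normal] (e : ℕ) : (powClosure Δ e).Normal := by
  refine ⟨fun x hx g => ?_⟩
  suffices h : powClosure Δ e ≤ (powClosure Δ e).comap (MulAut.conj g).toMonoidHom from h hx
  refine (Subgroup.closure_le _).2 ?_
  rintro _ ⟨t, ht, rfl⟩
  change g * t ^ e * g⁻¹ ∈ powClosure Δ e
  rw [← conj_pow]
  exact pow_mem_powClosure (Subgroup.Normal.conj_mem inferInstance t ht g) e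

theorem le_sup_powClosure {Δ U : Subgroup G} {e q : ℕ} (h : e.Coprime q)
    (hq : ∀ t ∈ Δ, t ^ q ∈ U) : Δ ≤ U ⊔ powClosure Δ e := fun t ht =>
  mem_of_pow_mem_of_coprime _ h (Subgroup.mem_sup_right (pow_mem_powClosure ht e))
    (Subgroup.mem_sup_left (hq t ht))

theorem commute_of_pow_eq_one_of_commutator_pow_eq_one {x y : G} {e q : ℕ} (h : e.Coprime q)
    (hx : x ^ q = 1) (he : ⁅x, y⁆ ^ e = 1) (hc : Commute ⁅x, y⁆ x) : Commute x y := by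
  have hconj : y * x * y⁻¹ = ⁅x, y⁆⁻¹ * x := by rw [commutatorElement_def]; group
  have hq : (⁅x, y⁆⁻¹) ^ q = 1 := by
    rw [← mul_one ((⁅x, y⁆⁻¹) ^ q), ← hx, ← hc.inv_left.mul_pow, ← hconj, conj_pow, hx, mul_one,
      mul_inv_cancel]
  rw [inv_pow, inv_eq_one] at hq
  exact commutatorElement_eq_one_iff_commute.1 (eq_one_of_pow_eq_one_of_coprime h he hq)

theorem pow_eq_one_of_mem_closure {X : Set G} {q : ℕ} (hX : ∀ x ∈ X, ∀ y ∈ X, Commute x y)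
    (hq : ∀ x ∈ X, x ^ q = 1) {y : G} (hy : y ∈ Subgroup.closure X) : y ^ q = 1 := by
  have := Subgroup.isMulCommutative_closure hX
  induction hy using Subgroup.closure_induction with
  | mem x hx => exact hq x hx
  | one => exact one_pow q
  | mul x y hx hy ihx ihy =>
    have hxy : Commute x y := setLike_mul_comm hx hy
    rw [hxy.mul_pow, ihx, ihy, one_mul]
  | inv x _ ih => rw [inv_pow, ih, inv_one]

theorem powClosure_inf_le_commutator {Δ U : Subgroup G} [Δ.Normal] [U.Normal] {e q : ℕ}
    (h : e.Coprime q) (hU : ∀ u ∈ U, u ^ e = 1) (hΔ : ∀ t ∈ Δ, t ^ q ∈ U) (hcomm : ⁅Δ, Δ⁆ ≤ U) :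
    powClosure Δ e ⊓ U ≤ ⁅powClosure Δ e ⊓ U, powClosure Δ e⁆ := by
  set D := powClosure Δ e
  set π := QuotientGroup.mk' ⁅D ⊓ U, D⁆
  have hD_commutator : ⁅D, D⁆ ≤ D ⊓ U := le_inf (Subgroup.commutator_le_left D D)
    ((Subgroup.commutator_mono (powClosure_le Δ e) (powClosure_le Δ e)).trans hcomm)
  have hpow_q : ∀ x ∈ (· ^ e) '' (Δ : Set G), x ^ q = 1 := by
    rintro _ ⟨t, ht, rfl⟩
    dsimp only
    rw [← pow_mul, mul_comm, pow_mul, hU _ (hΔ t ht)]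
  have hcomm_pow : ∀ x ∈ (· ^ e) '' (Δ : Set G), ∀ y ∈ (· ^ e) '' (Δ : Set G),
      Commute (π x) (π y) := by
    intro x hx y hy
    have hxD : x ∈ D := Subgroup.subset_closure hx
    have hz := hD_commutator
      (Subgroup.commutator_mem_commutator hxD (Subgroup.subset_closure hy : y ∈ D))
    refine commute_of_pow_eq_one_of_commutator_pow_eq_one h ?_ ?_ ?_
    · rw [← map_pow, hpow_q x hx, map_one]
    · rw [← map_commutatorElement, ← map_pow, hU _ hz.2, map_one]
    · rw [← map_commutatorElement, ← commutatorElement_eq_one_iff_commute, ← map_commutatorElement,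
        mk'_apply_eq_one_iff]
      exact Subgroup.commutator_mem_commutator hz hxD
  intro s hs
  rw [← mk'_apply_eq_one_iff]
  refine eq_one_of_pow_eq_one_of_coprime h (by rw [← map_pow, hU s hs.2, map_one]) ?_
  have hs_map : π s ∈ Subgroup.closure (π '' ((· ^ e) '' (Δ : Set G))) := by
    rw [← MonoidHom.map_closure]
    exact Subgroup.mem_map_of_mem π hs.1
  refine pow_eq_one_of_mem_closure ?_ ?_ hs_map
  · rintro _ ⟨x, hx, rfl⟩ _ ⟨y, hy, rfl⟩
    exact hcomm_pow x hx y hy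
  · rintro _ ⟨x, hx, rfl⟩
    rw [← map_pow, hpow_q x hx, map_one]

end PowClosure

namespace CoprimeFiltration

variable {G : Type*} [Group G] {n r e q : ℕ} {U D S : Subgroup G} {W : ℕ → Subgroup G}

theorem eq_bot (F : CoprimeFiltration n r e q U D S W)
    (h : ∀ k < r, ⁅D, W k⁆ ≤ W (k + 1)) : S = ⊥ := by
  have hS (k : ℕ) (hk : k ≤ r) : S ≤ W k := by
    induction k with
    | zero => exact F.S_le_U.trans F.W_zero.ge
    | succ k ih =>
      refine F.S_le.trans ((Subgroup.commutator_comm_le S D).trans ?_)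
      exact (Subgroup.commutator_mono le_rfl (ih (by lia))).trans (h k hk)
  exact eq_bot_iff.2 ((hS r le_rfl).trans F.W_last.le)

theorem lowerCentralSeries_le_sup (F : CoprimeFiltration n r e q U D S W) {Δ : Subgroup G}
    (hΔ : Δ ≤ U ⊔ D) (i : ℕ) :
    Δ.lowerCentralSeries (i + 1) ≤ U.lowerCentralSeries (i + 1) ⊔ S := by
  have := F.normal_U
  have := F.normal_S
  have hcomm {j : ℕ} {X : Subgroup G} (hX : X ≤ U.lowerCentralSeries j ⊔ S) :
      ⁅U ⊔ D, X⁆ ≤ U.lowerCentralSeries (j + 1) ⊔ S :=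
    Subgroup.commutator_le.2 fun τ hτ x hx => F.commutator_mem_sup hτ (hX hx)
  induction i with
  | zero =>
    refine (Subgroup.commutator_mono hΔ hΔ).trans ?_
    rw [Subgroup.commutator_comm]
    refine sup_commutator_le ?_ ?_
    · rw [Subgroup.commutator_comm]
      exact hcomm (j := 0) le_sup_left
    · exact ((Subgroup.commutator_mono le_rfl le_top).trans F.D_central).trans le_sup_right
  | succ i ih =>
    rw [Subgroup.lowerCentralSeries_succ, Subgroup.commutator_comm]
    exact (Subgroup.commutator_mono hΔ le_rfl).trans (hcomm ih)

theorem lowerCentralSeries_le (F : CoprimeFiltration n r e q U D S W) {Δ : Subgroup G}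
    (hΔ : Δ ≤ U ⊔ D) (hn : 1 ≤ n) : Δ.lowerCentralSeries n ≤ S := by
  obtain ⟨i, rfl⟩ := Nat.exists_eq_add_of_le' hn
  simpa only [F.nilp, bot_sup_eq] using F.lowerCentralSeries_le_sup hΔ i

end CoprimeFiltration

/-- An approximate group `A` generating `G`, with a subgroup `Γ` having a nilpotent subgroup `U`,
normal in `G`, of coprime exponent, and a filtration `W` of `U` such that each element of `Γ` acts
either trivially or without fixed points on each step of the filtration. -/
structure TorusData {G : Type*} [Group G] (n r e q : ℕ) (A : Set G) (K : ℝ) (Γ U : Subgroup G)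
    (W : ℕ → Subgroup G) : Prop where
  closure_eq : Subgroup.closure A = ⊤
  inv_eq : A⁻¹ = A
  growth : SmallGrowth (A ^ 2) K
  two_le : 2 ≤ K
  normal_U : U.Normal
  U_le : U ≤ Γ
  commutator_le : ⁅Γ, (⊤ : Subgroup G)⁆ ≤ U
  nilp : U.lowerCentralSeries n = ⊥
  W_zero : W 0 = U
  W_last : W r = ⊥
  commutator_Γ_W_le : ∀ k, ⁅Γ, W k⁆ ≤ W k
  commutator_U_W_le : ∀ k, ⁅U, W k⁆ ≤ W (k + 1)
  W_anti : ∀ k, W (k + 1) ≤ W k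
  pow_mem : ∀ d ∈ Γ, d ^ q ∈ U
  pow_eq : ∀ u ∈ U, u ^ e = 1
  coprime : e.Coprime q
  dichotomy : ∀ d ∈ Γ, ∀ k < r, (∀ x ∈ W k, ⁅d, x⁆ ∈ W (k + 1)) ∨
    IsFixedPointFree d (W k) (W (k + 1))

namespace TorusData

variable {G : Type*} [Group G]
variable {n r e q : ℕ} {A : Set G} {K : ℝ} {Γ U : Subgroup G} {W : ℕ → Subgroup G}

theorem conj_mem_W (P : TorusData n r e q A K Γ U W) {k : ℕ} {d x : G} (hd : d ∈ Γ)
    (hx : x ∈ W k) : d * x * d⁻¹ ∈ W k := by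
  rw [show d * x * d⁻¹ = ⁅d, x⁆ * x by rw [commutatorElement_def, inv_mul_cancel_right]]
  exact (W k).mul_mem (P.commutator_Γ_W_le k (Subgroup.commutator_mem_commutator hd hx)) hx

/-- The elements of `Γ` acting trivially on the `k`-th step of the filtration. -/
def stepCentralizer (P : TorusData n r e q A K Γ U W) (k : ℕ) : Subgroup G where
  carrier := {d | d ∈ Γ ∧ ∀ x ∈ W k, ⁅d, x⁆ ∈ W (k + 1)}
  one_mem' := ⟨Γ.one_mem, fun x _ => by
    rw [commutatorElement_one_left]; exact (W (k + 1)).one_mem⟩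
  mul_mem' := by
    rintro a b ⟨ha, ha'⟩ ⟨hb, hb'⟩
    refine ⟨Γ.mul_mem ha hb, fun x hx => ?_⟩
    rw [commutatorElement_mul_left_eq_conj_mul]
    exact (W (k + 1)).mul_mem (P.conj_mem_W ha (hb' x hx)) (ha' x hx)
  inv_mem' := by
    rintro a ⟨ha, ha'⟩
    refine ⟨Γ.inv_mem ha, fun x hx => ?_⟩
    rw [show ⁅a⁻¹, x⁆ = a⁻¹ * ⁅a, x⁆⁻¹ * a⁻¹⁻¹ by simp only [commutatorElement_def]; group]
    exact P.conj_mem_W (Γ.inv_mem ha) ((W (k + 1)).inv_mem (ha' x hx))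

/-- The elements of `Γ` acting trivially on the steps of the filtration indexed by `J`. -/
def multiCentralizer (P : TorusData n r e q A K Γ U W) (J : Finset ℕ) : Subgroup G :=
  Γ ⊓ ⨅ k ∈ J, P.stepCentralizer k

theorem multiCentralizer_le (P : TorusData n r e q A K Γ U W) (J : Finset ℕ) :
    P.multiCentralizer J ≤ Γ := inf_le_left

theorem multiCentralizer_le_stepCentralizer (P : TorusData n r e q A K Γ U W) {J : Finset ℕ}
    {k : ℕ} (hk : k ∈ J) : P.multiCentralizer J ≤ P.stepCentralizer k :=
  inf_le_right.trans (iInf₂_le k hk)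

theorem commutator_multiCentralizer_W_le (P : TorusData n r e q A K Γ U W) {J : Finset ℕ} {k : ℕ}
    (hk : k ∈ J) : ⁅P.multiCentralizer J, W k⁆ ≤ W (k + 1) :=
  Subgroup.commutator_le.2 fun _ hd => (P.multiCentralizer_le_stepCentralizer hk hd).2

theorem le_multiCentralizer (P : TorusData n r e q A K Γ U W) (J : Finset ℕ) :
    U ≤ P.multiCentralizer J :=
  le_inf P.U_le (le_iInf₂ fun k _ _ hu => ⟨P.U_le hu, fun _ hx =>
    P.commutator_U_W_le k (Subgroup.commutator_mem_commutator hu hx)⟩)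

theorem multiCentralizer_normal (P : TorusData n r e q A K Γ U W) (J : Finset ℕ) :
    (P.multiCentralizer J).Normal :=
  Subgroup.commutator_top_right_le_iff.1 (((Subgroup.commutator_mono (P.multiCentralizer_le J)
    le_rfl).trans P.commutator_le).trans (P.le_multiCentralizer J))

theorem multiCentralizer_insert (P : TorusData n r e q A K Γ U W) (J : Finset ℕ) (k : ℕ) :
    P.multiCentralizer (insert k J) = P.multiCentralizer J ⊓ P.stepCentralizer k := by
  rw [multiCentralizer, multiCentralizer, Finset.iInf_insert, inf_assoc,
    inf_comm (P.stepCentralizer k)]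

theorem cosetCount_multiCentralizer_insert_le [Finite G] (P : TorusData n r e q A K Γ U W)
    (J : Finset ℕ) (k : ℕ) :
    cosetCount (A ^ 2 ∩ Γ) (P.multiCentralizer (insert k J)) ≤
      cosetCount (A ^ 2 ∩ Γ) (P.multiCentralizer J) *
        cosetCount ((A ^ 2) ^ 2 ∩ P.multiCentralizer J) (P.stepCentralizer k) := by
  have hsub : (A ^ 2 ∩ Γ : Set G)⁻¹ * (A ^ 2 ∩ Γ) ⊆ (A ^ 2) ^ 2 := by
    rintro _ ⟨x, hx, y, hy, rfl⟩
    rw [sq (A ^ 2)]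
    exact Set.mul_mem_mul (P.growth.inv_eq ▸ hx.1) hy.1
  rw [multiCentralizer_insert]
  exact (cosetCount_inf_le _ _ _).trans
    (Nat.mul_le_mul_left _ (cosetCount_mono (Set.inter_subset_inter_left _ hsub) _))

theorem exists_multiCentralizer [Finite G] (P : TorusData n r e q A K Γ U W) (M : ℕ) :
    ∃ J ⊆ Finset.range r,
      (cosetCount (A ^ 2 ∩ Γ) (P.multiCentralizer J) : ℝ) ≤ K ^ (M * J.card) ∧
      ∀ k < r, k ∉ J → K ^ M ≤
        cosetCount ((A ^ 2) ^ 2 ∩ P.multiCentralizer J) (P.stepCentralizer k) := by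
  have hK : 0 < K := by linarith [P.two_le]
  have hempty : (cosetCount (A ^ 2 ∩ Γ) (P.multiCentralizer ∅) : ℝ) ≤ K ^ (M * 0) := by
    have hle : cosetCount (A ^ 2 ∩ Γ) (P.multiCentralizer ∅) ≤ 1 :=
      cosetCount_le_one (by simp [multiCentralizer])
    simpa using hle
  have hfinite : {J | J ⊆ Finset.range r ∧
      (cosetCount (A ^ 2 ∩ Γ) (P.multiCentralizer J) : ℝ) ≤ K ^ (M * J.card)}.Finite :=
    (Finset.range r).powerset.finite_toSet.subset fun J hJ => Finset.mem_powerset.2 hJ.1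
  obtain ⟨J, hJ⟩ := hfinite.exists_maximal ⟨∅, Finset.empty_subset _, hempty⟩
  refine ⟨J, hJ.prop.1, hJ.prop.2, fun k hk hkJ => ?_⟩
  by_contra! hlt
  refine hkJ (hJ.le_of_ge (y := insert k J) ⟨?_, ?_⟩ (Finset.subset_insert k J)
    (Finset.mem_insert_self k J))
  · exact Finset.insert_subset (Finset.mem_range.2 hk) hJ.prop.1
  · calc (cosetCount (A ^ 2 ∩ Γ) (P.multiCentralizer (insert k J)) : ℝ)
        ≤ cosetCount (A ^ 2 ∩ Γ) (P.multiCentralizer J) *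
          cosetCount ((A ^ 2) ^ 2 ∩ P.multiCentralizer J) (P.stepCentralizer k) := by
          exact_mod_cast P.cosetCount_multiCentralizer_insert_le J k
      _ ≤ K ^ (M * J.card) * K ^ M := by gcongr; exact hJ.prop.2
      _ = K ^ (M * (insert k J).card) := by
          rw [Finset.card_insert_of_notMem hkJ, ← pow_add, mul_add, mul_one]

theorem coprimeFiltration (P : TorusData n r e q A K Γ U W) {Δ : Subgroup G} [Δ.Normal]
    (hΔ : Δ ≤ Γ) :
    CoprimeFiltration n r e q U (powClosure Δ e) (powClosure Δ e ⊓ U) W := by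
  have hU := P.normal_U
  have hpow (d : G) (hd : d ∈ Δ) : d ^ q ∈ U := P.pow_mem d (hΔ hd)
  have hD := powClosure_le Δ e
  exact
    { normal_U := hU
      normal_D := inferInstance
      normal_S := inferInstance
      S_le_U := inf_le_right
      S_le_D := inf_le_left
      D_central := le_inf (Subgroup.commutator_le_left _ _)
        ((Subgroup.commutator_mono (hD.trans hΔ) le_rfl).trans P.commutator_le)
      S_le := powClosure_inf_le_commutator P.coprime P.pow_eq hpow
        ((Subgroup.commutator_mono hΔ le_top).trans P.commutator_le)
      nilp := P.nilp
      W_zero := P.W_zero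
      W_last := P.W_last
      commutator_D_W_le := fun k =>
        (Subgroup.commutator_mono (hD.trans hΔ) le_rfl).trans (P.commutator_Γ_W_le k)
      commutator_U_W_le := P.commutator_U_W_le
      W_anti := P.W_anti
      pow_mem := fun d hd => ⟨Subgroup.pow_mem _ hd q, hpow d (hD hd)⟩
      pow_eq := P.pow_eq
      coprime := P.coprime }

theorem le_sup_powClosure (P : TorusData n r e q A K Γ U W) {Δ : Subgroup G} (hΔ : Δ ≤ Γ) :
    Δ ≤ U ⊔ powClosure Δ e :=
  _root_.le_sup_powClosure P.coprime fun d hd => P.pow_mem d (hΔ hd)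

theorem pivotData (P : TorusData n r e q A K Γ U W) {J : Finset ℕ} {T : Set G}
    (hT : T ⊆ (A ^ 2) ^ 2 ∩ P.multiCentralizer J)
    (hsep : ∀ t ∈ T, ∀ t' ∈ T, t ≠ t' → ∀ k ∈ Finset.range r \ J, t⁻¹ * t' ∉ P.stepCentralizer k) :
    PivotData n r e q A K U (powClosure (P.multiCentralizer J) e)
      (powClosure (P.multiCentralizer J) e ⊓ U) W T := by
  have := P.multiCentralizer_normal J
  have hΔ := P.multiCentralizer_le J
  exact
    { P.coprimeFiltration hΔ with
      closure_eq := P.closure_eq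
      inv_eq := P.inv_eq
      growth := P.growth
      two_le := P.two_le
      T_sub := hT.trans Set.inter_subset_left
      T_le := hT.trans (Set.inter_subset_right.trans (P.le_sup_powClosure hΔ))
      rich := fun t ht t' ht' hne k hk => by
        by_cases hkJ : k ∈ J
        · exact Or.inl ((Subgroup.commutator_mono (powClosure_le _ e) le_rfl).trans
            (P.commutator_multiCentralizer_W_le hkJ))
        · have hmem : t⁻¹ * t' ∈ Γ := Γ.mul_mem (Γ.inv_mem (hΔ (hT ht).2)) (hΔ (hT ht').2)
          refine Or.inr ((P.dichotomy _ hmem k hk).resolve_left fun h => ?_)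
          exact hsep t ht t' ht' hne k (by simp [hk, hkJ]) ⟨hmem, h⟩ }

theorem cosetCount_multiCentralizer_le [Finite G] (P : TorusData n r e q A K Γ U W) {c M : ℕ}
    {J : Finset ℕ} (hJ : J ⊆ Finset.range r) (hc : (cosetCount A Γ : ℝ) ≤ K ^ c)
    (hM : (cosetCount (A ^ 2 ∩ Γ) (P.multiCentralizer J) : ℝ) ≤ K ^ (M * J.card)) :
    (cosetCount A (P.multiCentralizer J) : ℝ) ≤ K ^ (c + M * r) := by
  have hK : 1 ≤ K := P.growth.one_le
  have hcard : J.card ≤ r := by simpa using Finset.card_le_card hJ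
  have hle := cosetCount_inf_le A Γ (P.multiCentralizer J)
  rw [inf_eq_right.2 (P.multiCentralizer_le J), P.inv_eq, ← sq] at hle
  calc (cosetCount A (P.multiCentralizer J) : ℝ)
      ≤ cosetCount A Γ * cosetCount (A ^ 2 ∩ Γ) (P.multiCentralizer J) := by exact_mod_cast hle
    _ ≤ K ^ c * K ^ (M * J.card) := by gcongr
    _ ≤ K ^ (c + M * r) := by rw [← pow_add]; gcongr

theorem pow_lt_ncard_of_separated (P : TorusData n r e q A K Γ U W) {M : ℕ} {I : Finset ℕ}
    {T : Set G} (hI : I ⊆ Finset.range r)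
    (hcard : K ^ (M + r + 8) ≤ K ^ 7 * I.card * T.ncard) : K ^ M < T.ncard := by
  have hK : 2 ≤ K := P.two_le
  have hI_card : (I.card : ℝ) ≤ K ^ r := by
    have hle : I.card ≤ r := by simpa using Finset.card_le_card hI
    calc (I.card : ℝ) ≤ 2 ^ r := by exact_mod_cast hle.trans Nat.lt_two_pow_self.le
      _ ≤ K ^ r := by gcongr
  have hT : K ^ (M + 1) ≤ T.ncard := by
    refine le_of_mul_le_mul_left (a := K ^ (r + 7)) ?_ (by positivity)
    calc K ^ (r + 7) * K ^ (M + 1) = K ^ (M + r + 8) := by ring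
      _ ≤ K ^ 7 * I.card * T.ncard := hcard
      _ ≤ K ^ 7 * K ^ r * T.ncard := by gcongr
      _ = K ^ (r + 7) * T.ncard := by ring
  exact (pow_lt_pow_right₀ (by linarith) M.lt_succ_self).trans_le hT

theorem exists_normal_subgroup (n r c : ℕ) (hn : 1 ≤ n) : ∃ C m : ℕ,
    ∀ {G : Type u} [Group G] [Finite G] {e q : ℕ} {A : Set G} {K : ℝ} {Γ U : Subgroup G}
      {W : ℕ → Subgroup G}, TorusData n r e q A K Γ U W → (cosetCount A Γ : ℝ) ≤ K ^ c →
      ∃ Δ ≤ Γ, Δ.Normal ∧ (cosetCount A Δ : ℝ) ≤ K ^ C ∧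
        (Δ.lowerCentralSeries n : Set G) ⊆ (A ^ 2) ^ m := by
  obtain ⟨m, M, hpivot⟩ := PivotData.exists_subset_pow.{u} n
  refine ⟨c + (M + r + 8) * r, m, fun {G} _ _ e q A K Γ U W P hc => ?_⟩
  obtain ⟨J, hJ, hcount, hlarge⟩ := P.exists_multiCentralizer (M + r + 8)
  refine ⟨P.multiCentralizer J, P.multiCentralizer_le J, P.multiCentralizer_normal J,
    P.cosetCount_multiCentralizer_le hJ hc hcount, ?_⟩
  have := P.multiCentralizer_normal J
  have F := P.coprimeFiltration (P.multiCentralizer_le J)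
  have hle := F.lowerCentralSeries_le (P.le_sup_powClosure (P.multiCentralizer_le J)) hn
  rcases (Finset.range r \ J).eq_empty_or_nonempty with hI | hI
  · have hbot := F.eq_bot fun k hk =>
      (Subgroup.commutator_mono (powClosure_le _ e) le_rfl).trans
        (P.commutator_multiCentralizer_W_le
          (Finset.sdiff_eq_empty_iff_subset.1 hI (Finset.mem_range.2 hk)))
    intro x hx
    rw [Subgroup.mem_bot.1 (hbot.le (hle hx))]
    exact P.growth.one_mem_pow m
  · obtain ⟨T, hT, hsep, hcard⟩ := P.growth.exists_pairwise_separated (P.multiCentralizer J)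
      P.stepCentralizer hI fun k hk => hlarge k (Finset.mem_range.1 (Finset.mem_sdiff.1 hk).1)
        (Finset.mem_sdiff.1 hk).2
    exact (SetLike.coe_subset_coe.2 hle).trans
      (hpivot (P.pivotData hT hsep) (P.pow_lt_ncard_of_separated Finset.sdiff_subset hcard))

end TorusData

section Support

variable {ι R : Type*}

/-- The matrices whose entries outside the relation `s` vanish. -/
def supportedOn (R : Type*) [AddGroup R] (s : ι → ι → Prop) : AddSubgroup (Matrix ι ι R) where
  carrier := {X | ∀ i j, ¬ s i j → X i j = 0}
  zero_mem' _ _ _ := rfl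
  add_mem' hX hY i j h := by rw [Matrix.add_apply, hX i j h, hY i j h, add_zero]
  neg_mem' hX i j h := by rw [Matrix.neg_apply, hX i j h, neg_zero]

theorem supportedOn_mono [AddGroup R] {s t : ι → ι → Prop} (h : ∀ i j, s i j → t i j) :
    supportedOn R s ≤ supportedOn R t :=
  fun _ hX i j hij => hX i j fun hs => hij (h i j hs)

theorem mul_mem_supportedOn [Fintype ι] [Ring R] {s t w : ι → ι → Prop} {X Y : Matrix ι ι R}
    (h : ∀ i l j, s i l → t l j → w i j) (hX : X ∈ supportedOn R s) (hY : Y ∈ supportedOn R t) :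
    X * Y ∈ supportedOn R w := by
  intro i j hij
  rw [Matrix.mul_apply]
  refine Finset.sum_eq_zero fun l _ => ?_
  by_cases hs : s i l
  · rw [hY l j fun ht => hij (h i l j hs ht), mul_zero]
  · rw [hX i l hs, zero_mul]

/-- The relations `s` for which the matrices supported on `s` are stable under multiplication by
upper triangular matrices on both sides. -/
def IsIdealRel [LE ι] (s : ι → ι → Prop) : Prop :=
  ∀ i i' j' j, i ≤ i' → s i' j' → j' ≤ j → s i j

variable [Fintype ι] [LinearOrder ι] [Ring R] {s : ι → ι → Prop} {X Y : Matrix ι ι R}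

theorem IsIdealRel.mul_mem_left (hs : IsIdealRel s) (hX : X.IsUpperTriangular)
    (hY : Y ∈ supportedOn R s) : X * Y ∈ supportedOn R s :=
  mul_mem_supportedOn (s := (· ≤ ·)) (fun i l j hil hlj => hs i l j j hil hlj le_rfl)
    (fun _ _ h => hX (not_le.1 h)) hY

theorem IsIdealRel.mul_mem_right (hs : IsIdealRel s) (hX : X ∈ supportedOn R s)
    (hY : Y.IsUpperTriangular) : X * Y ∈ supportedOn R s :=
  mul_mem_supportedOn (t := (· ≤ ·)) (fun i l j hil hlj => hs i i l j le_rfl hil hlj) hX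
    (fun _ _ h => hY (not_le.1 h))

theorem mul_apply_self_of_isUpperTriangular (hX : X.IsUpperTriangular) (hY : Y.IsUpperTriangular)
    (i : ι) : (X * Y) i i = X i i * Y i i := by
  rw [Matrix.mul_apply]
  refine Finset.sum_eq_single i (fun l _ hl => ?_) (fun h => absurd (Finset.mem_univ i) h)
  rcases lt_or_gt_of_ne hl with h | h
  · rw [hX h, zero_mul]
  · rw [hY h, mul_zero]

end Support

section CongruenceSubgroups

variable {n : ℕ} {E : Type u} [Field E]

/-- The inclusion of the group of invertible upper triangular matrices into the matrix ring. -/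
def borelMatrix : borelSubgroup n E →* Matrix (Fin n) (Fin n) E :=
  (Units.coeHom _).comp (borelSubgroup n E).subtype

theorem borelMatrix_isUpperTriangular (g : borelSubgroup n E) :
    (borelMatrix g).IsUpperTriangular := g.2

theorem borelMatrix_injective : Function.Injective (borelMatrix (n := n) (E := E)) :=
  Units.val_injective.comp Subtype.val_injective

/-- The upper triangular matrices congruent to `1` modulo the ideal defined by `s`. -/
def congruenceSubgroup (E : Type u) [Field E] {s : Fin n → Fin n → Prop} (hs : IsIdealRel s) :
    Subgroup (borelSubgroup n E) where
  carrier := {g | borelMatrix g - 1 ∈ supportedOn E s}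
  one_mem' := by
    rw [Set.mem_ofPred_eq, map_one, sub_self]
    exact zero_mem _
  mul_mem' {a b} ha hb := by
    have hmul : borelMatrix (a * b) - 1 =
        (borelMatrix a - 1) * borelMatrix b + (borelMatrix b - 1) := by
      rw [map_mul]; noncomm_ring
    rw [Set.mem_ofPred_eq, hmul]
    exact add_mem (hs.mul_mem_right ha (borelMatrix_isUpperTriangular b)) hb
  inv_mem' {a} ha := by
    have hinv : borelMatrix a⁻¹ - 1 = -((borelMatrix a - 1) * borelMatrix a⁻¹) := by
      rw [sub_mul, ← map_mul, mul_inv_cancel, map_one, one_mul, neg_sub]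
    rw [Set.mem_ofPred_eq, hinv]
    exact neg_mem (hs.mul_mem_right ha (borelMatrix_isUpperTriangular _))

variable {s t w : Fin n → Fin n → Prop} {hs : IsIdealRel s} {ht : IsIdealRel t}
  {hw : IsIdealRel w}

theorem mem_congruenceSubgroup {g : borelSubgroup n E} :
    g ∈ congruenceSubgroup E hs ↔ borelMatrix g - 1 ∈ supportedOn E s := Iff.rfl

theorem congruenceSubgroup_mono (h : ∀ i j, s i j → t i j) :
    congruenceSubgroup E hs ≤ congruenceSubgroup E ht :=
  fun _ hx => supportedOn_mono h hx

instance congruenceSubgroup_normal : (congruenceSubgroup E hs).Normal := by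
  refine ⟨fun x hx g => ?_⟩
  have hconj : borelMatrix (g * x * g⁻¹) - 1 =
      borelMatrix g * (borelMatrix x - 1) * borelMatrix g⁻¹ := by
    rw [mul_sub, sub_mul, mul_one, ← map_mul, ← map_mul, ← map_mul, mul_inv_cancel, map_one]
  rw [mem_congruenceSubgroup, hconj]
  exact hs.mul_mem_right (hs.mul_mem_left (borelMatrix_isUpperTriangular g) hx)
    (borelMatrix_isUpperTriangular _)

theorem borelMatrix_commutator_sub_one (a b : borelSubgroup n E) :
    borelMatrix ⁅a, b⁆ - 1 = ((borelMatrix a - 1) * (borelMatrix b - 1) -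
      (borelMatrix b - 1) * (borelMatrix a - 1)) * borelMatrix (a⁻¹ * b⁻¹) := by
  have hcomm : (borelMatrix a - 1) * (borelMatrix b - 1) -
      (borelMatrix b - 1) * (borelMatrix a - 1) =
      borelMatrix a * borelMatrix b - borelMatrix b * borelMatrix a := by noncomm_ring
  rw [hcomm, sub_mul, ← map_mul, ← map_mul, ← map_mul, ← map_mul,
    show b * a * (a⁻¹ * b⁻¹) = 1 by group, map_one, commutatorElement_def, mul_assoc (a * b)]

theorem commutator_mem_congruenceSubgroup (h : ∀ i l j, s i l → t l j → w i j)
    (h' : ∀ i l j, t i l → s l j → w i j) {a b : borelSubgroup n E}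
    (ha : a ∈ congruenceSubgroup E hs) (hb : b ∈ congruenceSubgroup E ht) :
    ⁅a, b⁆ ∈ congruenceSubgroup E hw := by
  rw [mem_congruenceSubgroup, borelMatrix_commutator_sub_one]
  exact hw.mul_mem_right (sub_mem (mul_mem_supportedOn h ha hb) (mul_mem_supportedOn h' hb ha))
    (borelMatrix_isUpperTriangular _)

theorem congruenceSubgroup_eq_bot (h : ∀ i j, ¬ s i j) : congruenceSubgroup E hs = ⊥ :=
  eq_bot_iff.2 fun g hg => borelMatrix_injective <| by
    rw [map_one, ← sub_eq_zero]
    exact Matrix.ext fun i j => hg i j (h i j)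

end CongruenceSubgroups

section EntryPositions

/-- The position of the `(i, j)` entry when the entries are read one diagonal after the other, the
main diagonal coming first, with positions `0` to `n - 1`. -/
def entryPos (n : ℕ) (i j : Fin n) : ℤ := (j - i) * n + i

/-- The entries above the main diagonal coming after the first `k` ones. -/
def posRel (n k : ℕ) (i j : Fin n) : Prop := n + k ≤ entryPos n i j

/-- The entries on the `d`-th diagonal above the main one, or further above. -/
def diagRel (n d : ℕ) (i j : Fin n) : Prop := (i : ℕ) + d ≤ j

variable {n k d : ℕ} {i l j : Fin n}

theorem isIdealRel_posRel (n k : ℕ) : IsIdealRel (posRel n k) := by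
  intro i i' j' j hi h hj
  have hn : (1 : ℤ) ≤ n := by exact_mod_cast i.pos
  have hi' : (i : ℤ) ≤ i' := by exact_mod_cast hi
  have hj' : (j' : ℤ) ≤ j := by exact_mod_cast hj
  unfold posRel entryPos at *
  nlinarith [mul_le_mul_of_nonneg_right hi' (sub_nonneg.2 hn),
    mul_le_mul_of_nonneg_right hj' (by linarith : (0 : ℤ) ≤ n)]

theorem isIdealRel_diagRel (n d : ℕ) : IsIdealRel (diagRel n d) := by
  intro i i' j' j hi h hj
  rw [← Fin.val_fin_le] at hi hj
  unfold diagRel at *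
  lia

theorem posRel_zero_iff : posRel n 0 i j ↔ i < j := by
  have hn : (1 : ℤ) ≤ n := by exact_mod_cast i.pos
  have hi : (i : ℤ) < n := by exact_mod_cast i.2
  have : (0 : ℤ) ≤ i := by positivity
  unfold posRel entryPos
  rw [← Fin.val_fin_lt]
  constructor
  · intro h
    by_contra! hle
    have hle' : (j : ℤ) ≤ i := by exact_mod_cast hle
    have := mul_le_mul_of_nonneg_right hle' (by linarith : (0 : ℤ) ≤ n)
    push_cast at h
    nlinarith
  · intro h
    have h' : (i : ℤ) + 1 ≤ j := by exact_mod_cast h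
    have := mul_le_mul_of_nonneg_right h' (by linarith : (0 : ℤ) ≤ n)
    push_cast
    nlinarith

theorem diagRel_succ_of_lt_left (hil : i < l) (hlj : diagRel n d l j) : diagRel n (d + 1) i j := by
  rw [← Fin.val_fin_lt] at hil
  unfold diagRel at *
  lia

theorem diagRel_succ_of_lt_right (hil : diagRel n d i l) (hlj : l < j) :
    diagRel n (d + 1) i j := by
  rw [← Fin.val_fin_lt] at hlj
  unfold diagRel at *
  lia

theorem not_diagRel_self (i j : Fin n) : ¬ diagRel n n i j := by
  have := j.2
  unfold diagRel
  lia

theorem posRel_succ_of_lt_left (hil : i < l) (hlj : posRel n k l j) : posRel n (k + 1) i j := by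
  have hil' : (i : ℤ) + 1 ≤ l := by exact_mod_cast hil
  have hn : (2 : ℤ) ≤ n := by
    have := l.2
    rw [← Fin.val_fin_lt] at hil
    lia
  unfold posRel entryPos at *
  have := mul_le_mul_of_nonneg_right hil' (by linarith : (0 : ℤ) ≤ n - 1)
  push_cast
  nlinarith

theorem posRel_succ_of_lt_right (hil : posRel n k i l) (hlj : l < j) : posRel n (k + 1) i j := by
  have hlj' : (l : ℤ) + 1 ≤ j := by exact_mod_cast hlj
  have hn : (1 : ℤ) ≤ n := by exact_mod_cast i.pos
  unfold posRel entryPos at *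
  have := mul_le_mul_of_nonneg_right hlj' (by linarith : (0 : ℤ) ≤ n)
  push_cast
  nlinarith

theorem posRel_of_succ (h : posRel n (k + 1) i j) : posRel n k i j := by
  unfold posRel at *
  lia

theorem not_posRel_sq (i j : Fin n) : ¬ posRel n (n ^ 2) i j := by
  unfold posRel entryPos
  have hn : (1 : ℤ) ≤ n := by exact_mod_cast i.pos
  have hj : (j : ℤ) + 1 ≤ n := by exact_mod_cast j.2
  have hi : (0 : ℤ) ≤ i := by positivity
  have := mul_le_mul_of_nonneg_right hj (by linarith : (0 : ℤ) ≤ n)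
  have := mul_nonneg hi (by linarith : (0 : ℤ) ≤ n - 1)
  push_cast
  nlinarith

theorem entryPos_injective {i' j' : Fin n} (h : entryPos n i j = entryPos n i' j') :
    i = i' ∧ j = j' := by
  have hmod (i j : Fin n) : entryPos n i j % n = i := by
    rw [entryPos, add_comm, Int.add_mul_emod_self_right]
    exact Int.emod_eq_of_lt (by positivity) (by exact_mod_cast i.2)
  have hi : (i : ℤ) = i' := by rw [← hmod i j, h, hmod]
  have hj : (j : ℤ) = j' := by simpa [entryPos, hi, i.pos.ne'] using h
  exact ⟨Fin.ext (by exact_mod_cast hi), Fin.ext (by exact_mod_cast hj)⟩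

theorem entryPos_eq (h : posRel n k i j) (h' : ¬ posRel n (k + 1) i j) :
    entryPos n i j = n + k := by
  unfold posRel at *
  lia

end EntryPositions

section UnipotentFiltration

variable {n : ℕ} {E : Type u} [Field E]

/-- The `i`-th diagonal entry as a character of the group of invertible upper triangular
matrices. -/
def diagonalCharacter (i : Fin n) : borelSubgroup n E →* E where
  toFun g := borelMatrix g i i
  map_one' := by rw [map_one, Matrix.one_apply_eq]
  map_mul' a b := by
    rw [map_mul, mul_apply_self_of_isUpperTriangular (borelMatrix_isUpperTriangular a)
      (borelMatrix_isUpperTriangular b)]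

theorem diagonalCharacter_ne_zero (i : Fin n) (g : borelSubgroup n E) :
    diagonalCharacter i g ≠ 0 :=
  ((Group.isUnit g).map (diagonalCharacter i)).ne_zero

/-- The filtration of the group of unipotent upper triangular matrices whose successive quotients
are given by a single matrix entry. -/
def unipotentFiltration (n : ℕ) (E : Type u) [Field E] (k : ℕ) : Subgroup (borelSubgroup n E) :=
  congruenceSubgroup E (isIdealRel_posRel n k)

instance unipotentFiltration_normal (k : ℕ) : (unipotentFiltration n E k).Normal :=
  congruenceSubgroup_normal

theorem unipotentFiltration_antitone : Antitone (unipotentFiltration n E) :=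
  antitone_nat_of_succ_le fun _ => congruenceSubgroup_mono fun _ _ => posRel_of_succ

theorem unipotentFiltration_sq : unipotentFiltration n E (n ^ 2) = ⊥ :=
  congruenceSubgroup_eq_bot not_posRel_sq

theorem mem_unipotentFiltration_zero_iff {g : borelSubgroup n E} :
    g ∈ unipotentFiltration n E 0 ↔ ∀ i, diagonalCharacter i g = 1 := by
  refine ⟨fun hg i => ?_, fun hg i j hij => ?_⟩
  · have h := hg i i fun h => lt_irrefl i (posRel_zero_iff.1 h)
    rwa [Matrix.sub_apply, Matrix.one_apply_eq, sub_eq_zero] at h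
  · rw [posRel_zero_iff, not_lt] at hij
    rcases hij.lt_or_eq with hlt | rfl
    · rw [Matrix.sub_apply, Matrix.one_apply_ne hlt.ne', sub_zero]
      exact borelMatrix_isUpperTriangular g hlt
    · rw [Matrix.sub_apply, Matrix.one_apply_eq, sub_eq_zero]
      exact hg j

theorem commutator_unipotentFiltration_le (k : ℕ) :
    ⁅unipotentFiltration n E 0, unipotentFiltration n E k⁆ ≤ unipotentFiltration n E (k + 1) :=
  Subgroup.commutator_le.2 fun _ hu _ hx => commutator_mem_congruenceSubgroup
    (s := posRel n 0) (t := posRel n k) (w := posRel n (k + 1))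
    (fun _ _ _ h h' => posRel_succ_of_lt_left (posRel_zero_iff.1 h) h')
    (fun _ _ _ h h' => posRel_succ_of_lt_right h (posRel_zero_iff.1 h')) hu hx

theorem lowerCentralSeries_unipotentFiltration_le (i : ℕ) :
    (unipotentFiltration n E 0).lowerCentralSeries i ≤
      congruenceSubgroup E (isIdealRel_diagRel n (i + 1)) := by
  induction i with
  | zero =>
    exact congruenceSubgroup_mono (hs := isIdealRel_posRel n 0) fun _ _ h => posRel_zero_iff.1 h
  | succ i ih =>
    rw [Subgroup.lowerCentralSeries_succ, Subgroup.commutator_le]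
    exact fun x hx y hy => commutator_mem_congruenceSubgroup
      (s := diagRel n (i + 1)) (t := posRel n 0) (w := diagRel n (i + 1 + 1))
      (fun _ _ _ h h' => diagRel_succ_of_lt_right h (posRel_zero_iff.1 h'))
      (fun _ _ _ h h' => diagRel_succ_of_lt_left (posRel_zero_iff.1 h) h') (ih hx) hy

theorem lowerCentralSeries_unipotentFiltration (hn : 1 ≤ n) :
    (unipotentFiltration n E 0).lowerCentralSeries (n - 1) = ⊥ := by
  refine eq_bot_iff.2 ((lowerCentralSeries_unipotentFiltration_le (n - 1)).trans ?_)
  refine (congruenceSubgroup_eq_bot fun i j => ?_).le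
  rw [Nat.sub_add_cancel hn]
  exact not_diagRel_self i j

theorem pow_eq_zero_of_mem_supportedOn {X : Matrix (Fin n) (Fin n) E}
    (hX : X ∈ supportedOn E (posRel n 0)) : X ^ n = 0 := by
  have hpow (d : ℕ) : X ^ d ∈ supportedOn E (diagRel n d) := by
    induction d with
    | zero =>
      intro i j hij
      rw [pow_zero]
      exact Matrix.one_apply_ne fun h => hij (by rw [h]; exact le_rfl)
    | succ d ih =>
      rw [pow_succ]
      exact mul_mem_supportedOn (s := diagRel n d) (t := posRel n 0)
        (fun _ _ _ h h' => diagRel_succ_of_lt_right h (posRel_zero_iff.1 h')) ih hX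
  exact Matrix.ext fun i j => hpow n i j (not_diagRel_self i j)

theorem pow_eq_one_of_mem_unipotentFiltration {p : ℕ} [Fact p.Prime] [CharP E p]
    {u : borelSubgroup n E} (hu : u ∈ unipotentFiltration n E 0) : u ^ p ^ n = 1 := by
  obtain rfl | hn := n.eq_zero_or_pos
  · exact borelMatrix_injective (Subsingleton.elim _ _)
  have : NeZero n := ⟨hn.ne'⟩
  have hzero : (borelMatrix u - 1) ^ p ^ n = 0 := pow_eq_zero_of_le
    (Nat.lt_pow_self (Fact.out : p.Prime).one_lt).le (pow_eq_zero_of_mem_supportedOn hu)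
  apply borelMatrix_injective
  rw [map_pow, map_one, ← sub_add_cancel (borelMatrix u) 1,
    add_pow_char_pow_of_commute p n (Commute.one_right _), hzero, one_pow, zero_add]

theorem pow_mem_unipotentFiltration {p a q : ℕ} [Fact p.Prime] [CharP E p]
    {g : borelSubgroup n E} (hg : g ^ (p ^ a * q) = 1) : g ^ q ∈ unipotentFiltration n E 0 := by
  -- The diagonal entries of `g ^ q` are `p ^ a`-th roots of unity, hence `1`.
  refine mem_unipotentFiltration_zero_iff.2 fun i => ?_
  have hpow : diagonalCharacter i (g ^ q) ^ p ^ a = 1 := by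
    rw [← map_pow, ← pow_mul, mul_comm, hg, map_one]
  have hsub := sub_pow_char_pow (p := p) (n := a) (diagonalCharacter i (g ^ q)) 1
  rw [hpow, one_pow, sub_self] at hsub
  exact sub_eq_zero.1 (eq_zero_of_pow_eq_zero hsub)

end UnipotentFiltration

/-- The function `f` identifies the section `V / V'` with a group of scalars on which `b` acts as
multiplication by `χ`. -/
structure IsScalarSection {H E : Type*} [Group H] [Field E] (b : H) (χ : E) (V V' : Subgroup H)
    (f : H → E) : Prop where
  le : V' ≤ V
  conj_mem : ∀ v ∈ V, b * v * b⁻¹ ∈ V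
  apply_mul : ∀ v ∈ V, ∀ v' ∈ V, f (v * v') = f v + f v'
  apply_eq_zero_iff : ∀ v ∈ V, f v = 0 ↔ v ∈ V'
  apply_conj : ∀ v ∈ V, f (b * v * b⁻¹) = χ * f v

namespace IsScalarSection

variable {H E : Type*} [Group H] [Field E] {b : H} {χ : E} {V V' : Subgroup H} {f : H → E}

theorem comap {L : Type*} [Group L] {ρ : L →* H} {b : L} (h : IsScalarSection (ρ b) χ V V' f) :
    IsScalarSection b χ (V.comap ρ) (V'.comap ρ) (f ∘ ρ) where
  le := Subgroup.comap_mono h.le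
  conj_mem v hv := by simpa using h.conj_mem _ hv
  apply_mul v hv v' hv' := by simpa using h.apply_mul _ hv _ hv'
  apply_eq_zero_iff v hv := h.apply_eq_zero_iff _ hv
  apply_conj v hv := by simpa using h.apply_conj _ hv

theorem commutator_mem (h : IsScalarSection b χ V V' f) {v : H} (hv : v ∈ V) : ⁅b, v⁆ ∈ V :=
  V.mul_mem (h.conj_mem v hv) (V.inv_mem hv)

theorem apply_inv (h : IsScalarSection b χ V V' f) {v : H} (hv : v ∈ V) : f v⁻¹ = -f v := by
  have hmul := h.apply_mul v hv v⁻¹ (V.inv_mem hv)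
  rw [mul_inv_cancel, (h.apply_eq_zero_iff 1 V.one_mem).2 V'.one_mem] at hmul
  exact (neg_eq_of_add_eq_zero_right hmul.symm).symm

theorem apply_commutator (h : IsScalarSection b χ V V' f) {v : H} (hv : v ∈ V) :
    f ⁅b, v⁆ = (χ - 1) * f v := by
  rw [commutatorElement_def, h.apply_mul _ (h.conj_mem v hv) _ (V.inv_mem hv), h.apply_conj v hv,
    h.apply_inv hv]
  ring

theorem commutator_mem_right (h : IsScalarSection b 1 V V' f) {v : H} (hv : v ∈ V) :
    ⁅b, v⁆ ∈ V' := by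
  rw [← h.apply_eq_zero_iff _ (h.commutator_mem hv), h.apply_commutator hv, sub_self, zero_mul]

variable [Finite H]

theorem exists_mem_map_eq (h : IsScalarSection b χ V V' f) (hχ : χ ≠ 1) {N : Subgroup H}
    (hNV : N ≤ V) (hN : ∀ z ∈ N, ⁅b, z⁆ ∈ N) {x : H} (hx : x ∈ N) :
    ∃ z ∈ N, (χ - 1) * f z = f x := by
  have hmaps : Set.MapsTo ((χ - 1) * ·) (f '' N) (f '' N) := by
    rintro _ ⟨z, hz, rfl⟩
    exact ⟨⁅b, z⁆, hN z hz, h.apply_commutator (hNV hz)⟩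
  have hinj : Set.InjOn ((χ - 1) * ·) (f '' N) :=
    (mul_right_injective₀ (sub_ne_zero.2 hχ)).injOn
  have hsurj := ((((Set.toFinite N).image f).injOn_iff_bijOn_of_mapsTo hmaps).1 hinj).surjOn
  obtain ⟨_, ⟨z, hz, rfl⟩, hzx⟩ := hsurj ⟨x, hx, rfl⟩
  exact ⟨z, hz, hzx⟩

theorem isFixedPointFree_map (h : IsScalarSection b χ V V' f) (hχ : χ ≠ 1) {Q : Type*} [Group Q]
    (ψ : H →* Q) : IsFixedPointFree (ψ b) (V.map ψ) (V'.map ψ) := by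
  rintro _ ⟨v, hv, rfl⟩ ⟨w, hw, hwv⟩
  rw [← map_commutatorElement] at hwv
  have hker {z : H} (hz : ψ z = 1) : ψ ⁅b, z⁆ = 1 := by
    rw [map_commutatorElement, hz, commutatorElement_one_right]
  obtain ⟨z, ⟨hzker, hzV⟩, hz⟩ := h.exists_mem_map_eq hχ (N := ψ.ker ⊓ V) inf_le_right
    (fun z hz => ⟨hker hz.1, h.commutator_mem hz.2⟩) (x := w⁻¹ * ⁅b, v⁆)
    ⟨MonoidHom.mem_ker.2 (by rw [map_mul, map_inv, hwv, inv_mul_cancel]),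
      V.mul_mem (V.inv_mem (h.le hw)) (h.commutator_mem hv)⟩
  have hzv : f z = f v := by
    refine mul_left_cancel₀ (sub_ne_zero.2 hχ) (hz.trans ?_)
    rw [h.apply_mul _ (V.inv_mem (h.le hw)) _ (h.commutator_mem hv), h.apply_inv (h.le hw),
      (h.apply_eq_zero_iff w (h.le hw)).2 hw, neg_zero, zero_add, h.apply_commutator hv]
  refine ⟨v * z⁻¹, (h.apply_eq_zero_iff _ (V.mul_mem hv (V.inv_mem hzV))).1 ?_, ?_⟩
  · rw [h.apply_mul v hv _ (V.inv_mem hzV), h.apply_inv hzV, hzv, add_neg_cancel]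
  · rw [map_mul, map_inv, MonoidHom.mem_ker.1 hzker, inv_one, mul_one]

end IsScalarSection

section EntrySections

variable {n : ℕ} {E : Type u} [Field E] {k : ℕ} {i j : Fin n}

theorem not_posRel_succ_of_entryPos_eq (hij : entryPos n i j = n + k) :
    ¬ posRel n (k + 1) i j := by
  unfold posRel
  lia

theorem unipotentFiltration_succ_eq (h : ∀ i j : Fin n, entryPos n i j ≠ n + k) :
    unipotentFiltration n E (k + 1) = unipotentFiltration n E k := by
  refine (unipotentFiltration_antitone k.le_succ).antisymm ?_
  refine congruenceSubgroup_mono fun i j hk => ?_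
  by_contra hk'
  exact h i j (entryPos_eq hk hk')

theorem borelMatrix_mul_sub_one_apply (hij : entryPos n i j = n + k) {v v' : borelSubgroup n E}
    (hv : v ∈ unipotentFiltration n E k) (hv' : v' ∈ unipotentFiltration n E k) :
    (borelMatrix (v * v') - 1) i j = (borelMatrix v - 1) i j + (borelMatrix v' - 1) i j := by
  have hmul : borelMatrix (v * v') - 1 = (borelMatrix v - 1) * (borelMatrix v' - 1) +
      ((borelMatrix v - 1) + (borelMatrix v' - 1)) := by
    rw [map_mul]; noncomm_ring
  have hsupp : (borelMatrix v - 1) * (borelMatrix v' - 1) ∈ supportedOn E (posRel n (k + 1)) :=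
    mul_mem_supportedOn (s := posRel n 0) (t := posRel n k)
      (fun _ _ _ h h' => posRel_succ_of_lt_left (posRel_zero_iff.1 h) h')
      (unipotentFiltration_antitone k.zero_le hv) hv'
  rw [hmul, Matrix.add_apply, hsupp i j (not_posRel_succ_of_entryPos_eq hij), zero_add,
    Matrix.add_apply]

theorem apply_eq_zero_iff_mem_unipotentFiltration_succ (hij : entryPos n i j = n + k)
    {v : borelSubgroup n E} (hv : v ∈ unipotentFiltration n E k) :
    (borelMatrix v - 1) i j = 0 ↔ v ∈ unipotentFiltration n E (k + 1) := by
  refine ⟨fun h i' j' hij' => ?_, fun h => h i j (not_posRel_succ_of_entryPos_eq hij)⟩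
  by_cases h' : posRel n k i' j'
  · obtain ⟨rfl, rfl⟩ := entryPos_injective ((entryPos_eq h' hij').trans hij.symm)
    exact h
  · exact hv i' j' h'

theorem mul_apply_of_entryPos_eq (hij : entryPos n i j = n + k) {X Y : Matrix (Fin n) (Fin n) E}
    (hX : X.IsUpperTriangular) (hY : Y ∈ supportedOn E (posRel n k)) :
    (X * Y) i j = X i i * Y i j := by
  rw [Matrix.mul_apply]
  refine Finset.sum_eq_single i (fun l _ hl => ?_) fun h => absurd (Finset.mem_univ i) h
  rcases lt_or_gt_of_ne hl with h | h
  · rw [hX h, zero_mul]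
  · rw [hY l j fun h' => not_posRel_succ_of_entryPos_eq hij (posRel_succ_of_lt_left h h'),
      mul_zero]

theorem mul_apply_of_entryPos_eq' (hij : entryPos n i j = n + k) {X Y : Matrix (Fin n) (Fin n) E}
    (hX : X ∈ supportedOn E (posRel n k)) (hY : Y.IsUpperTriangular) :
    (X * Y) i j = X i j * Y j j := by
  rw [Matrix.mul_apply]
  refine Finset.sum_eq_single j (fun l _ hl => ?_) fun h => absurd (Finset.mem_univ j) h
  rcases lt_or_gt_of_ne hl with h | h
  · rw [hX i l fun h' => not_posRel_succ_of_entryPos_eq hij (posRel_succ_of_lt_right h' h),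
      zero_mul]
  · rw [hY h, mul_zero]

theorem borelMatrix_conj_sub_one_apply (hij : entryPos n i j = n + k) (b : borelSubgroup n E)
    {v : borelSubgroup n E} (hv : v ∈ unipotentFiltration n E k) :
    (borelMatrix (b * v * b⁻¹) - 1) i j =
      diagonalCharacter i b / diagonalCharacter j b * (borelMatrix v - 1) i j := by
  have hconj : (borelMatrix (b * v * b⁻¹) - 1) * borelMatrix b =
      borelMatrix b * (borelMatrix v - 1) := by
    rw [sub_mul, mul_sub, one_mul, mul_one, ← map_mul, ← map_mul, inv_mul_cancel_right]
  have happly := congrFun (congrFun hconj i) j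
  rw [mul_apply_of_entryPos_eq' hij ((unipotentFiltration_normal k).conj_mem v hv b)
    (borelMatrix_isUpperTriangular b), mul_apply_of_entryPos_eq hij
    (borelMatrix_isUpperTriangular b) hv] at happly
  rw [div_mul_eq_mul_div, eq_div_iff (diagonalCharacter_ne_zero j b)]
  exact happly

theorem isScalarSection_unipotentFiltration (hij : entryPos n i j = n + k)
    (b : borelSubgroup n E) :
    IsScalarSection b (diagonalCharacter i b / diagonalCharacter j b) (unipotentFiltration n E k)
      (unipotentFiltration n E (k + 1)) (fun v => (borelMatrix v - 1) i j) where
  le := unipotentFiltration_antitone k.le_succ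
  conj_mem v hv := (unipotentFiltration_normal k).conj_mem v hv b
  apply_mul _ hv _ hv' := borelMatrix_mul_sub_one_apply hij hv hv'
  apply_eq_zero_iff _ hv := apply_eq_zero_iff_mem_unipotentFiltration_succ hij hv
  apply_conj _ hv := borelMatrix_conj_sub_one_apply hij b hv

theorem commutator_mem_or_isFixedPointFree {H Q : Type*} [Group H] [Finite H] [Group Q]
    (ρ : H →* borelSubgroup n E) (ψ : H →* Q) (b : H) (k : ℕ) :
    (∀ v ∈ (unipotentFiltration n E k).comap ρ,
      ⁅b, v⁆ ∈ (unipotentFiltration n E (k + 1)).comap ρ) ∨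
    IsFixedPointFree (ψ b) (((unipotentFiltration n E k).comap ρ).map ψ)
      (((unipotentFiltration n E (k + 1)).comap ρ).map ψ) := by
  by_cases hex : ∃ i j : Fin n, entryPos n i j = n + k
  · obtain ⟨i, j, hij⟩ := hex
    have h := (isScalarSection_unipotentFiltration hij (ρ b)).comap
    by_cases hχ : diagonalCharacter i (ρ b) / diagonalCharacter j (ρ b) = 1
    · rw [hχ] at h
      exact Or.inl fun v hv => h.commutator_mem_right hv
    · exact Or.inr (h.isFixedPointFree_map hχ ψ)
  · push Not at hex
    rw [unipotentFiltration_succ_eq hex]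
    exact Or.inl fun v hv => Subgroup.mul_mem _
      (Subgroup.Normal.conj_mem inferInstance v hv b) (Subgroup.inv_mem _ hv)

end EntrySections

section TriangularData

theorem lowerCentralSeries_comap_le {G H : Type*} [Group G] [Group H] (f : G →* H)
    (S : Subgroup H) (k : ℕ) :
    (S.comap f).lowerCentralSeries k ≤ (S.lowerCentralSeries k).comap f := by
  rw [← Subgroup.map_le_iff_le_comap, Subgroup.map_lowerCentralSeries]
  exact Subgroup.lowerCentralSeries_mono k (Subgroup.map_comap_le f S)

theorem commutator_le_of_commutator_pow_eq_one {Q : Type*} [Group Q] {Γ U : Subgroup Q} [Γ.Normal]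
    {p q : ℕ} (hpq : p.Coprime q) (hpow : ∀ d ∈ Γ, d ^ q ∈ U)
    (hcomm : ∀ d ∈ Γ, ∀ g : Q, ∃ a : ℕ, ⁅d, g⁆ ^ p ^ a = 1) : ⁅Γ, (⊤ : Subgroup Q)⁆ ≤ U := by
  rw [Subgroup.commutator_le]
  intro d hd g hg
  obtain ⟨a, ha⟩ := hcomm d hd g
  exact mem_of_pow_mem_of_coprime U (hpq.pow_left a) (ha ▸ U.one_mem)
    (hpow _ (Subgroup.commutator_le_left _ _ (Subgroup.commutator_mem_commutator hd hg)))

variable {n p : ℕ} {E : Type u} [Field E] {H Q : Type*} [Group H] [Group Q]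

/-- The image under `ψ` of the preimage under `ρ` of the unipotent filtration: in the application
`ψ` reduces a trigonalized group `H` modulo a normal subgroup. -/
def unipotentImage (ρ : H →* borelSubgroup n E) (ψ : H →* Q) (k : ℕ) : Subgroup Q :=
  ((unipotentFiltration n E k).comap ρ).map ψ

variable {ρ : H →* borelSubgroup n E} {ψ : H →* Q}

theorem unipotentImage_le_range (k : ℕ) : unipotentImage ρ ψ k ≤ ψ.range := by
  rw [MonoidHom.range_eq_map]
  exact Subgroup.map_mono le_top

theorem unipotentImage_succ_le (k : ℕ) : unipotentImage ρ ψ (k + 1) ≤ unipotentImage ρ ψ k :=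
  Subgroup.map_mono (Subgroup.comap_mono (unipotentFiltration_antitone k.le_succ))

theorem unipotentImage_sq (hρ : Function.Injective ρ) : unipotentImage ρ ψ (n ^ 2) = ⊥ := by
  rw [unipotentImage, unipotentFiltration_sq, MonoidHom.comap_bot, (ρ.ker_eq_bot_iff).2 hρ,
    Subgroup.map_bot]

theorem lowerCentralSeries_unipotentImage (hn : 1 ≤ n) (hρ : Function.Injective ρ) :
    (unipotentImage ρ ψ 0).lowerCentralSeries (n - 1) = ⊥ := by
  have h := lowerCentralSeries_comap_le ρ (unipotentFiltration n E 0) (n - 1)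
  rw [lowerCentralSeries_unipotentFiltration hn, MonoidHom.comap_bot,
    (ρ.ker_eq_bot_iff).2 hρ, le_bot_iff] at h
  rw [unipotentImage, ← Subgroup.map_lowerCentralSeries, h, Subgroup.map_bot]

theorem commutator_range_unipotentImage_le (k : ℕ) :
    ⁅ψ.range, unipotentImage ρ ψ k⁆ ≤ unipotentImage ρ ψ k := by
  rw [MonoidHom.range_eq_map, unipotentImage, ← Subgroup.map_commutator]
  exact Subgroup.map_mono (Subgroup.commutator_le_right _ _)

theorem commutator_unipotentImage_le (k : ℕ) :
    ⁅unipotentImage ρ ψ 0, unipotentImage ρ ψ k⁆ ≤ unipotentImage ρ ψ (k + 1) := by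
  rw [unipotentImage, unipotentImage, ← Subgroup.map_commutator]
  refine Subgroup.map_mono (Subgroup.map_le_iff_le_comap.1 ?_)
  rw [Subgroup.map_commutator]
  exact (Subgroup.commutator_mono (Subgroup.map_comap_le _ _) (Subgroup.map_comap_le _ _)).trans
    (commutator_unipotentFiltration_le k)

theorem pow_mem_unipotentImage [Fact p.Prime] [CharP E p] {d : Q} (hd : d ∈ ψ.range) :
    d ^ ordCompl[p] (Nat.card H) ∈ unipotentImage ρ ψ 0 := by
  obtain ⟨h, rfl⟩ := hd
  refine ⟨h ^ ordCompl[p] (Nat.card H), ?_, map_pow _ _ _⟩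
  have hpow : ρ h ^ (p ^ (Nat.card H).factorization p * ordCompl[p] (Nat.card H)) = 1 := by
    rw [Nat.ordProj_mul_ordCompl_eq_self, ← map_pow, pow_card_eq_one', map_one]
  simpa using pow_mem_unipotentFiltration hpow

theorem pow_eq_one_of_mem_unipotentImage [Fact p.Prime] [CharP E p] (hρ : Function.Injective ρ)
    {u : Q} (hu : u ∈ unipotentImage ρ ψ 0) : u ^ p ^ n = 1 := by
  obtain ⟨v, hv, rfl⟩ := hu
  have hv' : v ^ p ^ n = 1 := hρ (by
    rw [map_pow, map_one, pow_eq_one_of_mem_unipotentFiltration hv])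
  rw [← map_pow, hv', map_one]

theorem commutator_mem_unipotentImage_or_isFixedPointFree [Finite H] {d : Q} (hd : d ∈ ψ.range)
    (k : ℕ) : (∀ x ∈ unipotentImage ρ ψ k, ⁅d, x⁆ ∈ unipotentImage ρ ψ (k + 1)) ∨
      IsFixedPointFree d (unipotentImage ρ ψ k) (unipotentImage ρ ψ (k + 1)) := by
  obtain ⟨b, rfl⟩ := hd
  refine (commutator_mem_or_isFixedPointFree ρ ψ b k).imp_left fun h => ?_
  rintro _ ⟨v, hv, rfl⟩
  exact ⟨⁅b, v⁆, h v hv, map_commutatorElement _ _ _⟩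

theorem torusData_unipotentImage [Finite H] [Fact p.Prime] [CharP E p] (hn : 1 ≤ n)
    (hρ : Function.Injective ρ) [ψ.range.Normal] {A : Set Q} {K : ℝ}
    (hA : Subgroup.closure A = ⊤) (hinv : A⁻¹ = A) (hgrowth : SmallGrowth (A ^ 2) K) (hK : 2 ≤ K)
    (hcomm : ∀ d ∈ ψ.range, ∀ g : Q, ∃ a : ℕ, ⁅d, g⁆ ^ p ^ a = 1) :
    TorusData (n - 1) (n ^ 2) (p ^ n) (ordCompl[p] (Nat.card H)) A K ψ.range
      (unipotentImage ρ ψ 0) (unipotentImage ρ ψ) := by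
  have hcop : p.Coprime (ordCompl[p] (Nat.card H)) :=
    Nat.coprime_ordCompl Fact.out Nat.card_pos.ne'
  have hle : ⁅ψ.range, (⊤ : Subgroup Q)⁆ ≤ unipotentImage ρ ψ 0 :=
    commutator_le_of_commutator_pow_eq_one hcop (fun _ => pow_mem_unipotentImage) hcomm
  exact
    { closure_eq := hA
      inv_eq := hinv
      growth := hgrowth
      two_le := hK
      normal_U := Subgroup.commutator_top_right_le_iff.1
        ((Subgroup.commutator_mono (unipotentImage_le_range 0) le_rfl).trans hle)
      U_le := unipotentImage_le_range 0
      commutator_le := hle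
      nilp := lowerCentralSeries_unipotentImage hn hρ
      W_zero := rfl
      W_last := unipotentImage_sq hρ
      commutator_Γ_W_le := commutator_range_unipotentImage_le
      commutator_U_W_le := commutator_unipotentImage_le
      W_anti := unipotentImage_succ_le
      pow_mem := fun _ => pow_mem_unipotentImage
      pow_eq := fun _ => pow_eq_one_of_mem_unipotentImage hρ
      coprime := hcop.pow_left n
      dichotomy := fun _ hd k _ => commutator_mem_unipotentImage_or_isFixedPointFree hd k }

end TriangularData

section Reduction

variable {G Q : Type*} [Group G] [Group Q]

theorem cosetCount_image (f : G →* Q) (A : Set G) (Γ : Subgroup Q) :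
    cosetCount (f '' A) Γ = cosetCount A (Γ.comap f) := by
  let φ : G ⧸ Γ.comap f → Q ⧸ Γ := Quotient.map' f fun a b hab => by
    rw [QuotientGroup.leftRel_apply] at hab ⊢
    simpa using hab
  have hφ : Function.Injective φ := by
    rintro ⟨a⟩ ⟨b⟩ hab
    have hab' : (f a)⁻¹ * f b ∈ Γ := QuotientGroup.eq.1 hab
    exact QuotientGroup.eq.2 (by simpa using hab')
  rw [cosetCount, cosetCount, ← Set.ncard_image_of_injective _ hφ, Set.image_image,
    Set.image_image]
  rfl

theorem lowerCentralSeries_comap_subset_mul_ker (f : G →* Q) {Δ : Subgroup Q} {k : ℕ} {S : Set G}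
    (h : (Δ.lowerCentralSeries k : Set Q) ⊆ f '' S) :
    ((Δ.comap f).lowerCentralSeries k : Set G) ⊆ S * f.ker := by
  intro x hx
  obtain ⟨s, hs, hsx⟩ := h (lowerCentralSeries_comap_le f Δ k hx)
  exact ⟨s, hs, s⁻¹ * x, by simp [f.mem_ker, hsx], mul_inv_cancel_left s x⟩

theorem closure_le_normalizer_of_inv_eq {A : Set G} {H : Subgroup G} (hinv : A⁻¹ = A)
    (h : ∀ a ∈ A, ∀ x ∈ H, a * x * a⁻¹ ∈ H) : Subgroup.closure A ≤ Subgroup.normalizer H := by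
  rw [Subgroup.closure_le]
  intro a ha
  rw [SetLike.mem_coe, Subgroup.mem_normalizer_iff]
  refine fun x => ⟨h a ha x, fun hx => ?_⟩
  simpa [mul_assoc] using h a⁻¹ (hinv ▸ Set.inv_mem_inv.2 ha) _ hx

variable [Finite G] {A : Set G} {K : ℝ}

theorem exists_subgroup_eq_sq_of_tripling_lt (hA : A.Nonempty) (hinv : A⁻¹ = A)
    (h : ((A ^ 3).ncard : ℝ) ≤ K * A.ncard) (hK : K < 3 / 2) :
    ∃ H : Subgroup G, (H : Set G) = A ^ 2 := by
  classical
  have hlt : ((A ^ 2).ncard : ℝ) < 3 / 2 * A.ncard := by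
    have hpos : (0 : ℝ) < A.ncard := by exact_mod_cast (Set.ncard_pos).2 hA
    calc ((A ^ 2).ncard : ℝ) ≤ (A ^ 3).ncard := by
          exact_mod_cast ncard_pow_le_ncard_pow hA (Nat.le_succ 2)
      _ ≤ K * A.ncard := h
      _ < 3 / 2 * A.ncard := by gcongr
  obtain ⟨F, rfl⟩ := A.toFinite.exists_finset_coe
  rw [sq, ← Finset.coe_mul, Set.ncard_coe_finset, Set.ncard_coe_finset] at hlt
  have hlt' : ((F * F).card : ℚ) < (3 / 2 : ℚ) * F.card := by
    rw [← Rat.cast_lt (K := ℝ)]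
    push_cast
    exact hlt
  refine ⟨F.invMulSubgroup hlt', ?_⟩
  rw [Finset.invMulSubgroup_eq_inv_mul, Finset.coe_inv, hinv, sq]

theorem exists_normal_subgroup_eq_sq_of_tripling_lt (hA : A.Nonempty) (hinv : A⁻¹ = A)
    (hclosure : Subgroup.closure A = ⊤) (h : ((A ^ 3).ncard : ℝ) ≤ K * A.ncard)
    (hK : K < 3 / 2) : ∃ H : Subgroup G, H.Normal ∧ ∀ j ≠ 0, A ^ (2 * j) = H := by
  obtain ⟨H, hH⟩ := exists_subgroup_eq_sq_of_tripling_lt hA hinv h hK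
  have hpow (j : ℕ) (hj : j ≠ 0) : A ^ (2 * j) = H := by rw [pow_mul, ← hH, coe_set_pow hj]
  have hconj : ∀ a ∈ A, ∀ x ∈ H, a * x * a⁻¹ ∈ H := by
    intro a ha x hx
    rw [← SetLike.mem_coe, hH] at hx
    rw [← SetLike.mem_coe, ← hpow 2 two_ne_zero, show 2 * 2 = 1 + 2 + 1 from rfl, pow_add, pow_add,
      pow_one]
    exact Set.mul_mem_mul (Set.mul_mem_mul ha hx) (hinv ▸ Set.inv_mem_inv.2 ha)
  refine ⟨H, ?_, hpow⟩
  rw [← Subgroup.normalizer_eq_top_iff, eq_top_iff, ← hclosure]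
  exact closure_le_normalizer_of_inv_eq hinv hconj

theorem exists_normal_subgroup_of_tripling_lt (hA : A.Nonempty) (hinv : A⁻¹ = A)
    (hclosure : Subgroup.closure A = ⊤) (h : ((A ^ 3).ncard : ℝ) ≤ K * A.ncard) (hK : K < 3 / 2)
    {Γ P : Subgroup G} [Γ.Normal] (hPΓ : P ≤ Γ) (hP : (P : Set G) ⊆ A ^ 6) (k m : ℕ) :
    ∃ Δ : Subgroup G, P ≤ Δ ∧ Δ ≤ Γ ∧ Δ.Normal ∧ cosetCount A Δ ≤ cosetCount A Γ ∧
      (Δ.lowerCentralSeries k : Set G) ⊆ A ^ (2 * m + 6) := by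
  obtain ⟨H, hH, hpow⟩ :=
    exists_normal_subgroup_eq_sq_of_tripling_lt hA hinv hclosure h hK
  refine ⟨Γ ⊓ H, le_inf hPΓ ?_, inf_le_left, inferInstance, ?_, ?_⟩
  · rw [← SetLike.coe_subset_coe, ← hpow 3 three_ne_zero]
    exact hP
  · have hle : (A⁻¹ * A ∩ Γ : Set G) ⊆ H := by
      rw [hinv, ← sq, ← hpow 1 one_ne_zero]
      exact Set.inter_subset_left
    exact (cosetCount_inf_le A Γ H).trans (mul_le_of_le_one_right' (cosetCount_le_one hle))
  · rw [show 2 * m + 6 = 2 * (m + 3) by ring, hpow _ (by lia), SetLike.coe_subset_coe]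
    exact (Subgroup.lowerCentralSeries_le_self _ _).trans inf_le_right

end Reduction

section TrigonalizableSections

variable {n : ℕ}

theorem IsTrigonalizable.exists_injective_hom {F : Type u} [Field F] {B : Subgroup (GL (Fin n) F)}
    (h : IsTrigonalizable B) (p : ℕ) [CharP F p] :
    ∃ (E : Type u) (_ : Field E) (_ : CharP E p) (ρ : B →* borelSubgroup n E),
      Function.Injective ρ := by
  obtain ⟨E, _, _, g, hg⟩ := h
  let f : GL (Fin n) F →* GL (Fin n) E :=
    (MulAut.conj g).toMonoidHom.comp (Matrix.GeneralLinearGroup.map (algebraMap F E))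
  have hf : Function.Injective f := (MulAut.conj g).injective.comp
    (Units.map_injective (Matrix.map_injective (algebraMap F E).injective))
  have hmem (b : B) : f b ∈ borelSubgroup n E := hg ⟨_, ⟨b, b.2, rfl⟩, rfl⟩
  refine ⟨E, inferInstance, charP_of_injective_algebraMap (algebraMap F E).injective p,
    (f.comp B.subtype).codRestrict _ hmem, ?_⟩
  exact fun a b hab => Subtype.ext (hf (congrArg Subtype.val hab))

theorem SmallGrowth.image_sq_of_tripling {G Q : Type*} [Group G] [Finite G] [Group Q] {A : Set G}
    {K : ℝ} (hA : A.Nonempty) (hinv : A⁻¹ = A) (htrip : ((A ^ 3).ncard : ℝ) ≤ K * A.ncard)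
    (π : G →* Q) : SmallGrowth ((π '' A) ^ 2) (K ^ 6) := by
  simpa only [Set.image_pow, ← pow_mul] using (SmallGrowth.of_tripling hA hinv htrip).image π

/-- The hypotheses of the main theorem inside `G = ⟨A⟩`, with the trigonalizable subgroup covering
`Γ / P` given by a map `φ : H →* G` and an upper triangular form `ρ` of `H`, and with the trivial
action on `(Γ / P) / O_p(Γ / P)` expressed by commutators. -/
structure TrigonalizedSection {G H E : Type*} [Group G] [Group H] [Field E] (p c : ℕ) (A : Set G)
    (K : ℝ) (Γ P : Subgroup G) (φ : H →* G) (ρ : H →* borelSubgroup n E) : Prop where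
  nonempty : A.Nonempty
  inv_eq : A⁻¹ = A
  closure_eq : Subgroup.closure A = ⊤
  tripling : ((A ^ 3).ncard : ℝ) ≤ K * A.ncard
  cosetCount_le : (cosetCount A Γ : ℝ) ≤ K ^ c
  normal_Γ : Γ.Normal
  normal_P : P.Normal
  subset_pow : (P : Set G) ⊆ A ^ 6
  range_sup_eq : φ.range ⊔ P = Γ
  injective : Function.Injective ρ
  exists_commutator_pow_mem : ∀ x ∈ Γ, ∀ g : G, ∃ a : ℕ, ⁅x, g⁆ ^ p ^ a ∈ P

namespace TrigonalizedSection

section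

variable {G H E Q : Type*} [Group G] [Group H] [Field E] [Group Q] {p c : ℕ} {A : Set G} {K : ℝ}
  {Γ P : Subgroup G} {φ : H →* G} {ρ : H →* borelSubgroup n E}

theorem le (h : TrigonalizedSection p c A K Γ P φ ρ) : P ≤ Γ :=
  h.range_sup_eq ▸ le_sup_right

theorem one_le [Finite G] (h : TrigonalizedSection p c A K Γ P φ ρ) : 1 ≤ K :=
  one_le_of_tripling h.nonempty h.tripling

theorem range_comp_eq_map (h : TrigonalizedSection p c A K Γ P φ ρ) {π : G →* Q}
    (hker : π.ker = P) : (π.comp φ).range = Γ.map π := by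
  rw [MonoidHom.range_comp, ← h.range_sup_eq, Subgroup.map_sup,
    (Subgroup.map_eq_bot_iff P).2 hker.ge, sup_bot_eq]

theorem torusData [Finite G] [Finite H] [Fact p.Prime] [CharP E p]
    (h : TrigonalizedSection p c A K Γ P φ ρ) (hn : 1 ≤ n) (hK : 3 / 2 ≤ K) {π : G →* Q}
    (hπ : Function.Surjective π) (hker : π.ker = P) :
    TorusData (n - 1) (n ^ 2) (p ^ n) (ordCompl[p] (Nat.card H)) (π '' A) (K ^ 6) (Γ.map π)
      (unipotentImage ρ (π.comp φ) 0) (unipotentImage ρ (π.comp φ)) := by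
  have hrange := h.range_comp_eq_map hker
  have : (π.comp φ).range.Normal := hrange ▸ h.normal_Γ.map π hπ
  have hK6 : 2 ≤ K ^ 6 := calc
    (2 : ℝ) ≤ (3 / 2) ^ 6 := by norm_num
    _ ≤ K ^ 6 := by gcongr
  rw [← hrange]
  refine torusData_unipotentImage hn h.injective ?_ (by rw [← Set.image_inv, h.inv_eq])
    (SmallGrowth.image_sq_of_tripling h.nonempty h.inv_eq h.tripling π) hK6 ?_
  · rw [← MonoidHom.map_closure, h.closure_eq, Subgroup.map_top_of_surjective π hπ]
  · rw [hrange]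
    rintro _ ⟨x, hx, rfl⟩ y
    obtain ⟨g, rfl⟩ := hπ y
    obtain ⟨a, ha⟩ := h.exists_commutator_pow_mem x hx g
    exact ⟨a, by rwa [← hker, π.mem_ker, map_pow, map_commutatorElement] at ha⟩

end

theorem exists_normal_subgroup_of_le (hn : 2 ≤ n) (c : ℕ) :
    ∃ C m : ℕ, ∀ {G H E : Type u} [Group G] [Finite G] [Group H] [Finite H] [Field E] {p : ℕ}
      [Fact p.Prime] [CharP E p] {A : Set G} {K : ℝ} {Γ P : Subgroup G} {φ : H →* G}
      {ρ : H →* borelSubgroup n E}, TrigonalizedSection p c A K Γ P φ ρ → 3 / 2 ≤ K →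
      ∃ Δ : Subgroup G, P ≤ Δ ∧ Δ ≤ Γ ∧ Δ.Normal ∧ (cosetCount A Δ : ℝ) ≤ K ^ (6 * C) ∧
        (Δ.lowerCentralSeries (n - 1) : Set G) ⊆ A ^ (2 * m + 6) := by
  obtain ⟨C, m, hTorus⟩ := TorusData.exists_normal_subgroup.{u} (n - 1) (n ^ 2) c (by lia)
  refine ⟨C, m, ?_⟩
  intro G H E _ _ _ _ _ p _ _ A K Γ P φ ρ h hK
  have := h.normal_P
  set π := QuotientGroup.mk' P
  have hπ : Function.Surjective π := QuotientGroup.mk'_surjective P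
  have hker : π.ker = P := QuotientGroup.ker_mk' P
  have hcomap : (Γ.map π).comap π = Γ := Subgroup.comap_map_eq_self (hker.trans_le h.le)
  have hcount : (cosetCount (π '' A) (Γ.map π) : ℝ) ≤ (K ^ 6) ^ c := by
    rw [cosetCount_image, hcomap]
    exact h.cosetCount_le.trans (pow_le_pow_left₀ (zero_le_one.trans h.one_le)
      (le_self_pow₀ h.one_le (by norm_num)) c)
  obtain ⟨Δ, hΔΓ, hΔ, hcountΔ, hγ⟩ := hTorus (h.torusData (by lia) hK hπ hker) hcount
  refine ⟨Δ.comap π, hker.symm.trans_le (π.ker_le_comap Δ), ?_, hΔ.comap π, ?_, ?_⟩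
  · exact (Subgroup.comap_mono hΔΓ).trans hcomap.le
  · rwa [← cosetCount_image, pow_mul]
  · rw [← pow_mul, ← Set.image_pow] at hγ
    rw [pow_add]
    exact (lowerCentralSeries_comap_subset_mul_ker π hγ).trans
      (Set.mul_subset_mul_left (hker.symm ▸ h.subset_pow))

theorem exists_normal_subgroup (hn : 2 ≤ n) (c : ℕ) :
    ∃ C m : ℕ, ∀ {G H E : Type u} [Group G] [Finite G] [Group H] [Finite H] [Field E] {p : ℕ}
      [Fact p.Prime] [CharP E p] {A : Set G} {K : ℝ} {Γ P : Subgroup G} {φ : H →* G}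
      {ρ : H →* borelSubgroup n E}, TrigonalizedSection p c A K Γ P φ ρ →
      ∃ Δ : Subgroup G, P ≤ Δ ∧ Δ ≤ Γ ∧ Δ.Normal ∧ (cosetCount A Δ : ℝ) ≤ K ^ C ∧
        (Δ.lowerCentralSeries (n - 1) : Set G) ⊆ A ^ m := by
  obtain ⟨C, m, hlarge⟩ := exists_normal_subgroup_of_le.{u} hn c
  refine ⟨6 * C + c, 2 * m + 6, ?_⟩
  intro G H E _ _ _ _ _ p _ _ A K Γ P φ ρ h
  rcases lt_or_ge K (3 / 2) with hK | hK
  · have := h.normal_Γ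
    obtain ⟨Δ, hPΔ, hΔΓ, hΔ, hcountΔ, hγ⟩ := exists_normal_subgroup_of_tripling_lt h.nonempty
      h.inv_eq h.closure_eq h.tripling hK h.le h.subset_pow (n - 1) m
    exact ⟨Δ, hPΔ, hΔΓ, hΔ, (Nat.cast_le.2 hcountΔ).trans (h.cosetCount_le.trans
      (pow_le_pow_right₀ h.one_le (Nat.le_add_left _ _))), hγ⟩
  · obtain ⟨Δ, hPΔ, hΔΓ, hΔ, hcountΔ, hγ⟩ := hlarge h hK
    exact ⟨Δ, hPΔ, hΔΓ, hΔ, hcountΔ.trans (pow_le_pow_right₀ h.one_le (Nat.le_add_right _ _)), hγ⟩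

end TrigonalizedSection

end TrigonalizableSections

section Subgroups

variable {L : Type u} [Group L] {G Γ P B : Subgroup L}

theorem normal_subgroupOf_of_characteristic (hP : P ≤ Γ) (hΓ : Γ ≤ G) (hn : (Γ.subgroupOf G).Normal)
    [hchar : (P.subgroupOf Γ).Characteristic] : (P.subgroupOf G).Normal := by
  rw [Subgroup.normal_subgroupOf_iff_le_normalizer hΓ] at hn
  rw [Subgroup.normal_subgroupOf_iff (hP.trans hΓ)]
  intro x g hx hg
  exact Subgroup.characteristic_iff_le_comap.1 hchar (Γ.normalizerMonoidHom ⟨g, hn hg⟩)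
    (show (⟨x, hP hx⟩ : Γ) ∈ P.subgroupOf Γ from hx)

theorem exists_commutator_pow_mem_of_actsTriviallyMod {p : ℕ} [(P.subgroupOf Γ).Normal]
    (hΓ : Γ ≤ G) (hn : (Γ.subgroupOf G).Normal)
    (hact : ActsTriviallyMod G Γ P (pCore p (SectionOf Γ P))) {x g : L} (hx : x ∈ Γ)
    (hg : g ∈ G) : ∃ a : ℕ, ⁅x, g⁆ ^ p ^ a ∈ P := by
  let y : Γ := ⟨x, hx⟩
  let z : Γ := ⟨g * x * g⁻¹, (Subgroup.normal_subgroupOf_iff hΓ).1 hn x g hx hg⟩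
  have hzy : (QuotientGroup.mk (QuotientGroup.mk z : SectionOf Γ P) :
      SectionOf Γ P ⧸ pCore p (SectionOf Γ P)) = QuotientGroup.mk (QuotientGroup.mk y) :=
    hact g hg y z rfl
  have hmem : (QuotientGroup.mk (y * z⁻¹) : SectionOf Γ P) ∈ pCore p (SectionOf Γ P) := by
    rw [← QuotientGroup.eq_one_iff, QuotientGroup.mk_mul, QuotientGroup.mk_inv,
      QuotientGroup.mk_mul, QuotientGroup.mk_inv, hzy, mul_inv_cancel]
  obtain ⟨a, ha⟩ := (pCore_isGreatest p (SectionOf Γ P)).1.2 ⟨_, hmem⟩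
  have hpow : (QuotientGroup.mk ((y * z⁻¹) ^ p ^ a) : SectionOf Γ P) = 1 :=
    congrArg Subtype.val ha
  refine ⟨a, ?_⟩
  have hcomm : ⁅x, g⁆ = x * (g * x * g⁻¹)⁻¹ := by
    simp only [commutatorElement_def]
    group
  rw [hcomm]
  exact Subgroup.mem_subgroupOf.1 ((QuotientGroup.eq_one_iff (N := P.subgroupOf Γ) _).1 hpow)

theorem sup_eq_of_sectionTrace_eq_univ (hB : B ≤ Γ) (hP : P ≤ Γ)
    (h : sectionTrace (B : Set L) Γ P = Set.univ) : B ⊔ P = Γ := by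
  refine le_antisymm (sup_le hB hP) fun x hx => ?_
  obtain ⟨b, hb, hbx⟩ : (QuotientGroup.mk (⟨x, hx⟩ : Γ) : SectionOf Γ P) ∈
    sectionTrace (B : Set L) Γ P := h ▸ Set.mem_univ _
  have hbxP : b⁻¹ * ⟨x, hx⟩ ∈ P.subgroupOf Γ := QuotientGroup.eq.1 hbx
  rw [← mul_inv_cancel_left (b : L) x]
  exact Subgroup.mul_mem_sup hb hbxP

theorem lowerCentralTerm_map {L' : Type u} [Group L'] (f : L →* L') (k : ℕ) (D : Subgroup L) :
    lowerCentralTerm k (D.map f) = (D.lowerCentralSeries (k - 1)).map f :=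
  (Subgroup.map_lowerCentralSeries _ _ _).symm

theorem closure_eq_top_of_eq_closure_image {A : Set G}
    (hG : G = Subgroup.closure (G.subtype '' A)) : Subgroup.closure A = ⊤ := by
  apply Subgroup.map_injective G.subtype_injective
  rw [MonoidHom.map_closure, ← hG, ← MonoidHom.range_eq_map, Subgroup.range_subtype]

theorem trigonalizedSection_inclusion {E : Type u} [Field E] {n p c : ℕ} {K : ℝ} {A : Set G}
    [(P.subgroupOf Γ).Characteristic] {ρ : B →* borelSubgroup n E} (hA : A.Nonempty)
    (hinv : (G.subtype '' A)⁻¹ = G.subtype '' A)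
    (htrip : (((G.subtype '' A) ^ 3).ncard : ℝ) ≤ K * (G.subtype '' A).ncard)
    (hG : G = Subgroup.closure (G.subtype '' A)) (hΓ : Γ ≤ G) (hn : (Γ.subgroupOf G).Normal)
    (hP : P ≤ Γ) (hcount : (cosetCount (G.subtype '' A) Γ : ℝ) ≤ K ^ c)
    (hPA : (P : Set L) ⊆ (G.subtype '' A) ^ 6) (hB : B ≤ Γ)
    (hBP : sectionTrace (B : Set L) Γ P = Set.univ) (hρ : Function.Injective ρ)
    (hact : ActsTriviallyMod G Γ P (pCore p (SectionOf Γ P))) :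
    TrigonalizedSection p c A K (Γ.subgroupOf G) (P.subgroupOf G)
      (Subgroup.inclusion (hB.trans hΓ)) ρ where
  nonempty := hA
  inv_eq := G.subtype_injective.image_injective (by rw [Set.image_inv, hinv])
  closure_eq := closure_eq_top_of_eq_closure_image hG
  tripling := by
    rwa [← Set.image_pow, Set.ncard_image_of_injective _ G.subtype_injective,
      Set.ncard_image_of_injective _ G.subtype_injective] at htrip
  cosetCount_le := by rwa [cosetCount_image] at hcount
  normal_Γ := hn
  normal_P := normal_subgroupOf_of_characteristic hP hΓ hn
  subset_pow := by
    rw [← Set.image_pow] at hPA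
    rw [← Set.preimage_image_eq (A ^ 6) G.subtype_injective]
    exact Set.preimage_mono hPA
  range_sup_eq := by
    rw [Subgroup.inclusion_range, ← Subgroup.subgroupOf_sup (hB.trans hΓ) (hP.trans hΓ),
      sup_eq_of_sectionTrace_eq_univ hB hP hBP]
  injective := hρ
  exists_commutator_pow_mem _ hx g :=
    exists_commutator_pow_mem_of_actsTriviallyMod hΓ hn hact hx g.2

end Subgroups

theorem mainTheorem8 (n : ℕ) (hn : 2 ≤ n) (c : ℕ) :
    ∃ C m : ℕ,
      ∀ (F : Type u) [Field F] [Finite F] (p : ℕ) [CharP F p]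
        (A : Set (GL (Fin n) F)) (K : ℝ),
        A.Finite → A.Nonempty → A⁻¹ = A →
        ((A ^ 3).ncard : ℝ) ≤ K * (A.ncard : ℝ) →
        ∀ (G Γ P : Subgroup (GL (Fin n) F)),
          G = Subgroup.closure A →
          Γ ≤ G → (Γ.subgroupOf G).Normal →
          P ≤ Γ → ∀ _ : (P.subgroupOf Γ).Characteristic,
          (cosetCount A Γ : ℝ) ≤ K ^ c →
          Group.IsSolvable (SectionOf Γ P) →
          (P : Set (GL (Fin n) F)) ⊆ A ^ 6 →
          (∃ B : Subgroup (GL (Fin n) F), B ≤ Γ ∧ IsTrigonalizable B ∧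
            sectionTrace (B : Set (GL (Fin n) F)) Γ P = Set.univ) →
          ActsTriviallyMod G Γ P (pCore p (SectionOf Γ P)) →
          ∃ Δ : Subgroup (GL (Fin n) F),
            P ≤ Δ ∧ Δ ≤ Γ ∧ (Δ.subgroupOf G).Normal ∧
            (cosetCount A Δ : ℝ) ≤ K ^ C ∧
            (lowerCentralTerm n Δ : Set (GL (Fin n) F)) ⊆ A ^ m := by
  obtain ⟨C, m, hmain⟩ := TrigonalizedSection.exists_normal_subgroup.{u} hn c
  refine ⟨C, m, ?_⟩
  intro F _ _ p _ A K _ hA hinv htrip G Γ P hG hΓ hΓn hP hchar hcount _ hPA hB hact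
  have : Fact p.Prime := ⟨CharP.char_is_prime F p⟩
  obtain ⟨B, hBΓ, hBtrig, hBP⟩ := hB
  obtain ⟨E, _, _, ρ, hρ⟩ := hBtrig.exists_injective_hom p
  obtain ⟨A, rfl⟩ : ∃ A' : Set G, G.subtype '' A' = A :=
    Set.subset_range_iff_exists_image_eq.1 (by
      rw [G.coe_subtype, Subtype.range_coe, hG]
      exact Subgroup.subset_closure)
  obtain ⟨Δ, hPΔ, hΔΓ, hΔ, hcountΔ, hγ⟩ := hmain (trigonalizedSection_inclusion
    (Set.image_nonempty.1 hA) hinv htrip hG hΓ hΓn hP hcount hPA hBΓ hBP hρ hact)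
  have hcomap : (Δ.map G.subtype).comap G.subtype = Δ :=
    Subgroup.comap_map_eq_self_of_injective G.subtype_injective Δ
  refine ⟨Δ.map G.subtype, ?_, ?_, ?_, ?_, ?_⟩
  · exact fun x hx => ⟨⟨x, hΓ (hP hx)⟩, hPΔ hx, rfl⟩
  · exact Subgroup.map_le_iff_le_comap.2 hΔΓ
  · rwa [Subgroup.subgroupOf, hcomap]
  · rwa [cosetCount_image, hcomap]
  · rw [lowerCentralTerm_map, Subgroup.coe_map, ← Set.image_pow]
    exact Set.image_mono hγ
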